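/- **Setting.** Let $\Omega\subset\mathbb R^d$ be a bounded open set, $T,\kappa>0$, and let $A$ be the Laplacian. Let $\{(\lambda_i,\phi_i)\}_{i\ge 1}$ be the full system of eigenpairs of $-A\phi_i=\lambda_i\phi_i$ in $\Omega$ with zero boundary condition (i.e. $\phi_i\in H^1_0(\Omega)$), the $\phi_i$ being orthonormal in $L^2=L^2(\Omega)$. For $s\ge 0$ put $$\check H^{s}=\Big\{q\in L^2:\ \|q\|_{\check H^s}^2:=\sum_{i\ge 1}\lambda_i^{s}\,(q,\phi_i)^2<\infty\Big\}.$$ Let $\alpha:[0,T]\to(1,2)$ be three times differentiable with $|\alpha'|+|\alpha''|+|\alpha'''|\le L$ on $[0,T]$ for some $L$, and set $\alpha_0=\alpha(0)$ and $k(t)=t^{1-\alpha(t)}/\Gamma(2-\alpha(t))$. Consider the variable-exponent diffusion-wave problem $$\int_0^t k(t-s)\,\partial_s^2u(s)\,ds-\kappa A u(t)=f(t)\quad\text{in }\Omega,\ t\in(0,T],$$ $$u(0)=u_0,\qquad \partial_tu(0)=\bar u_0,\qquad u=0\ \text{ on }\partial\Omega\times[0,T].$$ By a solution in $W^{2,p}(0,T;L^2)\cap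 L^p(0,T;\check H^2)$ we mean a function $u$ of this class that satisfies the equation in $L^2$ for almost every $t$ ($A u(t)$ being the distributional Laplacian), with $u(t)\in H^1_0(\Omega)$ for almost every $t$, and whose continuous representatives of $u$ and $\partial_tu$ take the prescribed values at $t=0$. **Theorem.** Let $1<p<\frac1{2-\alpha_0}$. There is a constant $Q>0$, independent of $f$, $u_0$ and $\bar u_0$, such that for all $f\in W^{1,1}(0,T;L^2)$ and $u_0,\bar u_0\in\check H^2$ the problem has a unique solution $u\in W^{2,p}(0,T;L^2)\cap L^p(0,T;\check H^2)$, and $$\|u\|_{W^{2,p}(0,T;L^2)}+\|u\|_{L^p(0,T;\check H^2)}\le Q\big(\|f\|_{W^{1,1}(0,T;L^2)}+\|u_0\|_{\check H^2}+\|\bar u_0\|_{\check H^2}\big).$$ -/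

import Mathlib

open MeasureTheory Set Filter Topology
open TopologicalSpace (Opens)
open scoped ENNReal Laplacian Distributions

namespace DiffusionWave

section Space

variable {d : ℕ}

/-- The Hilbert space `L²(Ω)` of real square-integrable functions. -/
abbrev L2 (Ω : Opens (EuclideanSpace ℝ (Fin d))) : Type :=
  Lp ℝ 2 ((volume : Measure (EuclideanSpace ℝ (Fin d))).restrict
    (Ω : Set (EuclideanSpace ℝ (Fin d))))

/-- `v ∈ H¹₀(Ω)`, the closure of `C₀^∞(Ω)` in `H¹(Ω)`: there are test functions converging to `v`
in `L²(Ω)` all of whose first partial derivatives converge in `L²(Ω)`. -/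
def MemH10 (Ω : Opens (EuclideanSpace ℝ (Fin d))) (v : L2 Ω) : Prop :=
  ∃ (ψ : ℕ → 𝓓(Ω, ℝ)) (G : Fin d → L2 Ω),
    Tendsto (fun n => eLpNorm (fun x => ψ n x - v x) 2
      (volume.restrict (Ω : Set (EuclideanSpace ℝ (Fin d))))) atTop (𝓝 0) ∧
    ∀ j, Tendsto (fun n => eLpNorm
      (fun x => fderiv ℝ (ψ n) x (EuclideanSpace.single j 1) - G j x) 2
      (volume.restrict (Ω : Set (EuclideanSpace ℝ (Fin d))))) atTop (𝓝 0)

/-- `A v = h` on `Ω` in the sense of distributions, where `A` is the Laplacian. -/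
def HasWeakLaplacian (Ω : Opens (EuclideanSpace ℝ (Fin d))) (v h : L2 Ω) : Prop :=
  ∀ ψ : 𝓓(Ω, ℝ),
    ∫ x in (Ω : Set (EuclideanSpace ℝ (Fin d))), v x * Laplacian.laplacian (ψ : _ → ℝ) x =
      ∫ x in (Ω : Set (EuclideanSpace ℝ (Fin d))), h x * ψ x

/-- `- A w = μ w` in `Ω` with the zero boundary condition. -/
def IsEigenpair (Ω : Opens (EuclideanSpace ℝ (Fin d))) (μ : ℝ) (w : L2 Ω) : Prop :=
  MemH10 Ω w ∧ HasWeakLaplacian Ω w (-(μ • w))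

/-- `{(lam i, φ i)}` is the full system of eigenpairs of `- A` with the zero boundary condition:
the `φ i` are orthonormal eigenfunctions, and no eigenfunction is missing. -/
structure IsEigensystem (Ω : Opens (EuclideanSpace ℝ (Fin d)))
    (lam : ℕ → ℝ) (φ : ℕ → L2 Ω) : Prop where
  orthonormal : Orthonormal ℝ φ
  eigenpair : ∀ i, IsEigenpair Ω (lam i) (φ i)
  exhaustive : ∀ (μ : ℝ) (w : L2 Ω), IsEigenpair Ω μ w →
    w ∈ (Submodule.span ℝ (range φ)).topologicalClosure

/-- The norm `(∑ i, (lam i) ^ s * (q, φ i) ^ 2) ^ (1/2)` of `q` in `Ȟ^s(Ω)`, possibly `∞`;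
the space `Ȟ^s(Ω)` consists of the `q ∈ L²(Ω)` for which it is finite. -/
noncomputable def hNorm {Ω : Opens (EuclideanSpace ℝ (Fin d))}
    (lam : ℕ → ℝ) (φ : ℕ → L2 Ω) (s : ℝ) (q : L2 Ω) : ℝ≥0∞ :=
  (∑' i, ENNReal.ofReal (lam i ^ s * (inner ℝ q (φ i)) ^ 2)) ^ (1 / 2 : ℝ)

end Space

section Time

variable {X : Type*} [NormedAddCommGroup X] [NormedSpace ℝ X]

/-- The open time interval `(0, T)`. -/
def timeInterval (T : ℝ) : Opens ℝ := ⟨Ioo 0 T, isOpen_Ioo⟩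

/-- `v` is the `j`-th weak derivative of `u` on `(0, T)`. -/
def IsWeakDeriv (T : ℝ) (j : ℕ) (u v : ℝ → X) : Prop :=
  LocallyIntegrableOn u (Ioo 0 T) ∧ LocallyIntegrableOn v (Ioo 0 T) ∧
  ∀ ψ : 𝓓(timeInterval T, ℝ),
    ∫ t in Ioo 0 T, iteratedDeriv j (ψ : ℝ → ℝ) t • u t =
      (-1 : ℝ) ^ j • ∫ t in Ioo 0 T, ψ t • v t

open Classical in
/-- The `j`-th weak derivative of `u` on `(0, T)` (unique almost everywhere; `0` if there is
none). -/
noncomputable def weakDeriv (T : ℝ) (j : ℕ) (u : ℝ → X) : ℝ → X :=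
  if h : ∃ v, IsWeakDeriv T j u v then h.choose else 0

/-- `u ∈ W^{m,p}(0, T; X)`. -/
def MemSobolev (m : ℕ) (p T : ℝ) (u : ℝ → X) : Prop :=
  ∀ j ≤ m, ∃ v, IsWeakDeriv T j u v ∧
    MemLp v (ENNReal.ofReal p) (volume.restrict (Ioo 0 T))

/-- The norm `(∑_{j ≤ m} ‖∂_t^j u‖_{L^p(0,T;X)}^p)^{1/p}` of `u` in `W^{m,p}(0, T; X)`. -/
noncomputable def sobolevNorm (m : ℕ) (p T : ℝ) (u : ℝ → X) : ℝ≥0∞ :=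
  (∑ j ∈ Finset.range (m + 1),
    eLpNorm (weakDeriv T j u) (ENNReal.ofReal p) (volume.restrict (Ioo 0 T)) ^ p) ^ (1 / p)

/-- `v(0) = x`, for the representative of `v` that is continuous on `[0, T]`. -/
def HasInitialValue (T : ℝ) (v : ℝ → X) (x : X) : Prop :=
  ∃ c : ℝ → X, ContinuousOn c (Icc 0 T) ∧
    (∀ᵐ t ∂(volume.restrict (Ioo 0 T)), v t = c t) ∧ c 0 = x

end Time

/-- The variable-exponent Abel kernel `k(t) = t^{1-α(t)} / Γ(2-α(t))`. -/
noncomputable def kernel (α : ℝ → ℝ) (t : ℝ) : ℝ :=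
  t ^ (1 - α t) / Real.Gamma (2 - α t)

/-- `α` is three times differentiable on `[0, T]`, with `|α'| + |α''| + |α'''| ≤ L` and
`1 < α < 2` there. -/
structure IsAdmissibleExponent (T L : ℝ) (α : ℝ → ℝ) : Prop where
  range : ∀ t ∈ Icc 0 T, 1 < α t ∧ α t < 2
  differentiable : ∀ j < 3,
    DifferentiableOn ℝ (iteratedDerivWithin j α (Icc 0 T)) (Icc 0 T)
  bound : ∀ t ∈ Icc 0 T,
    |iteratedDerivWithin 1 α (Icc 0 T) t| + |iteratedDerivWithin 2 α (Icc 0 T) t| +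
      |iteratedDerivWithin 3 α (Icc 0 T) t| ≤ L

section Problem

variable {d : ℕ} {Ω : Opens (EuclideanSpace ℝ (Fin d))}

/-- The variable-exponent fractional derivative `(k * ∂_t² u)(t) = ∫₀ᵗ k(t-s) ∂_s² u(s) ds`. -/
noncomputable def fracDeriv (α : ℝ → ℝ) (T : ℝ) (u : ℝ → L2 Ω) (t : ℝ) : L2 Ω :=
  ∫ s in (0 : ℝ)..t, kernel α (t - s) • weakDeriv T 2 u s

/-- `u ∈ L^p(0, T; Ȟ^s(Ω))`. -/
def MemLpH (lam : ℕ → ℝ) (φ : ℕ → L2 Ω) (s p T : ℝ) (u : ℝ → L2 Ω) : Prop :=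
  AEStronglyMeasurable u (volume.restrict (Ioo 0 T)) ∧
  (∀ᵐ t ∂(volume.restrict (Ioo 0 T)), hNorm lam φ s (u t) < ∞) ∧
  ∫⁻ t in Ioo 0 T, hNorm lam φ s (u t) ^ p < ∞

/-- The norm of `u` in `L^p(0, T; Ȟ^s(Ω))`. -/
noncomputable def lpHNorm (lam : ℕ → ℝ) (φ : ℕ → L2 Ω) (s p T : ℝ) (u : ℝ → L2 Ω) : ℝ≥0∞ :=
  (∫⁻ t in Ioo 0 T, hNorm lam φ s (u t) ^ p) ^ (1 / p)

/-- `u` is a solution in `W^{2,p}(0,T; L²) ∩ L^p(0,T; Ȟ²)` of `k * ∂_t² u - κ A u = f` in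
`Ω × (0, T)` with `u(0) = u₀`, `∂_t u(0) = u₁` and `u = 0` on the boundary of `Ω`. -/
structure IsSolution (lam : ℕ → ℝ) (φ : ℕ → L2 Ω) (α : ℝ → ℝ) (κ p T : ℝ)
    (f : ℝ → L2 Ω) (u₀ u₁ : L2 Ω) (u : ℝ → L2 Ω) : Prop where
  memSobolev : MemSobolev 2 p T u
  memLpH : MemLpH lam φ 2 p T u
  equation : ∀ᵐ t ∂(volume.restrict (Ioo 0 T)),
    IntervalIntegrable (fun s => kernel α (t - s) • weakDeriv T 2 u s) volume 0 t ∧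
    ∃ h : L2 Ω, HasWeakLaplacian Ω (u t) h ∧ fracDeriv α T u t - κ • h = f t
  boundary : ∀ᵐ t ∂(volume.restrict (Ioo 0 T)), MemH10 Ω (u t)
  initial_value : HasInitialValue T u u₀
  initial_velocity : HasInitialValue T (weakDeriv T 1 u) u₁

end Problem

end DiffusionWave

/-! Write `*` for convolution on `(0, t)`, put `w = ∂_t² u` and `f = F₀ + ∫ f'`, so that `u = u₀ + t
u₁ + t * w`. With `l₀ = -A u₀` and `l₁ = -A u₁`, the coefficients in the eigenbasis satisfy
decoupled scalar Volterra equations `k * wᵢ + κ λᵢ (t * wᵢ) = xᵢ + 1 * yᵢ`, where `x = F₀ - κ l₀`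
and `y = f' - κ l₁`. If `ρᵢ` is a resolvent kernel, meaning `k * ρᵢ + κ λᵢ (t * ρᵢ) = 1`, then `wᵢ =
ρᵢ xᵢ + ρᵢ * yᵢ` solves the equation. Convolving the homogeneous equation with `ρᵢ` gives uniqueness
(`ae_vconv_id_eq_zero`).

Everything rests on a bound `|ρᵢ(t)| ≤ C t^(α₀-2)` with `C` independent of the eigenvalue
(`exists_resolvent_kernel`). By Bessel's inequality it gives `‖w‖ ≤ g ‖x‖ + g * ‖y‖` with `g = C
t^(α₀-2)` (`exists_diagonal_convolution`). Since `p (2 - α₀) < 1`, `g` is in `L^p`, and Young's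
inequality puts `w` in `L^p` although `y` is only integrable in time. The `Ȟ²` norm of `u` is then
read off from `κ A u = k * w - f`.

The kernel is built in two stages. For constant order, the Laplace transform suggests the inverse
transform of `z / (z^α + μ)`. It is written as an integral over two rays, bounded by `C t^(α-2)`,
and checked directly by Fubini and rotation of the rays (`im_mlJ_identity`); scaling in `t` makes
the bound uniform in `μ` (`exists_constant_order_kernel`). For variable order, `k = k₀ + 1 * q` with
`k₀` of constant order `α₀` and `q` weakly singular (`exists_kernel_decomposition`). If `s` is the
kernel of constant order, the solution of `ρ + (s * q) * ρ = s` is the required resolvent, and its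
Neumann series converges in an exponentially weighted norm (`exists_volterra_solution`).

On the spatial side, the eigenfunctions form a Hilbert basis because the inverse of `1 - A` on `H¹₀`
is compact and self-adjoint and the system omits no eigenfunction. The Poincaré inequality bounds
the eigenvalues away from `0`. -/

namespace DiffusionWave

/-! ### Contour integrals in the variable `ζ = log z`: Cauchy's theorem in strips, Gamma and Mellin
integrals -/

section Strip

open Complex

/-- The point `x + i y`. -/
noncomputable def ray (y x : ℝ) : ℂ := (x : ℂ) + (y : ℂ) * I

@[simp] lemma ray_re (y x : ℝ) : (ray y x).re = x := by simp [ray]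
@[simp] lemma ray_im (y x : ℝ) : (ray y x).im = y := by simp [ray]

@[fun_prop] lemma continuous_ray (y : ℝ) : Continuous (ray y) := by
  unfold ray; fun_prop

lemma integrable_exp_neg_mul_abs {c : ℝ} (hc : 0 < c) :
    Integrable (fun x : ℝ => Real.exp (-c * |x|)) := by
  have h1 : IntegrableOn (fun x : ℝ => Real.exp (-c * |x|)) (Ioi 0) := by
    refine (integrableOn_congr_fun (fun x hx => ?_) measurableSet_Ioi).1
      (exp_neg_integrableOn_Ioi 0 hc)
    simp [abs_of_pos (mem_Ioi.1 hx)]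
  have h2 : IntegrableOn (fun x : ℝ => Real.exp (-c * |x|)) (Iio 0) := by
    have := h1.comp_neg
    simpa using this
  have h3 : IntegrableOn (fun x : ℝ => Real.exp (-c * |x|)) (Iic 0) :=
    (integrableOn_Iic_iff_integrableOn_Iio (by simp)).2 h2
  have := h3.union h1
  rwa [Iic_union_Ioi, integrableOn_univ] at this

/-- Estimates on a line in the strip are proved separately near `z = 0` (`x ≤ 0`) and near `z = ∞`
(`x ≥ 0`), with different rates; this merges them into the form that `integral_ray_eq_integral_ray`
needs. -/
lemma le_exp_neg_min_mul_abs {a b M x r : ℝ} (hM : 0 ≤ M)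
    (h1 : x ≤ 0 → r ≤ M * Real.exp (a * x)) (h2 : 0 ≤ x → r ≤ M * Real.exp (-b * x)) :
    r ≤ M * Real.exp (-(min a b) * |x|) := by
  rcases le_total 0 x with hx | hx
  · refine (h2 hx).trans (mul_le_mul_of_nonneg_left (Real.exp_le_exp.2 ?_) hM)
    rw [abs_of_nonneg hx]
    nlinarith [min_le_right a b]
  · refine (h1 hx).trans (mul_le_mul_of_nonneg_left (Real.exp_le_exp.2 ?_) hM)
    rw [abs_of_nonpos hx]
    nlinarith [min_le_left a b]

/-- The integral of a holomorphic function that decays at both ends of a strip is the same along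
the two edges of the strip. -/
theorem integral_ray_eq_integral_ray {Ψ : ℂ → ℂ} {a b M c : ℝ} (hc : 0 < c)
    (hΨ : DifferentiableOn ℂ Ψ {ζ | ζ.im ∈ uIcc a b})
    (hbd : ∀ y ∈ uIcc a b, ∀ x : ℝ, ‖Ψ (ray y x)‖ ≤ M * Real.exp (-c * |x|)) :
    ∫ x : ℝ, Ψ (ray a x) = ∫ x : ℝ, Ψ (ray b x) := by
  have hint : ∀ y ∈ uIcc a b, Integrable (fun x : ℝ => Ψ (ray y x)) := by
    intro y hy
    refine ((integrable_exp_neg_mul_abs hc).const_mul M).mono' ?_ (Eventually.of_forall (hbd y hy))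
    have : Continuous (fun x : ℝ => Ψ (ray y x)) := by
      refine continuousOn_univ.1 (hΨ.continuousOn.comp (continuous_ray y).continuousOn ?_)
      intro x _
      simpa using hy
    exact this.aestronglyMeasurable
  -- Cauchy's theorem on the rectangle with real parts in `[-R, R]`; the two vertical sides vanish
  -- as `R → ∞`.
  have hrect : ∀ R : ℝ, (∫ x : ℝ in (-R)..R, Ψ (ray a x)) - (∫ x : ℝ in (-R)..R, Ψ (ray b x)) =
      I • (∫ y : ℝ in a..b, Ψ (ray y (-R))) - I • (∫ y : ℝ in a..b, Ψ (ray y R)) := by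
    intro R
    have := integral_boundary_rect_eq_zero_of_differentiableOn Ψ (ray a (-R)) (ray b R) (by
      refine hΨ.mono fun ζ hζ => ?_
      simpa using hζ.2)
    simp only [ray_re, ray_im] at this
    simp only [ray]
    push_cast at this ⊢
    linear_combination this
  have hvert : ∀ u : ℝ → ℝ, Tendsto (fun R => |u R|) atTop atTop →
      Tendsto (fun R : ℝ => ∫ y : ℝ in a..b, Ψ (ray y (u R))) atTop (𝓝 0) := by
    intro u hu
    have h0 : Tendsto (fun R : ℝ => M * Real.exp (-c * |u R|) * |b - a|) atTop (𝓝 0) := by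
      have : Tendsto (fun R : ℝ => Real.exp (-(c * |u R|))) atTop (𝓝 0) :=
        Real.tendsto_exp_neg_atTop_nhds_zero.comp (hu.const_mul_atTop hc)
      simpa [neg_mul] using (this.const_mul M).mul_const |b - a|
    refine squeeze_zero_norm (fun R => ?_) h0
    exact intervalIntegral.norm_integral_le_of_norm_le_const
      (fun y hy => hbd y (uIoc_subset_uIcc hy) (u R))
  have hv1 := hvert (fun R => -R) (by simpa using tendsto_abs_atTop_atTop)
  have hv2 := hvert (fun R => R) tendsto_abs_atTop_atTop
  have hl := (intervalIntegral_tendsto_integral (hint a left_mem_uIcc) tendsto_neg_atTop_atBot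
    tendsto_id).sub (intervalIntegral_tendsto_integral (hint b right_mem_uIcc)
      tendsto_neg_atTop_atBot tendsto_id)
  have hr := (hv1.const_smul I).sub (hv2.const_smul I)
  have := tendsto_nhds_unique hl (hr.congr fun R => (hrect R).symm)
  simpa [sub_eq_zero] using this

/-- The difference of the squares of the two sides is at least `(1 - cos²(φ/2)) (a - b)² ≥ 0`, by
`cos y ≥ cos φ` and the half-angle formula. Every denominator in the contour integrals is bounded
below in this way. -/
lemma norm_exp_mul_I_add_ge {a b y φ : ℝ} (ha : 0 ≤ a) (hb : 0 ≤ b) (hy : |y| ≤ φ)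
    (hφ : φ < Real.pi) :
    Real.cos (φ / 2) * (a + b) ≤ ‖(a : ℂ) * exp (y * I) + b‖ := by
  have h0 : 0 ≤ φ := (abs_nonneg y).trans hy
  have hc : 0 ≤ Real.cos (φ / 2) :=
    Real.cos_nonneg_of_mem_Icc ⟨by linarith [Real.pi_pos], by linarith⟩
  have hcos : Real.cos φ ≤ Real.cos y := by
    rw [← Real.cos_abs y]
    exact Real.cos_le_cos_of_nonneg_of_le_pi (abs_nonneg y) hφ.le hy
  have h2 : Real.cos φ = 2 * Real.cos (φ / 2) ^ 2 - 1 := by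
    rw [← Real.cos_two_mul]; congr 1; ring
  refine (sq_le_sq₀ (by positivity) (norm_nonneg _)).1 ?_
  have hn : ‖(a : ℂ) * exp (y * I) + b‖ ^ 2 = a ^ 2 + 2 * a * b * Real.cos y + b ^ 2 := by
    rw [← normSq_eq_norm_sq, normSq_apply]
    have hre : ((a : ℂ) * exp (y * I) + b).re = a * Real.cos y + b := by
      simp [exp_ofReal_mul_I_re]
    have him : ((a : ℂ) * exp (y * I) + b).im = a * Real.sin y := by
      simp [exp_ofReal_mul_I_im]
    rw [hre, him]
    nlinarith [Real.sin_sq_add_cos_sq y]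
  rw [hn, mul_pow]
  have hc1 : Real.cos (φ / 2) ^ 2 ≤ 1 := Real.cos_sq_le_one _
  nlinarith [mul_nonneg (mul_nonneg ha hb) (sub_nonneg.2 hcos), mul_nonneg (sub_nonneg.2 hc1) (sq_nonneg (a - b))]

lemma exp_ray (y x : ℝ) : exp (ray y x) = (Real.exp x : ℂ) * exp (y * I) := by
  rw [ray, exp_add, ofReal_exp]

lemma exp_mul_ray (α y x : ℝ) :
    exp (α * ray y x) = (Real.exp (α * x) : ℂ) * exp ((α * y : ℝ) * I) := by
  rw [ray, mul_add, exp_add, ofReal_exp]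
  push_cast
  ring_nf

lemma norm_exp_mul_ray (α y x : ℝ) : ‖exp (α * ray y x)‖ = Real.exp (α * x) := by
  rw [norm_exp]; simp [ray]

lemma norm_exp_ray (y x : ℝ) : ‖exp (ray y x)‖ = Real.exp x := by
  rw [norm_exp]; simp

lemma norm_exp_mul_exp_ray (t y x : ℝ) :
    ‖exp (t * exp (ray y x))‖ = Real.exp (t * Real.exp x * Real.cos y) := by
  rw [norm_exp, exp_ray]
  simp [exp_ofReal_mul_I_re, mul_assoc, exp_ofReal_re]

/-- Euler's integral for `Γ` after the substitution `r = e^x`. It is used both to represent negative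
powers and to integrate `e^{tz}` along rays. -/
lemma integral_exp_mul_exp_neg {γ c : ℝ} (hγ : 0 < γ) (hc : 0 < c) :
    Integrable (fun x : ℝ => Real.exp (γ * x) * Real.exp (-(c * Real.exp x))) ∧
      ∫ x : ℝ, Real.exp (γ * x) * Real.exp (-(c * Real.exp x)) =
        c ^ (-γ) * Real.Gamma γ := by
  have himg : Real.exp '' univ = Ioi 0 := by rw [image_univ, Real.range_exp]
  have hd : ∀ x ∈ (univ : Set ℝ), HasDerivWithinAt Real.exp (Real.exp x) univ x :=
    fun x _ => (Real.hasDerivAt_exp x).hasDerivWithinAt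
  have key : ∀ x : ℝ, |Real.exp x| • (Real.exp x ^ (γ - 1) * Real.exp (-(c * Real.exp x))) =
      Real.exp (γ * x) * Real.exp (-(c * Real.exp x)) := by
    intro x
    rw [abs_of_pos (Real.exp_pos x), smul_eq_mul, ← mul_assoc, ← Real.exp_mul, ← Real.exp_add]
    congr 2; ring
  constructor
  · have h := (integrableOn_image_iff_integrableOn_abs_deriv_smul MeasurableSet.univ hd
      Real.exp_injective.injOn (fun r => r ^ (γ - 1) * Real.exp (-(c * r)))).1 (by
        rw [himg]
        have := integrableOn_rpow_mul_exp_neg_mul_rpow (p := 1) (s := γ - 1) (b := c)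
          (by linarith) one_pos hc
        simpa using this)
    rw [integrableOn_univ] at h
    exact h.congr (Eventually.of_forall key)
  · have h := integral_image_eq_integral_abs_deriv_smul MeasurableSet.univ hd
      Real.exp_injective.injOn (fun r => r ^ (γ - 1) * Real.exp (-(c * r)))
    rw [himg, Real.integral_rpow_mul_exp_neg_mul_Ioi hγ hc, setIntegral_univ] at h
    rw [← integral_congr_ae (Eventually.of_forall key), ← h, one_div,
      Real.inv_rpow hc.le, Real.rpow_neg hc.le]

end Strip

section Strip

open Complex

lemma ray_eta (ζ : ℂ) : ray ζ.im ζ.re = ζ := by simp [ray, re_add_im]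

/-- Rotating a ray to one where the integrand is real kills the imaginary part. This discards the
unwanted terms below, which is why the identities concern imaginary parts only. -/
lemma im_integral_ray_eq_zero {Ψ : ℂ → ℂ} {a b M c : ℝ} (hc : 0 < c)
    (hΨ : DifferentiableOn ℂ Ψ {ζ | ζ.im ∈ uIcc a b})
    (hbd : ∀ y ∈ uIcc a b, ∀ x : ℝ, ‖Ψ (ray y x)‖ ≤ M * Real.exp (-c * |x|))
    (hreal : ∀ x : ℝ, (Ψ (ray b x)).im = 0) :
    (∫ x : ℝ, Ψ (ray a x)).im = 0 := by
  rw [integral_ray_eq_integral_ray hc hΨ hbd]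
  have : (fun x : ℝ => Ψ (ray b x)) = fun x : ℝ => (((Ψ (ray b x)).re : ℝ) : ℂ) := by
    funext x
    apply Complex.ext <;> simp [hreal]
  rw [this, integral_complex_ofReal, ofReal_im]

lemma integrable_comp_ray {Ψ : ℂ → ℂ} {y M c : ℝ} (hc : 0 < c)
    (hΨ : ContinuousOn Ψ {ζ | ζ.im = y})
    (hbd : ∀ x : ℝ, ‖Ψ (ray y x)‖ ≤ M * Real.exp (-c * |x|)) :
    Integrable (fun x : ℝ => Ψ (ray y x)) := by
  refine ((integrable_exp_neg_mul_abs hc).const_mul M).mono' ?_ (Eventually.of_forall hbd)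
  have : Continuous (fun x : ℝ => Ψ (ray y x)) := by
    refine continuousOn_univ.1 (hΨ.comp (continuous_ray y).continuousOn ?_)
    intro x _
    simp
  exact this.aestronglyMeasurable

lemma cos_half_pos {φ : ℝ} (h0 : 0 ≤ φ) (hφ : φ < Real.pi) : 0 < Real.cos (φ / 2) :=
  Real.cos_pos_of_mem_Ioo ⟨by linarith [Real.pi_pos], by linarith⟩

lemma norm_exp_mul_ray_add_one_ge {α y φ : ℝ} (hy : |α * y| ≤ φ) (hφ : φ < Real.pi) (x : ℝ) :
    Real.cos (φ / 2) * (Real.exp (α * x) + 1) ≤ ‖exp (α * ray y x) + 1‖ := by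
  rw [exp_mul_ray]
  simpa using norm_exp_mul_I_add_ge (Real.exp_pos (α * x)).le zero_le_one hy hφ

lemma norm_exp_ray_add_ge {b y φ : ℝ} (hb : 0 ≤ b) (hy : |y| ≤ φ) (hφ : φ < Real.pi) (x : ℝ) :
    Real.cos (φ / 2) * (Real.exp x + b) ≤ ‖exp (ray y x) + b‖ := by
  rw [exp_ray]
  exact norm_exp_mul_I_add_ge (Real.exp_pos x).le hb hy hφ

lemma norm_one_sub_exp_mul_ray_ge {α y φ : ℝ} (hy : |α * y - Real.pi| ≤ φ) (hφ : φ < Real.pi)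
    (x : ℝ) :
    Real.cos (φ / 2) * (Real.exp (α * x) + 1) ≤ ‖1 - exp (α * ray y x)‖ := by
  have h := norm_exp_mul_I_add_ge (Real.exp_pos (α * x)).le zero_le_one hy hφ
  refine h.trans (le_of_eq ?_)
  congr 1
  rw [exp_mul_ray]
  push_cast
  rw [sub_mul, exp_sub, exp_pi_mul_I]
  ring

lemma exp_add_ne_zero_of_abs_im_lt {ζ : ℂ} {b : ℝ} (hb : 0 ≤ b) (h : |ζ.im| < Real.pi) :
    exp ζ + b ≠ 0 := by
  have h1 := norm_exp_ray_add_ge hb le_rfl h ζ.re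
  rw [ray_eta] at h1
  have : 0 < Real.cos (|ζ.im| / 2) * (Real.exp ζ.re + b) :=
    mul_pos (cos_half_pos (abs_nonneg _) h) (by positivity)
  exact norm_pos_iff.1 (this.trans_le h1)

/-- The Mellin transform of `1 / (e^ζ + ·)` in logarithmic coordinates. -/
lemma integral_exp_div_exp_ray_add {β : ℝ} (h0 : 0 < β) (h1 : β < 1) {y : ℝ} (hy : |y| < Real.pi)
    (x : ℝ) :
    ∫ u : ℝ, (Real.exp ((1 - β) * u) : ℂ) / (exp (ray y x) + Real.exp u) =
      (Real.Gamma β * Real.Gamma (1 - β) : ℝ) * exp (-(β * ray y x)) := by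
  -- The case `z = 1`, without the reflection formula: write `1 / (e^u + 1)` as the integral of
  -- `e^{-(e^u + 1) r}` over `r = e^v > 0` and exchange the integrals, which produces `Γ(β) Γ(1 -
  -- β)` directly.
  have hreal : ∫ u : ℝ, Real.exp ((1 - β) * u) / (Real.exp u + 1) =
      Real.Gamma β * Real.Gamma (1 - β) := by
    let F : ℝ × ℝ → ℝ := fun q => Real.exp ((1 - β) * q.1) *
      (Real.exp (1 * q.2) * Real.exp (-((Real.exp q.1 + 1) * Real.exp q.2)))
    have hF0 : ∀ q, 0 ≤ F q := fun q => by positivity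
    have hFm : AEStronglyMeasurable F (volume.prod volume) := by
      have : Continuous F := by fun_prop
      exact this.aestronglyMeasurable
    have e2 : ∀ u v : ℝ, F (u, v) = (Real.exp v * Real.exp (-(Real.exp v))) *
        (Real.exp ((1 - β) * u) * Real.exp (-(Real.exp v * Real.exp u))) := by
      intro u v
      simp only [F, ← Real.exp_add]
      congr 1; ring_nf; rw [← Real.exp_add]; ring_nf
    have iu : ∀ v : ℝ, Integrable (fun u => F (u, v)) ∧ ∫ u, F (u, v) =
        Real.Gamma (1 - β) * (Real.exp (β * v) * Real.exp (-(1 * Real.exp v))) := by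
      intro v
      have := integral_exp_mul_exp_neg (γ := 1 - β) (c := Real.exp v) (by linarith)
        (Real.exp_pos v)
      simp only [e2]
      refine ⟨this.1.const_mul _, ?_⟩
      rw [integral_const_mul, this.2, ← Real.exp_mul, mul_comm (Real.exp _) (Real.Gamma _),
        ← mul_assoc, mul_comm _ (Real.Gamma _), mul_assoc]
      congr 1
      simp only [← Real.exp_add]
      congr 1; ring
    have iv : ∀ u : ℝ, ∫ v, F (u, v) = Real.exp ((1 - β) * u) / (Real.exp u + 1) := by
      intro u
      have := integral_exp_mul_exp_neg (γ := 1) (c := Real.exp u + 1) one_pos (by positivity)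
      simp only [F]
      rw [integral_const_mul, this.2, Real.Gamma_one, Real.rpow_neg_one]
      ring
    have hint : Integrable F (volume.prod volume) := by
      rw [integrable_prod_iff' hFm]
      refine ⟨Eventually.of_forall fun v => (iu v).1, ?_⟩
      have : (fun v : ℝ => ∫ u, ‖F (u, v)‖) = fun v => Real.Gamma (1 - β) *
          (Real.exp (β * v) * Real.exp (-(1 * Real.exp v))) := by
        funext v
        rw [← (iu v).2]
        exact integral_congr_ae (Eventually.of_forall fun u => Real.norm_of_nonneg (hF0 _))
      rw [this]
      exact (integral_exp_mul_exp_neg h0 one_pos).1.const_mul _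
    have hsw := integral_integral_swap (f := fun u v => F (u, v)) hint
    simp only [iv, fun v => (iu v).2] at hsw
    rw [hsw, integral_const_mul, (integral_exp_mul_exp_neg h0 one_pos).2]
    simp [mul_comm]
  have hcpos := cos_half_pos (abs_nonneg y) hy
  set k := Real.cos (|y| / 2)
  let G : ℂ → ℂ := fun w => exp ((1 - β : ℝ) * w) / (exp w + (1 : ℝ))
  have hstrip : ∀ w ∈ uIcc (-y) 0, |w| ≤ |y| := by
    intro w hw
    rcases le_total 0 y with h | h
    · rw [uIcc_of_le (by linarith)] at hw
      rw [abs_of_nonpos hw.2, abs_of_nonneg h]; linarith [hw.1]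
    · rw [uIcc_of_ge (by linarith)] at hw
      rw [abs_of_nonneg hw.1, abs_of_nonpos h]; linarith [hw.2]
  -- The translation `w = u - ray y x` replaces `e^ζ` by `1` at the cost of moving the line of
  -- integration to height `-y`; as `|y| < π`, it returns to height `0` without meeting a zero of
  -- `e^w + 1`.
  have hrot := integral_ray_eq_integral_ray (Ψ := G) (a := -y) (b := 0) (M := k⁻¹)
    (c := min (1 - β) β) (lt_min (by linarith) h0) (by
      intro w hw
      have : exp w + (1 : ℝ) ≠ 0 :=
        exp_add_ne_zero_of_abs_im_lt zero_le_one ((hstrip _ hw).trans_lt hy)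
      exact DifferentiableAt.differentiableWithinAt (by fun_prop (disch := exact this)))
    (by
      intro w hw u
      have hge := norm_exp_ray_add_ge zero_le_one (hstrip w hw) hy u
      have hn : ‖G (ray w u)‖ ≤ k⁻¹ * (Real.exp ((1 - β) * u) / (Real.exp u + 1)) := by
        rw [norm_div, norm_exp_mul_ray, inv_mul_eq_div, div_div, mul_comm _ k]
        exact div_le_div_of_nonneg_left (Real.exp_pos _).le (by positivity) hge
      refine le_exp_neg_min_mul_abs (by positivity) (fun _ => hn.trans ?_) (fun _ => hn.trans ?_)
      · refine mul_le_mul_of_nonneg_left (div_le_self (Real.exp_pos _).le ?_) (by positivity)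
        linarith [Real.exp_pos u]
      · refine mul_le_mul_of_nonneg_left ?_ (by positivity)
        rw [div_le_iff₀ (by positivity), mul_add, ← Real.exp_add]
        have : (1 - β) * u = -β * u + u := by ring
        rw [this]
        linarith [Real.exp_pos (-β * u)])
  have h0' : ∫ u : ℝ, G (ray 0 u) = (Real.Gamma β * Real.Gamma (1 - β) : ℝ) := by
    rw [← hreal, ← integral_complex_ofReal]
    refine integral_congr_ae (Eventually.of_forall fun u => ?_)
    simp [G, ray]
  rw [h0'] at hrot
  rw [← hrot, mul_comm, ← integral_sub_right_eq_self (fun u : ℝ => G (ray (-y) u)) x,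
    ← integral_const_mul]
  refine integral_congr_ae (Eventually.of_forall fun u => ?_)
  have hray : ray (-y) (u - x) = u - ray y x := by simp [ray]; ring
  simp only [G, hray]
  have hne1 : exp (ray y x) + Real.exp u ≠ 0 :=
    exp_add_ne_zero_of_abs_im_lt (Real.exp_pos u).le (by simpa using hy)
  have hne2 : exp ((u : ℂ) - ray y x) + (1 : ℝ) ≠ 0 := by
    refine exp_add_ne_zero_of_abs_im_lt zero_le_one ?_
    simpa using hy
  rw [mul_div_assoc', div_eq_div_iff hne1 hne2, ofReal_exp, ofReal_exp, mul_add, mul_add,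
    ← exp_add, ← exp_add, ← exp_add, ofReal_one, mul_one, ← exp_add, add_comm]
  congr 2 <;> push_cast <;> ring

end Strip

/-! ### The contour integral `mlJ` along a ray, its size and its moments -/

section Strip

open Complex

lemma im_integral_eq {X : Type*} [MeasurableSpace X] {μ : Measure X} {f : X → ℂ}
    (hf : Integrable f μ) : (∫ x, f x ∂μ).im = ∫ x, (f x).im ∂μ :=
  (imCLM.integral_comp_comm hf).symm

lemma integrable_exp_div_exp_add {β : ℝ} (h0 : 0 < β) (h1 : β < 1) (x : ℝ) :
    Integrable (fun u : ℝ => Real.exp ((1 - β) * u) / (Real.exp x + Real.exp u)) ∧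
    ∫ u : ℝ, Real.exp ((1 - β) * u) / (Real.exp x + Real.exp u) =
      Real.Gamma β * Real.Gamma (1 - β) * Real.exp (-(β * x)) := by
  constructor
  · refine ((integrable_exp_neg_mul_abs (lt_min (by linarith : 0 < 1 - β) h0)).const_mul
      (max 1 (Real.exp (-x)))).mono' ?_ (Eventually.of_forall fun u => ?_)
    · have : Continuous (fun u : ℝ => Real.exp ((1 - β) * u) / (Real.exp x + Real.exp u)) := by
        refine Continuous.div (by fun_prop) (by fun_prop) fun u => by positivity
      exact this.aestronglyMeasurable
    · rw [Real.norm_of_nonneg (by positivity)]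
      refine le_exp_neg_min_mul_abs (by positivity) (fun _ => ?_) (fun _ => ?_)
      · calc _ ≤ Real.exp ((1 - β) * u) / Real.exp x := by
              gcongr; linarith [Real.exp_pos u]
          _ = Real.exp (-x) * Real.exp ((1 - β) * u) := by rw [Real.exp_neg]; ring
          _ ≤ _ := by gcongr; exact le_max_right _ _
      · calc _ ≤ Real.exp ((1 - β) * u) / Real.exp u := by
              gcongr; linarith [Real.exp_pos x]
          _ = 1 * Real.exp (-β * u) := by rw [← Real.exp_sub, one_mul]; congr 1; ring
          _ ≤ _ := by gcongr; exact le_max_left _ _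
  · have h := integral_exp_div_exp_ray_add h0 h1 (y := 0) (by simpa using Real.pi_pos) x
    have e : (fun u : ℝ => (Real.exp ((1 - β) * u) : ℂ) / (exp (ray 0 x) + Real.exp u)) =
        fun u : ℝ => ((Real.exp ((1 - β) * u) / (Real.exp x + Real.exp u) : ℝ) : ℂ) := by
      funext u; simp [ray]
    rw [e, integral_complex_ofReal] at h
    have h2 : exp (-(β * ray 0 x)) = (Real.exp (-(β * x)) : ℝ) := by simp [ray]
    rw [h2] at h
    exact_mod_cast h

lemma norm_exp_mul_exp_ray' (t θ x : ℝ) :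
    ‖exp (t * exp (ray θ x))‖ = Real.exp (-(-Real.cos θ * t * Real.exp x)) := by
  rw [norm_exp_mul_exp_ray]; congr 1; ring

/-- `e^{2ζ} / (e^{αζ} + 1)`. -/
noncomputable def mlF (α : ℝ) (ζ : ℂ) : ℂ := exp (2 * ζ) / (exp (α * ζ) + 1)

/-- The contour integral along the two rays of argument `± θ` of
`e^{tz} z / (z ^ α + 1)`, in logarithmic coordinates. -/
noncomputable def mlJ (α θ t : ℝ) : ℂ :=
  ∫ x : ℝ, mlF α (ray θ x) * exp (t * exp (ray θ x))

/-- The exponent of the kernel lies in `(1, 2)` and the rays avoid the poles. -/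
structure RayAngle (α θ : ℝ) : Prop where
  one_lt : 1 < α
  lt_two : α < 2
  -- Past the imaginary axis `cos θ < 0`, so `e^{tz}` decays along the ray.
  half_pi_lt : Real.pi / 2 < θ
  mul_lt_pi : α * θ < Real.pi

namespace RayAngle

variable {α θ : ℝ} (h : RayAngle α θ)
include h

lemma pos : 0 < θ := by linarith [h.half_pi_lt, Real.pi_pos]

lemma mul_nonneg : 0 ≤ α * θ := by have := h.pos; have := h.one_lt; positivity

lemma lt_pi : θ < Real.pi := by nlinarith [h.mul_lt_pi, h.one_lt, h.pos]

lemma cos_pos : 0 < Real.cos (α * θ / 2) := cos_half_pos h.mul_nonneg h.mul_lt_pi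

lemma cos_pos' : 0 < Real.cos (θ / 2) := cos_half_pos h.pos.le h.lt_pi

lemma neg_cos_pos : 0 < -Real.cos θ := by
  have := Real.cos_neg_of_pi_div_two_lt_of_lt h.half_pi_lt (by linarith [h.lt_pi, Real.pi_pos])
  linarith

lemma abs_le {y : ℝ} (hy : y ∈ uIcc θ 0) : |y| ≤ θ ∧ |α * y| ≤ α * θ := by
  rw [uIcc_of_ge h.pos.le] at hy
  have := h.one_lt
  have h0 : 0 ≤ α * y := by have := hy.1; positivity
  rw [abs_of_nonneg hy.1, abs_of_nonneg h0]
  exact ⟨hy.2, by gcongr; exact hy.2⟩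

lemma denom_ge {y : ℝ} (hy : y ∈ uIcc θ 0) (x : ℝ) :
    Real.cos (α * θ / 2) * (Real.exp (α * x) + 1) ≤ ‖exp (α * ray y x) + 1‖ :=
  norm_exp_mul_ray_add_one_ge (h.abs_le hy).2 h.mul_lt_pi x

lemma denom_ne_zero {ζ : ℂ} (hζ : ζ.im ∈ uIcc θ 0) : exp (α * ζ) + 1 ≠ 0 := by
  have h1 := h.denom_ge hζ ζ.re
  rw [ray_eta] at h1
  have : 0 < Real.cos (α * θ / 2) * (Real.exp (α * ζ.re) + 1) := mul_pos h.cos_pos (by positivity)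
  exact norm_pos_iff.1 (this.trans_le h1)

lemma norm_mlF_le {y : ℝ} (hy : y ∈ uIcc θ 0) (x : ℝ) :
    ‖mlF α (ray y x)‖ ≤ (Real.cos (α * θ / 2))⁻¹ * (Real.exp (2 * x) / (Real.exp (α * x) + 1)) := by
  have hk := h.cos_pos
  have h2 : ‖exp (2 * ray y x)‖ = Real.exp (2 * x) := by
    simpa using norm_exp_mul_ray 2 y x
  rw [mlF, norm_div, h2, inv_mul_eq_div, div_div, mul_comm _ (Real.cos _)]
  exact div_le_div_of_nonneg_left (Real.exp_pos _).le (by positivity) (h.denom_ge hy x)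

lemma norm_mlF_le_exp_two {y : ℝ} (hy : y ∈ uIcc θ 0) (x : ℝ) :
    ‖mlF α (ray y x)‖ ≤ (Real.cos (α * θ / 2))⁻¹ * Real.exp (2 * x) := by
  have hk := h.cos_pos
  refine (h.norm_mlF_le hy x).trans (mul_le_mul_of_nonneg_left ?_ (by positivity))
  exact div_le_self (Real.exp_pos _).le (by linarith [Real.exp_pos (α * x)])

/-- Here the denominator is replaced by `e^{αx}` instead of `1`. The exponent `2 - α` is what makes
`mlJ` of order `t^(α-2)`, by Euler's integral. -/
lemma norm_mlF_le_exp {y : ℝ} (hy : y ∈ uIcc θ 0) (x : ℝ) :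
    ‖mlF α (ray y x)‖ ≤ (Real.cos (α * θ / 2))⁻¹ * Real.exp ((2 - α) * x) := by
  have hk := h.cos_pos
  refine (h.norm_mlF_le hy x).trans (mul_le_mul_of_nonneg_left ?_ (by positivity))
  rw [div_le_iff₀ (by positivity), mul_add, ← Real.exp_add, sub_mul, sub_add_cancel]
  linarith [Real.exp_pos (2 * x - α * x)]

lemma differentiableOn_mlF : DifferentiableOn ℂ (mlF α) {ζ | ζ.im ∈ uIcc θ 0} := by
  intro ζ hζ
  have := h.denom_ne_zero hζ
  unfold mlF
  exact DifferentiableAt.differentiableWithinAt (by fun_prop (disch := exact this))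

lemma continuous_mlF : Continuous (fun x => mlF α (ray θ x)) := by
  refine continuousOn_univ.1 (h.differentiableOn_mlF.continuousOn.comp
    (continuous_ray θ).continuousOn ?_)
  intro x _
  simp

lemma continuous_integrand :
    Continuous (fun q : ℝ × ℝ => mlF α (ray θ q.2) * exp (q.1 * exp (ray θ q.2))) := by
  have h1 : Continuous (fun q : ℝ × ℝ => mlF α (ray θ q.2)) := h.continuous_mlF.comp continuous_snd
  have h2 : Continuous (fun q : ℝ × ℝ => ray θ q.2) := (continuous_ray θ).comp continuous_snd
  fun_prop

lemma norm_integrand_le (t x : ℝ) :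
    ‖mlF α (ray θ x) * exp (t * exp (ray θ x))‖ ≤ (Real.cos (α * θ / 2))⁻¹ *
      (Real.exp ((2 - α) * x) * Real.exp (-(-Real.cos θ * t * Real.exp x))) := by
  rw [norm_mul, norm_exp_mul_exp_ray', ← mul_assoc]
  exact mul_le_mul_of_nonneg_right (h.norm_mlF_le_exp left_mem_uIcc x) (Real.exp_pos _).le

lemma integrable_integrand {t : ℝ} (ht : 0 < t) :
    Integrable (fun x => mlF α (ray θ x) * exp (t * exp (ray θ x))) := by
  have hc := h.neg_cos_pos
  refine ((integral_exp_mul_exp_neg (γ := 2 - α) (by linarith [h.lt_two])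
    (mul_pos hc ht)).1.const_mul _).mono' ?_ (Eventually.of_forall (h.norm_integrand_le t))
  have := h.continuous_mlF
  exact Continuous.aestronglyMeasurable (by fun_prop)

lemma integral_norm_integrand_le {t : ℝ} (ht : 0 < t) :
    ∫ x, ‖mlF α (ray θ x) * exp (t * exp (ray θ x))‖ ≤
      (Real.cos (α * θ / 2))⁻¹ * ((-Real.cos θ) ^ (α - 2) * Real.Gamma (2 - α)) * t ^ (α - 2) := by
  have hc := h.neg_cos_pos
  have hi := integral_exp_mul_exp_neg (γ := 2 - α) (by linarith [h.lt_two]) (mul_pos hc ht)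
  refine (integral_mono (h.integrable_integrand ht).norm (hi.1.const_mul _)
    (h.norm_integrand_le t)).trans (le_of_eq ?_)
  rw [integral_const_mul, hi.2, Real.mul_rpow hc.le ht.le, neg_sub]
  ring

/-- The contour integral is bounded by `C * t ^ (α - 2)`. -/
lemma norm_mlJ_le {t : ℝ} (ht : 0 < t) :
    ‖mlJ α θ t‖ ≤
      (Real.cos (α * θ / 2))⁻¹ * ((-Real.cos θ) ^ (α - 2) * Real.Gamma (2 - α)) * t ^ (α - 2) :=
  (norm_integral_le_integral_norm _).trans (h.integral_norm_integrand_le ht)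

lemma stronglyMeasurable_mlJ : StronglyMeasurable (mlJ α θ) :=
  (h.continuous_integrand.stronglyMeasurable).integral_prod_right

/-- Fubini's theorem for moments of the contour integral. -/
lemma integral_mul_mlJ {t : ℝ} (ht : 0 < t) {φ : ℝ → ℝ} (hφ : Continuous φ) {B : ℝ}
    (hB : ∀ τ ∈ Ioc 0 t, |φ τ| ≤ B) :
    ∫ τ in Ioc 0 t, (φ τ : ℂ) * mlJ α θ τ =
      ∫ x : ℝ, mlF α (ray θ x) * ∫ τ in Ioc 0 t, (φ τ : ℂ) * exp (τ * exp (ray θ x)) := by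
  let F : ℝ → ℝ → ℂ := fun τ x => φ τ * (mlF α (ray θ x) * exp (τ * exp (ray θ x)))
  set K := (Real.cos (α * θ / 2))⁻¹ * ((-Real.cos θ) ^ (α - 2) * Real.Gamma (2 - α))
  have hFm : AEStronglyMeasurable (Function.uncurry F)
      ((volume.restrict (Ioc 0 t)).prod volume) := by
    have := h.continuous_integrand
    have : Continuous (Function.uncurry F) := by
      simp only [F, Function.uncurry_def]
      fun_prop
    exact this.aestronglyMeasurable
  -- The integral of the norm over the ray is of order `τ^(α-2)`, which is integrable at `0` because
  -- `α > 1`.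
  have hFi : Integrable (Function.uncurry F) ((volume.restrict (Ioc 0 t)).prod volume) := by
    rw [integrable_prod_iff hFm]
    have hpos : ∀ᵐ τ ∂(volume.restrict (Ioc 0 t)), τ ∈ Ioc 0 t :=
      ae_restrict_mem measurableSet_Ioc
    refine ⟨hpos.mono fun τ hτ => (h.integrable_integrand hτ.1).const_mul (φ τ : ℂ), ?_⟩
    have hdom : Integrable (fun τ : ℝ => B * (K * τ ^ (α - 2))) (volume.restrict (Ioc 0 t)) := by
      have : IntervalIntegrable (fun τ : ℝ => τ ^ (α - 2)) volume 0 t :=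
        intervalIntegral.intervalIntegrable_rpow' (by linarith [h.one_lt])
      exact (((intervalIntegrable_iff_integrableOn_Ioc_of_le ht.le).1 this).const_mul K).const_mul B
    refine hdom.mono' ?_ (hpos.mono fun τ hτ => ?_)
    · exact hFm.norm.integral_prod_right'
    · rw [Real.norm_of_nonneg (integral_nonneg fun _ => norm_nonneg _)]
      simp only [Function.uncurry, F, norm_mul (φ τ : ℂ), integral_const_mul]
      have h1 := h.integral_norm_integrand_le hτ.1
      have h2 : ‖(φ τ : ℂ)‖ ≤ B := by simpa using hB τ hτ
      exact mul_le_mul h2 h1 (integral_nonneg fun _ => norm_nonneg _) ((norm_nonneg _).trans h2)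
  have := integral_integral_swap hFi
  simp only [F, integral_const_mul] at this
  rw [show ∫ τ in Ioc 0 t, (φ τ : ℂ) * mlJ α θ τ = ∫ τ in Ioc 0 t, (φ τ : ℂ) *
    ∫ x : ℝ, mlF α (ray θ x) * exp (τ * exp (ray θ x)) from rfl, this]
  refine integral_congr_ae (Eventually.of_forall fun x => ?_)
  simp only [← integral_const_mul]
  refine integral_congr_ae (Eventually.of_forall fun τ => ?_)
  ring

end RayAngle

end Strip

/-! ### Beta integrals, for convolutions of powers -/

section Beta

/-- The real Beta function. -/
noncomputable def betaR (a b : ℝ) : ℝ := ∫ x in (0 : ℝ)..1, x ^ (a - 1) * (1 - x) ^ (b - 1)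

lemma intervalIntegrable_betaR {a b : ℝ} (ha : 0 < a) (hb : 0 < b) :
    IntervalIntegrable (fun x : ℝ => x ^ (a - 1) * (1 - x) ^ (b - 1)) volume 0 1 := by
  have h := Complex.betaIntegral_convergent (u := a) (v := b) (by simpa) (by simpa)
  rw [intervalIntegrable_iff_integrableOn_Ioc_of_le zero_le_one] at h ⊢
  refine (integrableOn_congr_fun (fun x hx => ?_) measurableSet_Ioc).1 h.re
  have e1 : (x : ℂ) ^ ((a : ℂ) - 1) = ((x ^ (a - 1) : ℝ) : ℂ) := by
    rw [Complex.ofReal_cpow hx.1.le]; push_cast; rfl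
  have e2 : (1 - (x : ℂ)) ^ ((b : ℂ) - 1) = (((1 - x) ^ (b - 1) : ℝ) : ℂ) := by
    rw [Complex.ofReal_cpow (by linarith [hx.2])]; push_cast; rfl
  simp only [e1, e2, ← Complex.ofReal_mul]
  simp

lemma betaR_nonneg (a b : ℝ) : 0 ≤ betaR a b := by
  refine intervalIntegral.integral_nonneg zero_le_one fun x hx => ?_
  have := hx.1
  have : 0 ≤ 1 - x := by linarith [hx.2]
  positivity

lemma rpow_mul_rpow_sub_scale {a b t x : ℝ} (ht : 0 < t) (hx : x ∈ Icc (0 : ℝ) 1) :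
    (t * x) ^ (a - 1) * (t - t * x) ^ (b - 1) =
      t ^ (a + b - 2) * (x ^ (a - 1) * (1 - x) ^ (b - 1)) := by
  have h1 : t - t * x = t * (1 - x) := by ring
  have h2 : t ^ (a + b - 2) = t ^ (a - 1) * t ^ (b - 1) := by
    rw [← Real.rpow_add ht]; congr 1; ring
  rw [h1, Real.mul_rpow ht.le hx.1, Real.mul_rpow ht.le (by linarith [hx.2]), h2]
  ring

lemma intervalIntegrable_rpow_mul_rpow_sub {a b t : ℝ} (ha : 0 < a) (hb : 0 < b) (ht : 0 < t) :
    IntervalIntegrable (fun τ : ℝ => τ ^ (a - 1) * (t - τ) ^ (b - 1)) volume 0 t := by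
  have h := ((intervalIntegrable_betaR ha hb).const_mul (t ^ (a + b - 2)))
  have h2 : IntervalIntegrable (fun x : ℝ => (t * x) ^ (a - 1) * (t - t * x) ^ (b - 1))
      volume 0 1 := by
    refine h.congr fun x hx => (rpow_mul_rpow_sub_scale ht ?_).symm
    rw [uIoc_of_le zero_le_one] at hx
    exact ⟨hx.1.le, hx.2⟩
  have h3 := (IntervalIntegrable.comp_mul_left_iff (c := t) (a := 0) (b := t)
    (f := fun τ : ℝ => τ ^ (a - 1) * (t - τ) ^ (b - 1)) ht.ne'
    (by rw [enorm_mul]; exact ENNReal.mul_ne_top enorm_ne_top enorm_ne_top)).1 (by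
      simpa [ht.ne'] using h2)
  exact h3

lemma integral_rpow_mul_rpow_sub {a b t : ℝ} (ht : 0 < t) :
    ∫ τ in (0 : ℝ)..t, τ ^ (a - 1) * (t - τ) ^ (b - 1) = betaR a b * t ^ (a + b - 1) := by
  have h := intervalIntegral.smul_integral_comp_mul_left
    (f := fun τ : ℝ => τ ^ (a - 1) * (t - τ) ^ (b - 1)) (a := 0) (b := 1) t
  simp only [mul_zero, mul_one] at h
  rw [← h, smul_eq_mul]
  have : ∫ x in (0 : ℝ)..1, (t * x) ^ (a - 1) * (t - t * x) ^ (b - 1) =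
      ∫ x in (0 : ℝ)..1, t ^ (a + b - 2) * (x ^ (a - 1) * (1 - x) ^ (b - 1)) := by
    refine intervalIntegral.integral_congr fun x hx => rpow_mul_rpow_sub_scale ht ?_
    rwa [uIcc_of_le zero_le_one] at hx
  rw [this, intervalIntegral.integral_const_mul, betaR]
  have : t ^ (a + b - 1) = t * t ^ (a + b - 2) := by
    rw [show a + b - 1 = 1 + (a + b - 2) by ring, Real.rpow_add ht, Real.rpow_one]
  rw [this]; ring

end Beta

/-! ### Convolutions of `mlJ` with exponentials, with `t^(1-α)` and with `t` -/

section Strip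

open Complex

namespace RayAngle

variable {α θ : ℝ} (h : RayAngle α θ)
include h

/-- With `r = e^u`, the inner time integral equals `(e^{tz} - e^{-tr}) / (z + r)`. The second term
carries the real factor `e^{-tr}`, and the rest of it can be rotated to the positive axis, where it
is real. -/
lemma integral_exp_neg_mul_mlJ {t : ℝ} (ht : 0 < t) (u : ℝ) :
    (∫ τ in Ioc 0 t, (Real.exp (-((t - τ) * Real.exp u)) : ℂ) * mlJ α θ τ).im =
      (∫ x : ℝ, mlF α (ray θ x) * exp (t * exp (ray θ x)) / (exp (ray θ x) + Real.exp u)).im := by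
  have hk := h.cos_pos
  have hk' := h.cos_pos'
  have hB : ∀ τ ∈ Ioc 0 t, |Real.exp (-((t - τ) * Real.exp u))| ≤ 1 := by
    intro τ hτ
    rw [abs_of_pos (Real.exp_pos _), Real.exp_le_one_iff]
    have := sub_nonneg.2 hτ.2
    have : 0 ≤ (t - τ) * Real.exp u := by positivity
    linarith
  have hcont : Continuous fun τ : ℝ => Real.exp (-((t - τ) * Real.exp u)) := by fun_prop
  rw [h.integral_mul_mlJ ht hcont hB]
  have hge : ∀ y ∈ uIcc θ 0, ∀ x, Real.cos (θ / 2) * (Real.exp x + Real.exp u) ≤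
      ‖exp (ray y x) + Real.exp u‖ := fun y hy x =>
    norm_exp_ray_add_ge (Real.exp_pos u).le (h.abs_le hy).1 h.lt_pi x
  have hne : ∀ ζ : ℂ, ζ.im ∈ uIcc θ 0 → exp ζ + Real.exp u ≠ 0 := fun ζ hζ =>
    exp_add_ne_zero_of_abs_im_lt (Real.exp_pos u).le ((h.abs_le hζ).1.trans_lt h.lt_pi)
  have hinner : ∀ x : ℝ, ∫ τ in Ioc 0 t, (Real.exp (-((t - τ) * Real.exp u)) : ℂ) *
      exp (τ * exp (ray θ x)) =
      (exp (t * exp (ray θ x)) - exp (-(t * Real.exp u))) / (exp (ray θ x) + Real.exp u) := by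
    intro x
    set z := exp (ray θ x)
    set r := Real.exp u
    have hz : z + r ≠ 0 := hne _ (by simp)
    rw [← intervalIntegral.integral_of_le ht.le]
    have e : ∀ τ : ℝ, (Real.exp (-((t - τ) * r)) : ℂ) * exp (τ * z) =
        exp (-(t * r)) * exp ((z + r) * τ) := by
      intro τ
      rw [ofReal_exp, ← exp_add, ← exp_add]
      congr 1; push_cast; ring
    simp only [e]
    rw [intervalIntegral.integral_const_mul, integral_exp_mul_complex hz, mul_div_assoc', mul_sub,
      ← exp_add, ← exp_add]
    congr 3 <;> push_cast <;> ring
  simp only [hinner]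
  have i1 : Integrable fun x : ℝ => mlF α (ray θ x) * exp (t * exp (ray θ x)) /
      (exp (ray θ x) + Real.exp u) := by
    refine ((h.integrable_integrand ht).norm.const_mul
      (Real.cos (θ / 2) * Real.exp u)⁻¹).mono' ?_ (Eventually.of_forall fun x => ?_)
    · have := h.continuous_mlF
      refine Continuous.aestronglyMeasurable (Continuous.div (by fun_prop) (by fun_prop) ?_)
      intro x
      exact hne _ (by simp)
    · rw [norm_div, inv_mul_eq_div]
      refine div_le_div_of_nonneg_left (norm_nonneg _) (by positivity)
        (le_trans ?_ (hge θ left_mem_uIcc x))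
      gcongr
      linarith [Real.exp_pos x]
  have hd : DifferentiableOn ℂ (fun ζ => mlF α ζ / (exp ζ + Real.exp u)) {ζ | ζ.im ∈ uIcc θ 0} :=
    h.differentiableOn_mlF.div (by fun_prop) hne
  -- The cosines come from the lower bounds for `z^α + 1` and `z + e^u`. For the latter, `e^u` is
  -- kept when `x ≤ 0` and `e^x` when `x ≥ 0`, which gives the rates `2` and `α - 1`.
  set M := (Real.cos (α * θ / 2))⁻¹ * (Real.cos (θ / 2))⁻¹ * max 1 (Real.exp (-u))
  have hM : 0 ≤ M := by positivity
  have hbd : ∀ y ∈ uIcc θ 0, ∀ x : ℝ, ‖(fun ζ => mlF α ζ / (exp ζ + Real.exp u)) (ray y x)‖ ≤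
      M * Real.exp (-(min 2 (α - 1)) * |x|) := by
    intro y hy x
    have hn : ∀ d, 0 < d → d ≤ Real.exp x + Real.exp u → ∀ e, ‖mlF α (ray y x)‖ ≤
        (Real.cos (α * θ / 2))⁻¹ * e → 0 ≤ e → ‖mlF α (ray y x) / (exp (ray y x) + Real.exp u)‖ ≤
        (Real.cos (α * θ / 2))⁻¹ * (Real.cos (θ / 2))⁻¹ * (d⁻¹ * e) := by
      intro d hd0 hd e he he0
      rw [norm_div, div_le_iff₀ (norm_pos_iff.2 (hne _ (by simpa using hy)))]
      refine he.trans ?_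
      have h1 := (mul_le_mul_of_nonneg_left hd hk'.le).trans (hge y hy x)
      calc (Real.cos (α * θ / 2))⁻¹ * e
          = (Real.cos (α * θ / 2))⁻¹ * (Real.cos (θ / 2))⁻¹ * (d⁻¹ * e) *
            (Real.cos (θ / 2) * d) := by field_simp
        _ ≤ _ := by gcongr
    refine le_exp_neg_min_mul_abs hM (fun hx => ?_) (fun hx => ?_)
    · refine (hn (Real.exp u) (Real.exp_pos u) (by linarith [Real.exp_pos x]) _
        (h.norm_mlF_le_exp_two hy x) (Real.exp_pos _).le).trans ?_
      rw [← mul_assoc]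
      simp only [M]
      gcongr
      rw [← Real.exp_neg]
      exact le_max_right _ _
    · refine (hn (Real.exp x) (Real.exp_pos x) (by linarith [Real.exp_pos u]) _
        (h.norm_mlF_le_exp hy x) (Real.exp_pos _).le).trans ?_
      rw [← Real.exp_neg, ← Real.exp_add]
      simp only [M]
      have : -x + (2 - α) * x = -(α - 1) * x := by ring
      rw [this]
      refine mul_le_mul_of_nonneg_right ?_ (Real.exp_pos _).le
      exact le_mul_of_one_le_right (by positivity) (le_max_left _ _)
  have hc0 : 0 < min 2 (α - 1) := lt_min two_pos (by linarith [h.one_lt])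
  have i2 := integrable_comp_ray hc0 (hd.continuousOn.mono (fun ζ (hζ : ζ.im = θ) => by
    simp [hζ])) (hbd θ left_mem_uIcc)
  have z2 := im_integral_ray_eq_zero hc0 hd hbd (by
    intro x
    have e1 : ray 0 x = x := by simp [ray]
    have : mlF α (x : ℂ) / (exp x + Real.exp u) =
        ((Real.exp (2 * x) / (Real.exp (α * x) + 1) / (Real.exp x + Real.exp u) : ℝ) : ℂ) := by
      simp [mlF]
    simp only [e1, this, ofReal_im])
  have e : ∀ x : ℝ, mlF α (ray θ x) * ((exp (t * exp (ray θ x)) - exp (-(t * Real.exp u))) /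
      (exp (ray θ x) + Real.exp u)) =
      mlF α (ray θ x) * exp (t * exp (ray θ x)) / (exp (ray θ x) + Real.exp u) -
      (Real.exp (-(t * Real.exp u)) : ℂ) * (mlF α (ray θ x) / (exp (ray θ x) + Real.exp u)) := by
    intro x
    push_cast
    ring
  simp only [e]
  rw [integral_sub i1 (i2.const_mul _), integral_const_mul, sub_im, im_ofReal_mul, z2,
    mul_zero, sub_zero]

end RayAngle

end Strip

section Strip

open Complex

namespace RayAngle

variable {α θ : ℝ} (h : RayAngle α θ)
include h

lemma integrable_rpow_mul_mlJ {t : ℝ} (ht : 0 < t) :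
    IntegrableOn (fun τ : ℝ => (((t - τ) ^ (1 - α) : ℝ) : ℂ) * mlJ α θ τ) (Ioo 0 t) := by
  set K := (Real.cos (α * θ / 2))⁻¹ * ((-Real.cos θ) ^ (α - 2) * Real.Gamma (2 - α))
  have h1 := intervalIntegrable_rpow_mul_rpow_sub (a := α - 1) (b := 2 - α) (t := t)
    (by linarith [h.one_lt]) (by linarith [h.lt_two]) ht
  rw [intervalIntegrable_iff_integrableOn_Ioo_of_le ht.le] at h1
  refine (h1.const_mul K).mono' ?_ ?_
  · have hm := h.stronglyMeasurable_mlJ.measurable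
    exact Measurable.aestronglyMeasurable (by fun_prop)
  · refine (ae_restrict_mem measurableSet_Ioo).mono fun τ hτ => ?_
    have h0 : 0 ≤ (t - τ) ^ (1 - α) := Real.rpow_nonneg (by linarith [hτ.2]) _
    rw [norm_mul, norm_real, Real.norm_of_nonneg h0]
    have := mul_le_mul_of_nonneg_left (h.norm_mlJ_le hτ.1) h0
    refine this.trans (le_of_eq ?_)
    rw [show α - 1 - 1 = α - 2 by ring, show 2 - α - 1 = 1 - α by ring]
    ring

/-- Convolution by `t^(1-α) / Γ(2-α)` should multiply the Laplace transform by `z^(α-2)`. To prove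
this on the contour, write `(t-τ)^(1-α)` as a superposition of the exponentials `e^{-(t-τ)r}`, apply
`integral_exp_neg_mul_mlJ` to each, and recognise the Mellin transform of `1 / (z + r)`. -/
lemma integral_rpow_mul_mlJ {t : ℝ} (ht : 0 < t) :
    (∫ τ in Ioo 0 t, (((t - τ) ^ (1 - α) / Real.Gamma (2 - α) : ℝ) : ℂ) * mlJ α θ τ).im =
      (∫ x : ℝ, exp (α * ray θ x) / (exp (α * ray θ x) + 1) * exp (t * exp (ray θ x))).im := by
  have h1 := h.one_lt
  have h2 := h.lt_two
  have hk := h.cos_pos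
  have hk' := h.cos_pos'
  have hG : 0 < Real.Gamma (α - 1) := Real.Gamma_pos_of_pos (by linarith)
  have hG' : 0 < Real.Gamma (2 - α) := Real.Gamma_pos_of_pos (by linarith)
  have hpow : ∀ τ ∈ Ioo 0 t,
      Integrable (fun u : ℝ => Real.exp ((α - 1) * u) * Real.exp (-((t - τ) * Real.exp u))) ∧
      ∫ u : ℝ, Real.exp ((α - 1) * u) * Real.exp (-((t - τ) * Real.exp u)) =
        (t - τ) ^ (1 - α) * Real.Gamma (α - 1) := by
    intro τ hτ
    have := integral_exp_mul_exp_neg (γ := α - 1) (c := t - τ) (by linarith) (by linarith [hτ.2])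
    rwa [neg_sub] at this
  -- the first application of Fubini's theorem, in `(τ, u)`
  let F : ℝ → ℝ → ℂ := fun τ u =>
    ((Real.exp ((α - 1) * u) * Real.exp (-((t - τ) * Real.exp u)) : ℝ) : ℂ) * mlJ α θ τ
  have hFm : AEStronglyMeasurable (Function.uncurry F)
      ((volume.restrict (Ioo 0 t)).prod volume) := by
    have hm := h.stronglyMeasurable_mlJ.measurable
    refine Measurable.aestronglyMeasurable ?_
    simp only [F, Function.uncurry_def]
    fun_prop
  have hFi : Integrable (Function.uncurry F) ((volume.restrict (Ioo 0 t)).prod volume) := by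
    rw [integrable_prod_iff hFm]
    constructor
    · refine (ae_restrict_mem measurableSet_Ioo).mono fun τ hτ => ?_
      exact ((hpow τ hτ).1.ofReal).mul_const (mlJ α θ τ)
    · refine ((h.integrable_rpow_mul_mlJ ht).norm.const_mul (Real.Gamma (α - 1))).congr
        ((ae_restrict_mem measurableSet_Ioo).mono fun τ hτ => ?_)
      have h0 : 0 ≤ (t - τ) ^ (1 - α) := Real.rpow_nonneg (by linarith [hτ.2]) _
      simp only [Function.uncurry, F]
      have e : ∀ u : ℝ, ‖((Real.exp ((α - 1) * u) * Real.exp (-((t - τ) * Real.exp u)) : ℝ) : ℂ) *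
          mlJ α θ τ‖ = (Real.exp ((α - 1) * u) * Real.exp (-((t - τ) * Real.exp u))) *
          ‖mlJ α θ τ‖ := fun u => by
        rw [norm_mul, norm_real, Real.norm_of_nonneg (by positivity)]
      simp only [e]
      rw [integral_mul_const, (hpow τ hτ).2, norm_mul, norm_real, Real.norm_of_nonneg h0]
      ring
  have hsw := integral_integral_swap hFi
  have hinn : ∀ τ ∈ Ioo 0 t, ∫ u, F τ u =
      (Real.Gamma (α - 1) : ℂ) * ((((t - τ) ^ (1 - α) : ℝ) : ℂ) * mlJ α θ τ) := by
    intro τ hτ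
    simp only [F]
    rw [integral_mul_const, integral_complex_ofReal, (hpow τ hτ).2]
    push_cast
    ring
  rw [setIntegral_congr_fun measurableSet_Ioo hinn, integral_const_mul] at hsw
  -- the second application, in `(u, x)`
  let G : ℝ → ℝ → ℂ := fun u x => (Real.exp ((α - 1) * u) : ℂ) *
    (mlF α (ray θ x) * exp (t * exp (ray θ x)) / (exp (ray θ x) + Real.exp u))
  have hne : ∀ x u : ℝ, exp (ray θ x) + Real.exp u ≠ 0 := fun x u =>
    exp_add_ne_zero_of_abs_im_lt (Real.exp_pos u).le
      (by simpa [abs_of_pos h.pos] using h.lt_pi)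
  have hGm : AEStronglyMeasurable (Function.uncurry G) (volume.prod volume) := by
    have hc := h.continuous_mlF
    refine Continuous.aestronglyMeasurable ?_
    have h3 : Continuous (fun q : ℝ × ℝ => mlF α (ray θ q.2)) := hc.comp continuous_snd
    have h4 : Continuous (fun q : ℝ × ℝ => ray θ q.2) := (continuous_ray θ).comp continuous_snd
    simp only [G, Function.uncurry_def]
    exact Continuous.mul (by fun_prop) (Continuous.div (by fun_prop) (by fun_prop)
      fun q => hne q.2 q.1)
  have hmell : ∀ x : ℝ, Integrable (fun u : ℝ =>
      Real.exp ((α - 1) * u) / (Real.exp x + Real.exp u)) ∧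
      ∫ u : ℝ, Real.exp ((α - 1) * u) / (Real.exp x + Real.exp u) =
        Real.Gamma (2 - α) * Real.Gamma (α - 1) * Real.exp (-((2 - α) * x)) := by
    intro x
    have := integrable_exp_div_exp_add (β := 2 - α) (by linarith) (by linarith) x
    rwa [show 1 - (2 - α) = α - 1 by ring] at this
  have hGn : ∀ u x : ℝ, ‖G u x‖ ≤ (Real.cos (θ / 2))⁻¹ *
      ‖mlF α (ray θ x) * exp (t * exp (ray θ x))‖ *
      (Real.exp ((α - 1) * u) / (Real.exp x + Real.exp u)) := by
    intro u x
    have hge := norm_exp_ray_add_ge (Real.exp_pos u).le (h.abs_le left_mem_uIcc).1 h.lt_pi x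
    simp only [G]
    rw [norm_mul, norm_div, norm_real, Real.norm_of_nonneg (Real.exp_pos _).le]
    calc _ ≤ Real.exp ((α - 1) * u) * (‖mlF α (ray θ x) * exp (t * exp (ray θ x))‖ /
          (Real.cos (θ / 2) * (Real.exp x + Real.exp u))) := by gcongr
      _ = _ := by field_simp
  have hGi : Integrable (Function.uncurry G) (volume.prod volume) := by
    rw [integrable_prod_iff' hGm]
    have hGx : ∀ x : ℝ, Integrable (fun u => G u x) := fun x =>
      ((hmell x).1.const_mul _).mono' (by
        have : Continuous (fun u => G u x) := by
          simp only [G]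
          exact Continuous.mul (by fun_prop) (Continuous.div (by fun_prop) (by fun_prop)
            fun u => hne x u)
        exact this.aestronglyMeasurable) (Eventually.of_forall fun u => hGn u x)
    refine ⟨Eventually.of_forall hGx, ?_⟩
    -- Integrating in `u` contributes `e^{-(2-α)x}`, which against the bound `e^{2x}` for `mlF`
    -- leaves Euler's integral with exponent `α`.
    have hdom := (integral_exp_mul_exp_neg (γ := α) (c := -Real.cos θ * t) (by linarith)
      (mul_pos h.neg_cos_pos ht)).1
    refine (hdom.const_mul ((Real.cos (θ / 2))⁻¹ * (Real.cos (α * θ / 2))⁻¹ *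
      (Real.Gamma (2 - α) * Real.Gamma (α - 1)))).mono' ?_ (Eventually.of_forall fun x => ?_)
    · exact hGm.norm.prod_swap.integral_prod_right'
    · rw [Real.norm_of_nonneg (integral_nonneg fun _ => norm_nonneg _)]
      refine (integral_mono (hGx x).norm ((hmell x).1.const_mul _) (fun u => hGn u x)).trans ?_
      rw [integral_const_mul, (hmell x).2, norm_mul, norm_exp_mul_exp_ray']
      have hF := h.norm_mlF_le_exp_two left_mem_uIcc x
      have e : Real.exp (α * x) = Real.exp (2 * x) * Real.exp (-((2 - α) * x)) := by
        rw [← Real.exp_add]; congr 1; ring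
      rw [e]
      calc _ ≤ (Real.cos (θ / 2))⁻¹ * ((Real.cos (α * θ / 2))⁻¹ * Real.exp (2 * x) *
            Real.exp (-(-Real.cos θ * t * Real.exp x))) *
            (Real.Gamma (2 - α) * Real.Gamma (α - 1) * Real.exp (-((2 - α) * x))) := by gcongr
        _ = _ := by ring
  have hsw2 := integral_integral_swap hGi
  have hinn2 : ∀ x : ℝ, ∫ u, G u x = (Real.Gamma (α - 1) * Real.Gamma (2 - α) : ℂ) *
      (exp (α * ray θ x) / (exp (α * ray θ x) + 1) * exp (t * exp (ray θ x))) := by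
    intro x
    have hm := integral_exp_div_exp_ray_add (β := 2 - α) (by linarith) (by linarith) (y := θ)
      (by simpa [abs_of_pos h.pos] using h.lt_pi) x
    rw [show 1 - (2 - α) = α - 1 by ring] at hm
    have e : ∀ u : ℝ, G u x = (mlF α (ray θ x) * exp (t * exp (ray θ x))) *
        ((Real.exp ((α - 1) * u) : ℂ) / (exp (ray θ x) + Real.exp u)) := by
      intro u; simp only [G]; ring
    simp only [e]
    rw [integral_const_mul, hm, mlF]
    have e2 : exp (α * ray θ x) = exp (2 * ray θ x) * exp (-(((2 - α : ℝ) : ℂ) * ray θ x)) := by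
      rw [← exp_add]; congr 1; push_cast; ring
    nth_rewrite 2 [e2]
    push_cast
    ring
  simp only [hinn2, integral_const_mul] at hsw2
  -- Only the imaginary parts agree: for each `u` a real term has been dropped.
  have hmid : (∫ u, ∫ τ in Ioo 0 t, F τ u).im = (∫ u, ∫ x, G u x).im := by
    have j1 : Integrable (fun u => ∫ τ in Ioo 0 t, F τ u) := hFi.integral_prod_right
    have j2 : Integrable (fun u => ∫ x, G u x) := hGi.integral_prod_left
    rw [im_integral_eq j1, im_integral_eq j2]
    refine integral_congr_ae (Eventually.of_forall fun u => ?_)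
    have e1 : ∀ τ, F τ u = (Real.exp ((α - 1) * u) : ℂ) *
        ((Real.exp (-((t - τ) * Real.exp u)) : ℂ) * mlJ α θ τ) := fun τ => by
      simp only [F]; push_cast; ring
    simp only [e1, G, integral_const_mul, im_ofReal_mul]
    rw [← integral_Ioc_eq_integral_Ioo, h.integral_exp_neg_mul_mlJ ht u]
  rw [← hsw, hsw2, ← ofReal_mul, im_ofReal_mul, im_ofReal_mul, mul_assoc] at hmid
  have hfin := mul_left_cancel₀ hG.ne' hmid
  have e3 : ∀ τ : ℝ, (((t - τ) ^ (1 - α) / Real.Gamma (2 - α) : ℝ) : ℂ) * mlJ α θ τ =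
      ((Real.Gamma (2 - α))⁻¹ : ℝ) * ((((t - τ) ^ (1 - α) : ℝ) : ℂ) * mlJ α θ τ) := by
    intro τ; push_cast; ring
  simp only [e3]
  rw [integral_const_mul, im_ofReal_mul, hfin, inv_mul_cancel_left₀ hG'.ne']

end RayAngle

lemma norm_exp_sub_one_le_mul_exp (w : ℂ) : ‖exp w - 1‖ ≤ ‖w‖ * Real.exp ‖w‖ := by
  simpa using norm_exp_sub_sum_le_norm_mul_exp w 1

lemma norm_exp_mul_exp_ray_sub_one_le {t x : ℝ} (ht : 0 ≤ t) (hx : x ≤ 0) (y : ℝ) :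
    ‖exp (t * exp (ray y x)) - 1‖ ≤ t * Real.exp t * Real.exp x := by
  refine (norm_exp_sub_one_le_mul_exp _).trans ?_
  rw [norm_mul, norm_real, Real.norm_of_nonneg ht, norm_exp_ray]
  have : t * Real.exp x ≤ t := mul_le_of_le_one_right ht (Real.exp_le_one_iff.2 hx)
  calc _ ≤ t * Real.exp x * Real.exp t := by gcongr
    _ = _ := by ring

lemma integral_sub_mul_exp {t : ℝ} (ht : 0 ≤ t) {z : ℂ} (hz : z ≠ 0) :
    ∫ τ in Ioc 0 t, ((t - τ : ℝ) : ℂ) * exp (τ * z) = (exp (t * z) - 1 - t * z) / z ^ 2 := by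
  rw [← intervalIntegral.integral_of_le ht]
  have hd : ∀ τ ∈ uIcc 0 t, HasDerivAt
      (fun τ : ℝ => (((t - τ : ℝ) : ℂ) / z + 1 / z ^ 2) * exp (τ * z))
      (((t - τ : ℝ) : ℂ) * exp (τ * z)) τ := by
    intro τ _
    have h1 : HasDerivAt (fun τ : ℝ => (((t - τ : ℝ) : ℂ) / z + 1 / z ^ 2)) ((-1 : ℝ) / z) τ :=
      ((((hasDerivAt_id τ).const_sub t).ofReal_comp).div_const z).add_const _
    have h2 : HasDerivAt (fun τ : ℝ => exp (τ * z)) (exp (τ * z) * (1 * z)) τ :=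
      (((hasDerivAt_id τ).ofReal_comp).mul_const z).cexp
    convert! h1.mul h2 using 1
    push_cast
    field_simp
    ring
  rw [intervalIntegral.integral_eq_sub_of_hasDerivAt hd
    (Continuous.intervalIntegrable (by fun_prop) _ _)]
  simp only [sub_self, ofReal_zero, zero_div, zero_add, sub_zero, zero_mul, exp_zero]
  field_simp
  ring

namespace RayAngle

variable {α θ : ℝ} (h : RayAngle α θ)
include h

lemma inv_exp_mul_add_one_le (x : ℝ) (hx : 0 ≤ x) :
    (Real.exp (α * x) + 1)⁻¹ ≤ Real.exp (-1 * x) := by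
  have := h.one_lt
  rw [neg_one_mul, Real.exp_neg]
  refine inv_anti₀ (Real.exp_pos x) ?_
  have : Real.exp x ≤ Real.exp (α * x) := Real.exp_le_exp.2 (by nlinarith)
  linarith

lemma norm_inv_denom_le {y : ℝ} (hy : y ∈ uIcc θ 0) (x : ℝ) :
    ‖(exp (α * ray y x) + 1)⁻¹‖ ≤ (Real.cos (α * θ / 2))⁻¹ * (Real.exp (α * x) + 1)⁻¹ := by
  have hk := h.cos_pos
  rw [norm_inv, ← mul_inv]
  exact inv_anti₀ (by positivity) (h.denom_ge hy x)

/-- Subtracting `1` makes the integrand decay as `z → 0`; at infinity `1 / (z^α + 1)` decays by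
itself. -/
lemma integrable_exp_sub_one_div {t : ℝ} (ht : 0 < t) :
    Integrable (fun x : ℝ => (exp (t * exp (ray θ x)) - 1) / (exp (α * ray θ x) + 1)) := by
  have hk := h.cos_pos
  have hd : ContinuousOn (fun ζ => (exp (t * exp ζ) - 1) / (exp (α * ζ) + 1)) {ζ | ζ.im = θ} :=
    ContinuousOn.div (by fun_prop) (by fun_prop) fun ζ hζ => h.denom_ne_zero (by simp [hζ.out])
  set M := (Real.cos (α * θ / 2))⁻¹ * (t * Real.exp t + 2)
  refine integrable_comp_ray (M := M) (c := min 1 1) (by simp) hd fun x => ?_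
  have hn := h.norm_inv_denom_le left_mem_uIcc x
  have hpos : 0 < Real.exp t := Real.exp_pos t
  rw [div_eq_mul_inv, norm_mul]
  refine le_exp_neg_min_mul_abs (by positivity) (fun hx => ?_) (fun hx => ?_)
  · have h1 := norm_exp_mul_exp_ray_sub_one_le ht.le hx θ
    have h2 : (Real.exp (α * x) + 1)⁻¹ ≤ 1 := inv_le_one_of_one_le₀ (by
      linarith [Real.exp_pos (α * x)])
    calc _ ≤ (t * Real.exp t * Real.exp x) * ((Real.cos (α * θ / 2))⁻¹ * 1) := by
          gcongr; exact hn.trans (by gcongr)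
      _ ≤ _ := by
          rw [one_mul, mul_one]
          have : 0 ≤ (Real.cos (α * θ / 2))⁻¹ * 2 * Real.exp x := by positivity
          simp only [M]
          linarith
  · have h1 : ‖exp (t * exp (ray θ x)) - 1‖ ≤ 2 := by
      refine (norm_sub_le _ _).trans ?_
      rw [norm_exp_mul_exp_ray', norm_one]
      have : Real.exp (-(-Real.cos θ * t * Real.exp x)) ≤ 1 := by
        rw [Real.exp_le_one_iff]
        have := h.neg_cos_pos
        have : 0 ≤ -Real.cos θ * t * Real.exp x := by positivity
        linarith
      linarith
    calc _ ≤ 2 * ((Real.cos (α * θ / 2))⁻¹ * Real.exp (-1 * x)) := by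
          gcongr; exact hn.trans (by gcongr; exact h.inv_exp_mul_add_one_le x hx)
      _ ≤ _ := by
          have : 0 ≤ (Real.cos (α * θ / 2))⁻¹ * (t * Real.exp t) * Real.exp (-1 * x) := by
            positivity
          simp only [M]
          linarith

/-- The time integral of `(t - τ) e^{τz}` is `(e^{tz} - 1 - tz) / z²`. The term `tz` contributes
nothing to the imaginary part, since it can be rotated to the positive axis. -/
lemma integral_sub_mul_mlJ {t : ℝ} (ht : 0 < t) :
    (∫ τ in Ioc 0 t, ((t - τ : ℝ) : ℂ) * mlJ α θ τ).im =
      (∫ x : ℝ, (exp (t * exp (ray θ x)) - 1) / (exp (α * ray θ x) + 1)).im := by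
  have hk := h.cos_pos
  have h1 := h.one_lt
  rw [h.integral_mul_mlJ ht (φ := fun τ => t - τ) (by fun_prop) (B := t) (by
    intro τ hτ
    rw [abs_of_nonneg (by linarith [hτ.2])]
    linarith [hτ.1])]
  have hd : DifferentiableOn ℂ (fun ζ => exp ζ / (exp (α * ζ) + 1)) {ζ | ζ.im ∈ uIcc θ 0} :=
    DifferentiableOn.div (by fun_prop) (by fun_prop) fun ζ hζ => h.denom_ne_zero hζ
  have hbd : ∀ y ∈ uIcc θ 0, ∀ x : ℝ, ‖(fun ζ => exp ζ / (exp (α * ζ) + 1)) (ray y x)‖ ≤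
      (Real.cos (α * θ / 2))⁻¹ * Real.exp (-(min 1 (α - 1)) * |x|) := by
    intro y hy x
    have hn := h.norm_inv_denom_le hy x
    simp only [div_eq_mul_inv, norm_mul, norm_exp_ray]
    refine le_exp_neg_min_mul_abs (by positivity) (fun hx => ?_) (fun hx => ?_)
    · have h2 : (Real.exp (α * x) + 1)⁻¹ ≤ 1 := inv_le_one_of_one_le₀ (by
        linarith [Real.exp_pos (α * x)])
      calc _ ≤ Real.exp x * ((Real.cos (α * θ / 2))⁻¹ * 1) := by
            gcongr; exact hn.trans (by gcongr)
        _ = _ := by ring_nf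
    · have h2 : (Real.exp (α * x) + 1)⁻¹ ≤ (Real.exp (α * x))⁻¹ :=
        inv_anti₀ (Real.exp_pos _) (by linarith)
      calc _ ≤ Real.exp x * ((Real.cos (α * θ / 2))⁻¹ * (Real.exp (α * x))⁻¹) := by
            gcongr; exact hn.trans (by gcongr)
        _ = (Real.cos (α * θ / 2))⁻¹ * (Real.exp x * Real.exp (-(α * x))) := by
            rw [Real.exp_neg]; ring
        _ = _ := by rw [← Real.exp_add]; ring_nf
  have hc0 : 0 < min 1 (α - 1) := lt_min one_pos (by linarith)
  have z2 := im_integral_ray_eq_zero hc0 hd hbd (by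
    intro x
    have e1 : ray 0 x = x := by simp [ray]
    have : exp (x : ℂ) / (exp (α * x) + 1) =
        ((Real.exp x / (Real.exp (α * x) + 1) : ℝ) : ℂ) := by
      simp
    simp only [e1, this, ofReal_im])
  have i2 := integrable_comp_ray hc0 (hd.continuousOn.mono (fun ζ (hζ : ζ.im = θ) => by
    simp [hζ])) (hbd θ left_mem_uIcc)
  have e : ∀ x : ℝ, mlF α (ray θ x) * ∫ τ in Ioc 0 t, ((t - τ : ℝ) : ℂ) * exp (τ * exp (ray θ x)) =
      (exp (t * exp (ray θ x)) - 1) / (exp (α * ray θ x) + 1) -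
        (t : ℂ) * (exp (ray θ x) / (exp (α * ray θ x) + 1)) := by
    intro x
    rw [integral_sub_mul_exp ht.le (exp_ne_zero _), mlF]
    have hD := h.denom_ne_zero (ζ := ray θ x) (by simp)
    have e2 : exp (2 * ray θ x) = exp (ray θ x) ^ 2 := by
      rw [← exp_nat_mul]; norm_num
    rw [e2]
    have := exp_ne_zero (ray θ x)
    field_simp
  simp only [e]
  rw [integral_sub (h.integrable_exp_sub_one_div ht) (i2.const_mul _), integral_const_mul, sub_im,
    im_ofReal_mul, z2, mul_zero, sub_zero]

end RayAngle

end Strip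

/-! ### Evaluation of the contour integral of `e^{tz} - 1/(z^α + 1)` -/

section Strip

open Complex

lemma integral_two_mul_exp_div : ∫ x : ℝ, 2 * Real.exp x / (1 + Real.exp (2 * x)) = Real.pi := by
  have hd : ∀ x : ℝ, HasDerivAt (fun x => 2 * Real.arctan (Real.exp x))
      (2 * Real.exp x / (1 + Real.exp (2 * x))) x := by
    intro x
    refine (((Real.hasDerivAt_exp x).arctan).const_mul 2).congr_deriv ?_
    rw [two_mul x, Real.exp_add]
    ring
  have hint : Integrable (fun x : ℝ => 2 * Real.exp x / (1 + Real.exp (2 * x))) := by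
    have h1 := (integrable_exp_div_exp_add (β := 1 / 2) (by norm_num) (by norm_num) 0).1
    have h2 := (h1.comp_mul_left' (two_ne_zero)).const_mul 2
    refine h2.congr (Eventually.of_forall fun x => ?_)
    simp only [Real.exp_zero]
    rw [← mul_div_assoc]
    congr 3
    ring
  have hbot : Tendsto (fun x => 2 * Real.arctan (Real.exp x)) atBot (𝓝 0) := by
    have := (Real.continuous_arctan.tendsto 0).comp Real.tendsto_exp_atBot
    simpa using this.const_mul 2
  have htop : Tendsto (fun x => 2 * Real.arctan (Real.exp x)) atTop (𝓝 Real.pi) := by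
    have := (Real.tendsto_arctan_atTop.mono_right nhdsWithin_le_nhds).comp Real.tendsto_exp_atTop
    have h2 := this.const_mul 2
    rwa [mul_div_cancel₀ Real.pi two_ne_zero] at h2
  simpa using integral_of_hasDerivAt_of_tendsto hd hint hbot htop

lemma one_sub_exp_ne_zero {ζ : ℂ} (hζ : |ζ.im - Real.pi| < Real.pi) : 1 - exp ζ ≠ 0 := by
  have h1 := norm_one_sub_exp_mul_ray_ge (α := 1) (y := ζ.im) (φ := |ζ.im - Real.pi|)
    (by simp) hζ ζ.re
  rw [ray_eta] at h1
  have h0 : 0 < Real.cos (|ζ.im - Real.pi| / 2) * (Real.exp (1 * ζ.re) + 1) :=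
    mul_pos (cos_half_pos (abs_nonneg _) hζ) (by positivity)
  have := norm_pos_iff.1 (h0.trans_le h1)
  simpa using this

namespace RayAngle

variable {α θ : ℝ} (h : RayAngle α θ)
include h

/-- The part of the evaluation that comes from rotating the rays to the negative axis. -/
lemma im_integral_exp_exp_sub {t : ℝ} (ht : 0 < t) :
    Integrable (fun x : ℝ => exp (t * exp (ray θ x)) - (1 - exp (ray θ x))⁻¹) ∧
    (∫ x : ℝ, (exp (t * exp (ray θ x)) - (1 - exp (ray θ x))⁻¹)).im = 0 := by
  have hπ := h.lt_pi
  have hc0 := h.neg_cos_pos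
  have hφ : Real.pi - θ < Real.pi := by linarith [h.pos]
  have hk : 0 < Real.cos ((Real.pi - θ) / 2) := cos_half_pos (by linarith) hφ
  set k := Real.cos ((Real.pi - θ) / 2)
  have hy' : ∀ y ∈ uIcc θ Real.pi, |y - Real.pi| ≤ Real.pi - θ ∧ Real.cos y ≤ Real.cos θ := by
    intro y hy
    rw [uIcc_of_le hπ.le] at hy
    refine ⟨?_, Real.cos_le_cos_of_nonneg_of_le_pi h.pos.le hy.2 hy.1⟩
    rw [abs_of_nonpos (by linarith [hy.2])]
    linarith [hy.1]
  have hne : ∀ ζ : ℂ, ζ.im ∈ uIcc θ Real.pi → 1 - exp ζ ≠ 0 := fun ζ hζ =>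
    one_sub_exp_ne_zero ((hy' _ hζ).1.trans_lt hφ)
  have hge : ∀ y ∈ uIcc θ Real.pi, ∀ x, ‖(1 - exp (ray y x))⁻¹‖ ≤ k⁻¹ * (Real.exp x + 1)⁻¹ := by
    intro y hy x
    have := norm_one_sub_exp_mul_ray_ge (α := 1) (y := y) (by simpa using (hy' y hy).1) hφ x
    simp only [ofReal_one, one_mul] at this
    rw [norm_inv, ← mul_inv]
    exact inv_anti₀ (by positivity) this
  have hd : DifferentiableOn ℂ (fun ζ => exp (t * exp ζ) - (1 - exp ζ)⁻¹)
      {ζ | ζ.im ∈ uIcc θ Real.pi} :=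
    DifferentiableOn.sub (by fun_prop) (DifferentiableOn.inv (by fun_prop) hne)
  set M := t * Real.exp t + k⁻¹ + (-Real.cos θ * t)⁻¹
  have hM : 0 ≤ M := by positivity
  have hbd : ∀ y ∈ uIcc θ Real.pi, ∀ x : ℝ,
      ‖(fun ζ => exp (t * exp ζ) - (1 - exp ζ)⁻¹) (ray y x)‖ ≤
      M * Real.exp (-(min 1 1) * |x|) := by
    intro y hy x
    refine le_exp_neg_min_mul_abs hM (fun hx => ?_) (fun hx => ?_)
    -- Both terms tend to `1` as `z → 0`; regrouping around this common limit shows the decay.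
    · have e : exp (t * exp (ray y x)) - (1 - exp (ray y x))⁻¹ =
          (exp (t * exp (ray y x)) - 1) - exp (ray y x) * (1 - exp (ray y x))⁻¹ := by
        have := hne (ray y x) (by simpa using hy)
        field_simp
        ring
      have h1 := norm_exp_mul_exp_ray_sub_one_le ht.le hx y
      have h2 : (Real.exp x + 1)⁻¹ ≤ 1 := inv_le_one_of_one_le₀ (by linarith [Real.exp_pos x])
      have h3 : ‖exp (ray y x) * (1 - exp (ray y x))⁻¹‖ ≤ Real.exp x * (k⁻¹ * 1) := by
        rw [norm_mul, norm_exp_ray]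
        gcongr
        exact (hge y hy x).trans (by gcongr)
      have h4 : 0 ≤ (-Real.cos θ * t)⁻¹ * Real.exp x := by positivity
      simp only [e, M, one_mul]
      refine (norm_sub_le _ _).trans ?_
      linarith
    · have h1 : ‖exp (t * exp (ray y x))‖ ≤ (-Real.cos θ * t)⁻¹ * Real.exp (-x) := by
        rw [norm_exp_mul_exp_ray']
        have hv : 0 < -Real.cos θ * t * Real.exp x := by positivity
        have : Real.exp (-(-Real.cos y * t * Real.exp x)) ≤
            Real.exp (-(-Real.cos θ * t * Real.exp x)) := by
          have := (hy' y hy).2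
          gcongr
        refine this.trans ?_
        rw [Real.exp_neg, Real.exp_neg, ← mul_inv]
        refine inv_anti₀ hv ?_
        linarith [Real.add_one_le_exp (-Real.cos θ * t * Real.exp x)]
      have h2 : (Real.exp x + 1)⁻¹ ≤ Real.exp (-x) := by
        rw [Real.exp_neg]; exact inv_anti₀ (Real.exp_pos x) (by linarith)
      have h3 : ‖(1 - exp (ray y x))⁻¹‖ ≤ k⁻¹ * Real.exp (-x) :=
        (hge y hy x).trans (by gcongr)
      have h4 : 0 ≤ t * Real.exp t * Real.exp (-x) := by positivity
      simp only [M]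
      rw [neg_one_mul]
      refine (norm_sub_le _ _).trans ?_
      linarith
  refine ⟨integrable_comp_ray (by simp) (hd.continuousOn.mono (fun ζ (hζ : ζ.im = θ) => by
    simp [hζ])) (hbd θ left_mem_uIcc), im_integral_ray_eq_zero (by simp) hd hbd fun x => ?_⟩
  have e1 : exp (ray Real.pi x) = ((-Real.exp x : ℝ) : ℂ) := by
    rw [exp_ray, exp_pi_mul_I]; simp
  have : exp (t * exp (ray Real.pi x)) - (1 - exp (ray Real.pi x))⁻¹ =
      ((Real.exp (t * -Real.exp x) - (1 + Real.exp x)⁻¹ : ℝ) : ℂ) := by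
    rw [e1]; push_cast; ring_nf
  simp only [this, ofReal_im]

/-- The part of the evaluation that comes from rotating the rays to the positive axis. -/
lemma im_integral_inv_sub_inv :
    Integrable (fun x : ℝ => (exp (ray θ x) + 1)⁻¹ - (exp (α * ray θ x) + 1)⁻¹) ∧
    (∫ x : ℝ, ((exp (ray θ x) + 1)⁻¹ - (exp (α * ray θ x) + 1)⁻¹)).im = 0 := by
  have hk := h.cos_pos
  have hk' := h.cos_pos'
  have hne : ∀ ζ : ℂ, ζ.im ∈ uIcc θ 0 → exp ζ + 1 ≠ 0 := fun ζ hζ => by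
    simpa using exp_add_ne_zero_of_abs_im_lt zero_le_one ((h.abs_le hζ).1.trans_lt h.lt_pi)
  have hd : DifferentiableOn ℂ (fun ζ => (exp ζ + 1)⁻¹ - (exp (α * ζ) + 1)⁻¹)
      {ζ | ζ.im ∈ uIcc θ 0} :=
    DifferentiableOn.sub (DifferentiableOn.inv (by fun_prop) hne)
      (DifferentiableOn.inv (by fun_prop) fun ζ hζ => h.denom_ne_zero hζ)
  have hge : ∀ y ∈ uIcc θ 0, ∀ x, ‖(exp (ray y x) + 1)⁻¹‖ ≤
      (Real.cos (θ / 2))⁻¹ * (Real.exp x + 1)⁻¹ := by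
    intro y hy x
    have := norm_exp_ray_add_ge zero_le_one (h.abs_le hy).1 h.lt_pi x
    rw [norm_inv, ← mul_inv]
    exact inv_anti₀ (by positivity) (by simpa using this)
  set M := (Real.cos (θ / 2))⁻¹ + (Real.cos (α * θ / 2))⁻¹
  have hbd : ∀ y ∈ uIcc θ 0, ∀ x : ℝ,
      ‖(fun ζ => (exp ζ + 1)⁻¹ - (exp (α * ζ) + 1)⁻¹) (ray y x)‖ ≤
      M * Real.exp (-(min 1 1) * |x|) := by
    intro y hy x
    have hα := h.norm_inv_denom_le hy x
    have h1 := hge y hy x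
    refine le_exp_neg_min_mul_abs (by positivity) (fun hx => ?_) (fun hx => ?_)
    -- Again both terms tend to `1` as `z → 0`, and the regrouping exhibits a difference of small
    -- terms.
    · have e : (exp (ray y x) + 1)⁻¹ - (exp (α * ray y x) + 1)⁻¹ =
          exp (α * ray y x) * (exp (α * ray y x) + 1)⁻¹ -
            exp (ray y x) * (exp (ray y x) + 1)⁻¹ := by
        have := hne (ray y x) (by simpa using hy)
        have := h.denom_ne_zero (ζ := ray y x) (by simpa using hy)
        field_simp
        ring
      have h2 : ∀ v : ℝ, (Real.exp v + 1)⁻¹ ≤ 1 := fun v =>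
        inv_le_one_of_one_le₀ (by linarith [Real.exp_pos v])
      have h3 : ‖exp (α * ray y x) * (exp (α * ray y x) + 1)⁻¹‖ ≤
          Real.exp x * ((Real.cos (α * θ / 2))⁻¹ * 1) := by
        rw [norm_mul, norm_exp_mul_ray]
        gcongr
        · nlinarith [h.one_lt]
        · exact hα.trans (by gcongr; exact h2 _)
      have h4 : ‖exp (ray y x) * (exp (ray y x) + 1)⁻¹‖ ≤
          Real.exp x * ((Real.cos (θ / 2))⁻¹ * 1) := by
        rw [norm_mul, norm_exp_ray]
        gcongr
        exact h1.trans (by gcongr; exact h2 _)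
      simp only [e, M, one_mul]
      refine (norm_sub_le _ _).trans ?_
      linarith
    · have h2 : (Real.exp x + 1)⁻¹ ≤ Real.exp (-1 * x) := by
        rw [neg_one_mul, Real.exp_neg]; exact inv_anti₀ (Real.exp_pos x) (by linarith)
      have h3 := h1.trans (mul_le_mul_of_nonneg_left h2 (by positivity))
      have h4 := hα.trans (mul_le_mul_of_nonneg_left (h.inv_exp_mul_add_one_le x hx)
        (by positivity))
      refine (norm_sub_le _ _).trans ?_
      simp only [M, add_mul]
      linarith
  refine ⟨integrable_comp_ray (by simp) (hd.continuousOn.mono (fun ζ (hζ : ζ.im = θ) => by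
    simp [hζ])) (hbd θ left_mem_uIcc), im_integral_ray_eq_zero (by simp) hd hbd fun x => ?_⟩
  have : (exp (ray 0 x) + 1)⁻¹ - (exp (α * ray 0 x) + 1)⁻¹ =
      (((Real.exp x + 1)⁻¹ - (Real.exp (α * x) + 1)⁻¹ : ℝ) : ℂ) := by
    simp [ray]
  simp only [this, ofReal_im]

/-- The part of the evaluation that comes from rotating the rays to the imaginary axis. -/
lemma im_integral_two_exp_div :
    Integrable (fun x : ℝ => 2 * exp (ray θ x) * (1 - exp (2 * ray θ x))⁻¹) ∧
    (∫ x : ℝ, 2 * exp (ray θ x) * (1 - exp (2 * ray θ x))⁻¹).im = Real.pi := by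
  have hπ := h.lt_pi
  have hφ : 2 * θ - Real.pi < Real.pi := by linarith
  have hk : 0 < Real.cos ((2 * θ - Real.pi) / 2) := cos_half_pos (by linarith [h.half_pi_lt]) hφ
  set k := Real.cos ((2 * θ - Real.pi) / 2)
  have hy' : ∀ y ∈ uIcc θ (Real.pi / 2), |2 * y - Real.pi| ≤ 2 * θ - Real.pi := by
    intro y hy
    rw [uIcc_of_ge h.half_pi_lt.le] at hy
    rw [abs_of_nonneg (by linarith [hy.1])]
    linarith [hy.2]
  have hne : ∀ ζ : ℂ, ζ.im ∈ uIcc θ (Real.pi / 2) → 1 - exp (2 * ζ) ≠ 0 := fun ζ hζ => by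
    refine one_sub_exp_ne_zero ?_
    simpa using (hy' _ hζ).trans_lt hφ
  have hge : ∀ y ∈ uIcc θ (Real.pi / 2), ∀ x, ‖(1 - exp (2 * ray y x))⁻¹‖ ≤
      k⁻¹ * (Real.exp (2 * x) + 1)⁻¹ := by
    intro y hy x
    have := norm_one_sub_exp_mul_ray_ge (α := 2) (hy' y hy) hφ x
    rw [norm_inv, ← mul_inv]
    exact inv_anti₀ (by positivity) (by simpa using this)
  have hd : DifferentiableOn ℂ (fun ζ => 2 * exp ζ * (1 - exp (2 * ζ))⁻¹)
      {ζ | ζ.im ∈ uIcc θ (Real.pi / 2)} :=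
    DifferentiableOn.mul (by fun_prop) (DifferentiableOn.inv (by fun_prop) hne)
  have hbd : ∀ y ∈ uIcc θ (Real.pi / 2), ∀ x : ℝ,
      ‖(fun ζ => 2 * exp ζ * (1 - exp (2 * ζ))⁻¹) (ray y x)‖ ≤
      (2 * k⁻¹) * Real.exp (-(min 1 1) * |x|) := by
    intro y hy x
    have h1 := hge y hy x
    simp only [norm_mul, norm_exp_ray, norm_ofNat]
    refine le_exp_neg_min_mul_abs (by positivity) (fun hx => ?_) (fun hx => ?_)
    · have h2 : (Real.exp (2 * x) + 1)⁻¹ ≤ 1 :=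
        inv_le_one_of_one_le₀ (by linarith [Real.exp_pos (2 * x)])
      calc _ ≤ 2 * Real.exp x * (k⁻¹ * 1) := by gcongr; exact h1.trans (by gcongr)
        _ = _ := by ring_nf
    · have h2 : (Real.exp (2 * x) + 1)⁻¹ ≤ Real.exp (-(2 * x)) := by
        rw [Real.exp_neg]; exact inv_anti₀ (Real.exp_pos _) (by linarith)
      calc _ ≤ 2 * Real.exp x * (k⁻¹ * Real.exp (-(2 * x))) := by
            gcongr; exact h1.trans (by gcongr)
        _ = 2 * k⁻¹ * (Real.exp x * Real.exp (-(2 * x))) := by ring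
        _ = _ := by rw [← Real.exp_add]; ring_nf
  refine ⟨integrable_comp_ray (by simp) (hd.continuousOn.mono (fun ζ (hζ : ζ.im = θ) => by
    simp [hζ])) (hbd θ left_mem_uIcc), ?_⟩
  rw [integral_ray_eq_integral_ray (by simp) hd hbd]
  have hI : exp ((Real.pi / 2 : ℝ) * I) = I := by
    push_cast; exact exp_pi_div_two_mul_I
  have e : ∀ x : ℝ, 2 * exp (ray (Real.pi / 2) x) * (1 - exp (2 * ray (Real.pi / 2) x))⁻¹ =
      ((2 * Real.exp x / (1 + Real.exp (2 * x)) : ℝ) : ℂ) * I := by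
    intro x
    have e2 : exp (2 * ray (Real.pi / 2) x) = -((Real.exp (2 * x) : ℝ) : ℂ) := by
      have := exp_nat_mul (ray (Real.pi / 2) x) 2
      rw [Nat.cast_ofNat] at this
      rw [this, exp_ray, hI, mul_pow, I_sq, two_mul x, Real.exp_add]
      push_cast
      ring
    rw [e2, exp_ray, hI, sub_neg_eq_add]
    push_cast
    ring
  simp only [e]
  rw [integral_mul_const, integral_complex_ofReal, im_ofReal_mul, I_im, mul_one,
    integral_two_mul_exp_div]

/-- The contour integral solves the scalar constant-order problem. -/
theorem im_mlJ_identity {t : ℝ} (ht : 0 < t) :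
    (∫ τ in Ioo 0 t, (((t - τ) ^ (1 - α) / Real.Gamma (2 - α) : ℝ) : ℂ) * mlJ α θ τ).im +
      (∫ τ in Ioc 0 t, ((t - τ : ℝ) : ℂ) * mlJ α θ τ).im = Real.pi := by
  have hk := h.cos_pos
  have hD : ∀ x, exp (α * ray θ x) + 1 ≠ 0 := fun x => h.denom_ne_zero (by simp)
  have i1 : Integrable (fun x : ℝ => exp (α * ray θ x) / (exp (α * ray θ x) + 1) *
      exp (t * exp (ray θ x))) := by
    refine ((integral_exp_mul_exp_neg (γ := α) (by linarith [h.one_lt])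
      (mul_pos h.neg_cos_pos ht)).1.const_mul (Real.cos (α * θ / 2))⁻¹).mono' ?_
      (Eventually.of_forall fun x => ?_)
    · exact Continuous.aestronglyMeasurable
        (Continuous.mul (Continuous.div (by fun_prop) (by fun_prop) hD) (by fun_prop))
    · rw [norm_mul, norm_exp_mul_exp_ray', div_eq_mul_inv, norm_mul, norm_exp_mul_ray, ← mul_assoc]
      have h2 : (Real.exp (α * x) + 1)⁻¹ ≤ 1 := inv_le_one_of_one_le₀ (by
        linarith [Real.exp_pos (α * x)])
      have h3 : ‖(exp (α * ray θ x) + 1)⁻¹‖ ≤ (Real.cos (α * θ / 2))⁻¹ * 1 :=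
        (h.norm_inv_denom_le left_mem_uIcc x).trans (by gcongr)
      refine mul_le_mul_of_nonneg_right ?_ (Real.exp_pos _).le
      rw [mul_comm]
      exact mul_le_mul_of_nonneg_right (by simpa using h3) (Real.exp_pos _).le
  rw [h.integral_rpow_mul_mlJ ht, h.integral_sub_mul_mlJ ht, ← add_im,
    ← integral_add i1 (h.integrable_exp_sub_one_div ht)]
  obtain ⟨a1, a2⟩ := h.im_integral_exp_exp_sub ht
  obtain ⟨b1, b2⟩ := h.im_integral_inv_sub_inv
  obtain ⟨c1, c2⟩ := h.im_integral_two_exp_div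
  -- The left side is `e^{tz} - 1/(z^α + 1)`. The first term should be rotated to the negative axis
  -- and the second to the positive one, but neither is integrable alone. Inserting `1/(1-z)` and
  -- `1/(1+z)`, which have no pole in the respective sectors, makes each difference decay at both
  -- ends. The compensating term `2z/(1-z²)` is evaluated on the imaginary axis and yields all of
  -- `π`.
  have e : ∀ x : ℝ, exp (α * ray θ x) / (exp (α * ray θ x) + 1) * exp (t * exp (ray θ x)) +
      (exp (t * exp (ray θ x)) - 1) / (exp (α * ray θ x) + 1) =
      (exp (t * exp (ray θ x)) - (1 - exp (ray θ x))⁻¹) +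
      ((exp (ray θ x) + 1)⁻¹ - (exp (α * ray θ x) + 1)⁻¹) +
      2 * exp (ray θ x) * (1 - exp (2 * ray θ x))⁻¹ := by
    intro x
    have h1 := hD x
    have h2 : exp (ray θ x) + 1 ≠ 0 := by
      simpa using exp_add_ne_zero_of_abs_im_lt zero_le_one (ζ := ray θ x)
        (by simpa [abs_of_pos h.pos] using h.lt_pi)
    have h3 : 1 - exp (ray θ x) ≠ 0 := one_sub_exp_ne_zero (by
      rw [ray_im, abs_of_neg (by linarith [h.lt_pi])]; linarith [h.pos])
    have e2 : 1 - exp (2 * ray θ x) = (1 - exp (ray θ x)) * (exp (ray θ x) + 1) := by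
      have := exp_nat_mul (ray θ x) 2
      rw [Nat.cast_ofNat] at this
      rw [this]; ring
    rw [e2]
    field_simp
    ring
  simp only [e]
  have ab : Integrable (fun x : ℝ => (exp (t * exp (ray θ x)) - (1 - exp (ray θ x))⁻¹) +
      ((exp (ray θ x) + 1)⁻¹ - (exp (α * ray θ x) + 1)⁻¹)) := a1.add b1
  rw [integral_add ab c1, integral_add a1 b1, add_im, add_im, a2, b2, c2]
  simp

end RayAngle

end Strip

/-! ### Convolution on a bounded interval -/

section Vconv

lemma integrable_indicator_Ioo {E : Type*} [NormedAddCommGroup E] {T : ℝ} {y : ℝ → E}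
    (hf : IntegrableOn y (Ioo 0 T)) :
    Integrable ((Ioo 0 T).indicator y) := (integrable_indicator_iff measurableSet_Ioo).2 hf


variable {E : Type*} [NormedAddCommGroup E] [NormedSpace ℝ E]

/-- The convolution `∫₀ᵗ f (t - τ) y τ dτ`. -/
noncomputable def vconv (f : ℝ → ℝ) (y : ℝ → E) (t : ℝ) : E :=
  ∫ τ in (0 : ℝ)..t, f (t - τ) • y τ

open scoped Convolution

/-- Extending both factors by zero outside `(0, T)` does not change the convolution at times `t ≤
T`. Existence almost everywhere, integrability and associativity therefore follow from the theory of
convolutions on the whole line. -/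
lemma indicator_smul_indicator {T t : ℝ} (ht : t ≤ T) (f : ℝ → ℝ) (y : ℝ → E) (s : ℝ) :
    (Ioo 0 T).indicator f s • (Ioo 0 T).indicator y (t - s) =
      (Ioo 0 t).indicator (fun s => f s • y (t - s)) s := by
  by_cases hs : s ∈ Ioo 0 t
  · rw [indicator_of_mem hs, indicator_of_mem (show s ∈ Ioo 0 T from ⟨hs.1, hs.2.trans_le ht⟩),
      indicator_of_mem (show t - s ∈ Ioo 0 T from ⟨by linarith [hs.2], by linarith [hs.1]⟩)]
  · rw [indicator_of_notMem hs]
    by_cases h1 : s ∈ Ioo 0 T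
    · have h2 : t - s ∉ Ioo 0 T := fun h2 => hs ⟨h1.1, by linarith [h2.1]⟩
      rw [indicator_of_notMem h2, smul_zero]
    · rw [indicator_of_notMem h1, zero_smul]

lemma convolutionExistsAt_iff {T t : ℝ} (h0 : 0 ≤ t) (ht : t ≤ T) (f : ℝ → ℝ) (y : ℝ → E) :
    ConvolutionExistsAt ((Ioo 0 T).indicator f) ((Ioo 0 T).indicator y) t
      (ContinuousLinearMap.lsmul ℝ ℝ) volume ↔
      IntervalIntegrable (fun τ => f (t - τ) • y τ) volume 0 t := by
  simp only [ConvolutionExistsAt, ContinuousLinearMap.lsmul_apply, indicator_smul_indicator ht]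
  rw [integrable_indicator_iff measurableSet_Ioo,
    ← intervalIntegrable_iff_integrableOn_Ioo_of_le h0]
  have h1 := IntervalIntegrable.comp_sub_left_iff (f := fun s => f s • y (t - s)) (a := 0) (b := t)
    (c := t) enorm_ne_top
  simp only [sub_sub_cancel, sub_zero, sub_self] at h1
  rw [← h1]
  exact ⟨fun h => h.symm, fun h => h.symm⟩

lemma vconv_eq_convolution {T t : ℝ} (h0 : 0 ≤ t) (ht : t ≤ T) (f : ℝ → ℝ) (y : ℝ → E) :
    vconv f y t = ((Ioo 0 T).indicator f ⋆[ContinuousLinearMap.lsmul ℝ ℝ, volume]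
      (Ioo 0 T).indicator y) t := by
  simp only [convolution, ContinuousLinearMap.lsmul_apply, indicator_smul_indicator ht]
  rw [integral_indicator measurableSet_Ioo, ← integral_Ioc_eq_integral_Ioo,
    ← intervalIntegral.integral_of_le h0, vconv]
  have h1 := intervalIntegral.integral_comp_sub_left (fun s => f s • y (t - s)) (a := 0) (b := t) t
  simp only [sub_sub_cancel, sub_zero, sub_self] at h1
  exact h1

variable {T : ℝ} {f g : ℝ → ℝ} {y z : ℝ → E}

lemma ae_intervalIntegrable_vconv (hf : IntegrableOn f (Ioo 0 T)) (hy : IntegrableOn y (Ioo 0 T)) :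
    ∀ᵐ t ∂(volume.restrict (Ioo 0 T)),
      IntervalIntegrable (fun τ => f (t - τ) • y τ) volume 0 t := by
  have h := (integrable_indicator_Ioo hf).ae_convolution_exists
    (ContinuousLinearMap.lsmul ℝ ℝ) (integrable_indicator_Ioo hy)
  filter_upwards [ae_restrict_of_ae h, ae_restrict_mem measurableSet_Ioo] with t ht hm
  exact (convolutionExistsAt_iff hm.1.le hm.2.le f y).1 ht

lemma integrableOn_vconv (hf : IntegrableOn f (Ioo 0 T)) (hy : IntegrableOn y (Ioo 0 T)) :
    IntegrableOn (vconv f y) (Ioo 0 T) := by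
  have h := ((integrable_indicator_Ioo hf).integrable_convolution
    (ContinuousLinearMap.lsmul ℝ ℝ) (integrable_indicator_Ioo hy)).integrableOn (s := Ioo 0 T)
  exact (integrableOn_congr_fun (fun t ht => (vconv_eq_convolution ht.1.le ht.2.le f y).symm)
    measurableSet_Ioo).1 h

lemma vconv_congr_right {t : ℝ} (ht : t ∈ Ioo 0 T) (f : ℝ → ℝ)
    (h : ∀ᵐ τ ∂(volume.restrict (Ioo 0 T)), y τ = z τ) : vconv f y t = vconv f z t := by
  refine intervalIntegral.integral_congr_ae_restrict ?_
  rw [uIoc_of_le ht.1.le, ← restrict_Ioo_eq_restrict_Ioc]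
  filter_upwards [ae_restrict_of_ae_restrict_of_subset (Ioo_subset_Ioo_right ht.2.le) h]
    with τ hτ
  rw [hτ]

lemma vconv_comm (f g : ℝ → ℝ) (t : ℝ) : vconv f g t = vconv g f t := by
  have h1 := intervalIntegral.integral_comp_sub_left (fun s => f s * g (t - s)) (a := 0)
    (b := t) t
  simp only [sub_sub_cancel, sub_zero, sub_self] at h1
  simp only [vconv, smul_eq_mul, h1]
  exact intervalIntegral.integral_congr (fun s _ => mul_comm _ _)

lemma vconv_eq_integral_smul_sub (f : ℝ → ℝ) (y : ℝ → E) (t : ℝ) :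
    vconv f y t = ∫ τ in (0 : ℝ)..t, f τ • y (t - τ) := by
  have h1 := intervalIntegral.integral_comp_sub_left (fun s => f s • y (t - s)) (a := 0)
    (b := t) t
  simp only [sub_sub_cancel, sub_zero, sub_self] at h1
  exact h1

lemma vconv_congr_left {t : ℝ} (ht : t ∈ Ioo 0 T) (y : ℝ → E)
    (h : ∀ᵐ τ ∂(volume.restrict (Ioo 0 T)), f τ = g τ) : vconv f y t = vconv g y t := by
  rw [vconv_eq_integral_smul_sub, vconv_eq_integral_smul_sub]
  refine intervalIntegral.integral_congr_ae_restrict ?_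
  rw [uIoc_of_le ht.1.le, ← restrict_Ioo_eq_restrict_Ioc]
  filter_upwards [ae_restrict_of_ae_restrict_of_subset (Ioo_subset_Ioo_right ht.2.le) h]
    with τ hτ
  rw [hτ]

lemma convolution_indicator_of_nonpos {t : ℝ} (ht : t ≤ 0) (f : ℝ → ℝ) (y : ℝ → E) :
    ((Ioo 0 T).indicator f ⋆[ContinuousLinearMap.lsmul ℝ ℝ, volume]
      (Ioo 0 T).indicator y) t = 0 := by
  simp only [convolution, ContinuousLinearMap.lsmul_apply]
  rcases le_total t T with h | h
  · simp only [indicator_smul_indicator h, Ioo_eq_empty (not_lt.2 ht), indicator_empty,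
      integral_zero]
  · simp [Ioo_eq_empty (not_lt.2 (h.trans ht))]

variable [CompleteSpace E]

/-- Associativity of convolution on `(0, T)`. -/
lemma ae_vconv_assoc (hf : IntegrableOn f (Ioo 0 T)) (hg : IntegrableOn g (Ioo 0 T))
    (hy : IntegrableOn y (Ioo 0 T)) :
    ∀ᵐ t ∂(volume.restrict (Ioo 0 T)), vconv (vconv f g) y t = vconv f (vconv g y) t := by
  have hf' := integrable_indicator_Ioo hf
  have hg' := integrable_indicator_Ioo hg
  have hy' := integrable_indicator_Ioo hy
  have h1 := hf'.ae_convolution_exists (ContinuousLinearMap.lsmul ℝ ℝ) hg'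
  have h2 := hg'.norm.ae_convolution_exists (ContinuousLinearMap.mul ℝ ℝ) hy'.norm
  have h3 := hf'.norm.ae_convolution_exists (ContinuousLinearMap.mul ℝ ℝ)
    (hg'.norm.integrable_convolution (ContinuousLinearMap.mul ℝ ℝ) hy'.norm)
  filter_upwards [ae_restrict_of_ae h3, ae_restrict_mem measurableSet_Ioo] with t ht hm
  have key := convolution_assoc (ContinuousLinearMap.lsmul ℝ ℝ) (ContinuousLinearMap.lsmul ℝ ℝ)
    (ContinuousLinearMap.lsmul ℝ ℝ) (ContinuousLinearMap.lsmul ℝ ℝ)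
    (fun a b c => smul_assoc a b c) hf'.aestronglyMeasurable hg'.aestronglyMeasurable
    hy'.aestronglyMeasurable h1 h2 ht
  rw [vconv_eq_convolution hm.1.le hm.2.le, vconv_eq_convolution hm.1.le hm.2.le]
  convert key using 1
  -- The inner convolution on the line need not vanish beyond `T`, unlike the truncated `vconv`.
  -- This is harmless: for `s ≥ T > t` the other factor vanishes at `t - s`.
  · refine integral_congr_ae (Eventually.of_forall fun s => ?_)
    simp only [ContinuousLinearMap.lsmul_apply]
    by_cases hs : s ∈ Ioo 0 T
    · rw [indicator_of_mem hs, vconv_eq_convolution hs.1.le hs.2.le]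
    · rw [indicator_of_notMem hs, zero_smul]
      rcases le_or_gt s 0 with h | h
      · rw [convolution_indicator_of_nonpos h, zero_smul]
      · have : t - s ∉ Ioo 0 T := fun h' => hs ⟨h, by linarith [h'.1, hm.2]⟩
        rw [indicator_of_notMem this, smul_zero]
  · refine integral_congr_ae (Eventually.of_forall fun s => ?_)
    simp only [ContinuousLinearMap.lsmul_apply]
    by_cases hs : s ∈ Ioo 0 T
    · congr 1
      by_cases hs' : t - s ∈ Ioo 0 T
      · rw [indicator_of_mem hs', vconv_eq_convolution hs'.1.le hs'.2.le]
      · rw [indicator_of_notMem hs', convolution_indicator_of_nonpos]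
        by_contra h
        exact hs' ⟨by linarith, by linarith [hs.1, hm.2]⟩
    · rw [indicator_of_notMem hs, zero_smul, zero_smul]

end Vconv

/-! ### The resolvent kernel of constant order -/

section ConstantOrder

/-- A solution of the scalar problem of constant order `α`, bounded uniformly in `μ`. -/
theorem exists_constant_order_kernel {α : ℝ} (h1 : 1 < α) (h2 : α < 2) :
    ∃ C : ℝ, 0 < C ∧ ∀ μ : ℝ, 0 < μ → ∃ s : ℝ → ℝ, Measurable s ∧
      (∀ t, 0 < t → |s t| ≤ C * t ^ (α - 2)) ∧
      ∀ t, 0 < t → vconv (fun r => r ^ (1 - α) / Real.Gamma (2 - α)) s t +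
        μ * vconv (fun r => r) s t = 1 := by
  have hπ := Real.pi_pos
  obtain ⟨θ, hθ1, hθ2⟩ : ∃ θ, Real.pi / 2 < θ ∧ θ < Real.pi / α := exists_between (by
    gcongr)
  have h : RayAngle α θ := ⟨h1, h2, hθ1, by rwa [lt_div_iff₀ (by linarith), mul_comm] at hθ2⟩
  set K := (Real.cos (α * θ / 2))⁻¹ * ((-Real.cos θ) ^ (α - 2) * Real.Gamma (2 - α))
  have hK : 0 < K := by
    have := h.cos_pos
    have := h.neg_cos_pos
    have := Real.Gamma_pos_of_pos (show 0 < 2 - α by linarith)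
    positivity
  -- The lower ray contributes the conjugate of the upper one, so `(2πi)⁻¹` times the full contour
  -- integral is the imaginary part divided by `π`. This is the case `μ = 1`.
  let s : ℝ → ℝ := fun t => Real.pi⁻¹ * (mlJ α θ t).im
  have hsm : Measurable s :=
    (Complex.measurable_im.comp h.stronglyMeasurable_mlJ.measurable).const_mul _
  have hsb : ∀ t, 0 < t → |s t| ≤ Real.pi⁻¹ * K * t ^ (α - 2) := by
    intro t ht
    rw [abs_mul, abs_of_pos (inv_pos.2 hπ), mul_assoc]
    exact mul_le_mul_of_nonneg_left ((Complex.abs_im_le_norm _).trans (h.norm_mlJ_le ht))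
      (inv_pos.2 hπ).le
  have hJi : ∀ t, 0 < t → IntegrableOn (mlJ α θ) (Ioc 0 t) := by
    intro t ht
    have : IntervalIntegrable (fun τ : ℝ => τ ^ (α - 2)) volume 0 t :=
      intervalIntegral.intervalIntegrable_rpow' (by linarith)
    refine (((intervalIntegrable_iff_integrableOn_Ioc_of_le ht.le).1 this).const_mul K).mono'
      h.stronglyMeasurable_mlJ.aestronglyMeasurable
      ((ae_restrict_mem measurableSet_Ioc).mono fun τ hτ => h.norm_mlJ_le hτ.1)
  have hs1 : ∀ t, 0 < t → vconv (fun r => r ^ (1 - α) / Real.Gamma (2 - α)) s t +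
      vconv (fun r => r) s t = 1 := by
    intro t ht
    have key := h.im_mlJ_identity ht
    have i1 : IntegrableOn (fun τ : ℝ => (((t - τ) ^ (1 - α) / Real.Gamma (2 - α) : ℝ) : ℂ) *
        mlJ α θ τ) (Ioo 0 t) := by
      have := (h.integrable_rpow_mul_mlJ ht).const_mul (((Real.Gamma (2 - α))⁻¹ : ℝ) : ℂ)
      refine this.congr (Eventually.of_forall fun τ => ?_)
      push_cast; ring
    have i2 : IntegrableOn (fun τ : ℝ => ((t - τ : ℝ) : ℂ) * mlJ α θ τ) (Ioc 0 t) := by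
      refine ((hJi t ht).norm.const_mul t).mono' ?_ ?_
      · have := h.stronglyMeasurable_mlJ.measurable
        exact Measurable.aestronglyMeasurable (by fun_prop)
      · refine (ae_restrict_mem measurableSet_Ioc).mono fun τ hτ => ?_
        rw [norm_mul, Complex.norm_real, Real.norm_of_nonneg (by linarith [hτ.2])]
        exact mul_le_mul_of_nonneg_right (by linarith [hτ.1]) (norm_nonneg _)
    rw [im_integral_eq i1, im_integral_eq i2] at key
    simp only [Complex.im_ofReal_mul] at key
    simp only [vconv, smul_eq_mul, s]
    rw [intervalIntegral.integral_of_le ht.le, intervalIntegral.integral_of_le ht.le]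
    simp only [mul_left_comm _ Real.pi⁻¹ _, integral_const_mul]
    rw [integral_Ioc_eq_integral_Ioo, ← mul_add, key, inv_mul_cancel₀ hπ.ne']
  refine ⟨Real.pi⁻¹ * K, by positivity, fun μ hμ => ?_⟩
  -- Since `t^(1-α)` and `t` are homogeneous, the dilation by `c` with `c^α = μ` carries the case `μ
  -- = 1` to any `μ`. The bound `t^(α-2)` scales with the factor `c^(2-α)`, so its constant does not
  -- depend on `μ`.
  set c := μ ^ (1 / α)
  have hc : 0 < c := Real.rpow_pos_of_pos hμ _
  have hcα : c ^ α = μ := by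
    rw [← Real.rpow_mul hμ.le, one_div, inv_mul_cancel₀ (by linarith), Real.rpow_one]
  refine ⟨fun t => c ^ (2 - α) * s (c * t), by fun_prop, fun t ht => ?_, fun t ht => ?_⟩
  · rw [abs_mul, abs_of_pos (Real.rpow_pos_of_pos hc _)]
    refine (mul_le_mul_of_nonneg_left (hsb (c * t) (by positivity))
      (Real.rpow_pos_of_pos hc _).le).trans (le_of_eq ?_)
    rw [Real.mul_rpow hc.le ht.le]
    have : c ^ (2 - α) * c ^ (α - 2) = 1 := by
      rw [← Real.rpow_add hc]; simp
    linear_combination (Real.pi⁻¹ * K * t ^ (α - 2)) * this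
  · refine Eq.trans ?_ (hs1 (c * t) (by positivity))
    congr 1
    · have hsub := intervalIntegral.smul_integral_comp_mul_left (a := 0) (b := t)
        (fun σ => ((c * t - σ) ^ (1 - α) / Real.Gamma (2 - α)) * s σ) c
      simp only [vconv, smul_eq_mul] at hsub ⊢
      rw [mul_zero] at hsub
      rw [← hsub, ← intervalIntegral.integral_const_mul]
      refine intervalIntegral.integral_congr fun τ hτ => ?_
      rw [uIcc_of_le ht.le] at hτ
      have e : c * t - c * τ = c * (t - τ) := by ring
      simp only [e]
      rw [Real.mul_rpow hc.le (by linarith [hτ.2])]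
      have : c ^ (2 - α) = c * c ^ (1 - α) := by
        rw [show 2 - α = 1 + (1 - α) by ring, Real.rpow_add hc, Real.rpow_one]
      rw [this]
      ring
    · have hsub := intervalIntegral.smul_integral_comp_mul_left (a := 0) (b := t)
        (fun σ => (c * t - σ) * s σ) c
      simp only [vconv, smul_eq_mul] at hsub ⊢
      rw [mul_zero] at hsub
      rw [← hsub, ← intervalIntegral.integral_const_mul, ← intervalIntegral.integral_const_mul]
      refine intervalIntegral.integral_congr fun τ _ => ?_
      have : μ * c ^ (2 - α) = c * c := by
        rw [← hcα, ← Real.rpow_add hc]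
        have : α + (2 - α) = (2 : ℕ) := by push_cast; ring
        rw [this, Real.rpow_natCast, sq]
      linear_combination ((t - τ) * s (c * τ)) * this

end ConstantOrder

/-! ### The variable-exponent kernel as a perturbation of a constant-exponent one -/

section Perturbation

lemma exists_abs_log_le {T ε : ℝ} (hT : 0 < T) (hε : 0 < ε) :
    ∃ C : ℝ, 0 < C ∧ ∀ t ∈ Ioo 0 T, |Real.log t| ≤ C * t ^ (-ε) := by
  refine ⟨1 / ε + T * T ^ ε, by positivity, fun t ht => ?_⟩
  have ht0 := ht.1
  rcases le_total t 1 with h | h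
  · have h1 := (Real.abs_log_mul_self_rpow_lt t ε ht0 h hε).le
    rw [abs_mul, abs_of_pos (Real.rpow_pos_of_pos ht0 _)] at h1
    have h2 : |Real.log t| ≤ 1 / ε * t ^ (-ε) := by
      rw [Real.rpow_neg ht0.le, ← div_eq_mul_inv, le_div_iff₀ (Real.rpow_pos_of_pos ht0 _)]
      exact h1
    refine h2.trans ?_
    rw [add_mul]
    have : 0 ≤ T * T ^ ε * t ^ (-ε) := by positivity
    linarith
  · rw [abs_of_nonneg (Real.log_nonneg h)]
    have h1 : Real.log t ≤ T := (Real.log_le_self ht0.le).trans ht.2.le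
    have h2 : 1 ≤ T ^ ε * t ^ (-ε) := by
      rw [Real.rpow_neg ht0.le, ← div_eq_mul_inv, one_le_div (Real.rpow_pos_of_pos ht0 _)]
      exact Real.rpow_le_rpow ht0.le ht.2.le hε.le
    have h3 : T ≤ T * (T ^ ε * t ^ (-ε)) := le_mul_of_one_le_right hT.le h2
    have : 0 ≤ 1 / ε * t ^ (-ε) := by positivity
    rw [add_mul]
    linarith

/-- The function `1 / Γ(2 - a)` and its derivative are bounded for `a ∈ [1, 2]`. -/
lemma exists_bound_inv_Gamma : ∃ (γ' : ℝ → ℝ) (G : ℝ), 0 < G ∧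
    (∀ a, HasDerivAt (fun a => (Real.Gamma (2 - a))⁻¹) (γ' a) a) ∧
    ∀ a ∈ Icc (1 : ℝ) 2, |(Real.Gamma (2 - a))⁻¹| ≤ G ∧ |γ' a| ≤ G := by
  -- The reciprocal of `Γ` is entire, so the bounds hold up to the endpoint `a = 2`, where `Γ`
  -- itself has a pole.
  let γ : ℂ → ℂ := fun z => (Complex.Gamma (2 - z))⁻¹
  have hγ : Differentiable ℂ γ :=
    Complex.differentiable_one_div_Gamma.comp ((differentiable_const 2).sub differentiable_id)
  have hre : ∀ a : ℝ, (γ a).re = (Real.Gamma (2 - a))⁻¹ := by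
    intro a
    have : (2 : ℂ) - a = ((2 - a : ℝ) : ℂ) := by push_cast; rfl
    simp only [γ, this, Complex.Gamma_ofReal, ← Complex.ofReal_inv, Complex.ofReal_re]
  have hder : ∀ a : ℝ, HasDerivAt (fun a => (Real.Gamma (2 - a))⁻¹) (deriv γ a).re a := by
    intro a
    have := (hγ a).hasDerivAt.real_of_complex
    simpa only [hre] using this
  have hc : Continuous (deriv γ) := (hγ.contDiff (n := 1)).continuous_deriv le_rfl
  have hc1 : Continuous fun a : ℝ => (deriv γ a).re := by fun_prop
  have hc2 : Continuous fun a : ℝ => (Real.Gamma (2 - a))⁻¹ :=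
    continuous_iff_continuousAt.2 fun a => (hder a).continuousAt
  obtain ⟨B1, h1⟩ := isCompact_Icc.exists_bound_of_continuousOn
    (hc1.continuousOn (s := Icc (1 : ℝ) 2))
  obtain ⟨B2, h2⟩ := isCompact_Icc.exists_bound_of_continuousOn
    (hc2.continuousOn (s := Icc (1 : ℝ) 2))
  refine ⟨fun a => (deriv γ a).re, max 1 (max B1 B2), by positivity, hder, fun a ha => ⟨?_, ?_⟩⟩
  · exact (h2 a ha).trans ((le_max_right _ _).trans (le_max_right _ _))
  · exact (h1 a ha).trans ((le_max_left _ _).trans (le_max_right _ _))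

variable {T L : ℝ} {α : ℝ → ℝ}

lemma IsAdmissibleExponent.hasDerivAt (hα : IsAdmissibleExponent T L α) {t : ℝ}
    (ht : t ∈ Ioo 0 T) : HasDerivAt α (deriv α t) t ∧ |deriv α t| ≤ L := by
  have hd : DifferentiableOn ℝ α (Icc 0 T) := by
    simpa using hα.differentiable 0 (by norm_num)
  have hn : Icc 0 T ∈ 𝓝 t := Icc_mem_nhds ht.1 ht.2
  have h1 := (hd t (Ioo_subset_Icc_self ht)).differentiableAt hn
  refine ⟨h1.hasDerivAt, ?_⟩
  have hb := hα.bound t (Ioo_subset_Icc_self ht)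
  rw [iteratedDerivWithin_one, derivWithin_of_mem_nhds hn] at hb
  linarith [abs_nonneg (iteratedDerivWithin 2 α (Icc 0 T) t),
    abs_nonneg (iteratedDerivWithin 3 α (Icc 0 T) t)]

lemma IsAdmissibleExponent.continuousOn (hα : IsAdmissibleExponent T L α) :
    ContinuousOn α (Icc 0 T) := by
  have hd : DifferentiableOn ℝ α (Icc 0 T) := by
    simpa using hα.differentiable 0 (by norm_num)
  exact hd.continuousOn

lemma IsAdmissibleExponent.abs_sub_le (hα : IsAdmissibleExponent T L α) {t : ℝ}
    (ht : t ∈ Ioo 0 T) : |α t - α 0| ≤ L * t := by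
  have hd : DifferentiableOn ℝ α (Icc 0 T) := by
    simpa using hα.differentiable 0 (by norm_num)
  have hT : 0 ≤ T := (ht.1.trans ht.2).le
  have := (convex_Icc 0 T).norm_image_sub_le_of_norm_derivWithin_le (C := L) hd (fun x hx => by
    have hb := hα.bound x hx
    rw [iteratedDerivWithin_one] at hb
    rw [Real.norm_eq_abs]
    linarith [abs_nonneg (iteratedDerivWithin 2 α (Icc 0 T) x),
      abs_nonneg (iteratedDerivWithin 3 α (Icc 0 T) x)]) (left_mem_Icc.2 hT)
    (Ioo_subset_Icc_self ht)
  simpa [abs_of_pos ht.1] using this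

/-- The bounded factor of the kernel: `k(t) = t ^ (1 - α(0)) * kernelFactor α t`. -/
noncomputable def kernelFactor (α : ℝ → ℝ) (t : ℝ) : ℝ :=
  Real.exp (-(α t - α 0) * Real.log t) * (Real.Gamma (2 - α t))⁻¹

lemma kernel_eq_rpow_mul_kernelFactor (α : ℝ → ℝ) {t : ℝ} (ht : 0 < t) :
    kernel α t = t ^ (1 - α 0) * kernelFactor α t := by
  rw [kernel, kernelFactor, div_eq_mul_inv, ← mul_assoc]
  congr 1
  rw [Real.rpow_def_of_pos ht, Real.rpow_def_of_pos ht, ← Real.exp_add]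
  congr 1; ring

lemma kernelFactor_zero (α : ℝ → ℝ) : kernelFactor α 0 = (Real.Gamma (2 - α 0))⁻¹ := by
  simp [kernelFactor]

/-- The kernel of variable exponent is a perturbation of that of constant exponent `α 0` by
a function whose derivative is less singular. -/
theorem exists_kernel_decomposition (hT : 0 < T) (hα : IsAdmissibleExponent T L α) :
    ∃ (q : ℝ → ℝ) (C : ℝ), 0 < C ∧ Measurable q ∧
      (∀ t ∈ Ioo 0 T, |q t| ≤ C * t ^ ((2 - α 0) / 2 - 1)) ∧
      ∀ t ∈ Ioo 0 T, kernel α t = t ^ (1 - α 0) / Real.Gamma (2 - α 0) + ∫ τ in (0 : ℝ)..t, q τ := by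
  obtain ⟨h1, h2⟩ := hα.range 0 ⟨le_rfl, hT.le⟩
  -- The logarithm is absorbed into `t^(-ε)`. With this `ε` one has `t^(1 - α 0) * t^(-ε) = t^(ε -
  -- 1)`, which is integrable.
  set ε := (2 - α 0) / 2 with hεdef
  have hε : 0 < ε := by linarith
  have hε1 : ε < 1 := by linarith
  have hL : 0 ≤ L := (abs_nonneg _).trans (hα.hasDerivAt (t := T / 2) ⟨by linarith, by linarith⟩).2
  obtain ⟨Cl, hCl, hlog⟩ := exists_abs_log_le hT hε
  obtain ⟨γ', G, hG, hγ, hGb⟩ := exists_bound_inv_Gamma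
  have hrange : ∀ t ∈ Icc 0 T, α t ∈ Icc (1 : ℝ) 2 := fun t ht =>
    ⟨(hα.range t ht).1.le, (hα.range t ht).2.le⟩
  -- the exponent of the exponential factor
  have hexp : ∀ t ∈ Ioo 0 T, |-(α t - α 0) * Real.log t| ≤ L * Cl * t ^ (1 - ε) := by
    intro t ht
    rw [abs_mul, abs_neg, show (1 - ε) = 1 + -ε by ring, Real.rpow_add ht.1, Real.rpow_one]
    calc _ ≤ (L * t) * (Cl * t ^ (-ε)) := by
          gcongr
          · exact mul_nonneg hL ht.1.le
          · exact hα.abs_sub_le ht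
          · exact hlog t ht
      _ = _ := by ring
  set E := Real.exp (L * Cl * T ^ (1 - ε))
  have hE : ∀ t ∈ Ioo 0 T, Real.exp (-(α t - α 0) * Real.log t) ≤ E := by
    intro t ht
    refine Real.exp_le_exp.2 ((le_abs_self _).trans ((hexp t ht).trans ?_))
    have := Real.rpow_le_rpow ht.1.le ht.2.le (by linarith : 0 ≤ 1 - ε)
    gcongr
  -- the derivative of the bounded factor
  let Φ' : ℝ → ℝ := fun t => Real.exp (-(α t - α 0) * Real.log t) *
    (-(deriv α t) * Real.log t + -(α t - α 0) * t⁻¹) * (Real.Gamma (2 - α t))⁻¹ +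
    Real.exp (-(α t - α 0) * Real.log t) * (γ' (α t) * deriv α t)
  have hΦ' : ∀ t ∈ Ioo 0 T, HasDerivAt (kernelFactor α) (Φ' t) t := by
    intro t ht
    have ha := (hα.hasDerivAt ht).1
    exact ((((ha.sub_const (α 0)).neg).mul (Real.hasDerivAt_log ht.1.ne')).exp).mul
      ((hγ (α t)).comp t ha)
  set C1 := E * (L * Cl + L * T ^ ε) * G + E * (G * L) * T ^ ε
  have hC1 : 0 ≤ C1 := by positivity
  have hTε : ∀ t ∈ Ioo 0 T, 1 ≤ T ^ ε * t ^ (-ε) := by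
    intro t ht
    rw [Real.rpow_neg ht.1.le, ← div_eq_mul_inv, one_le_div (Real.rpow_pos_of_pos ht.1 _)]
    exact Real.rpow_le_rpow ht.1.le ht.2.le hε.le
  have hΦb : ∀ t ∈ Ioo 0 T, |Φ' t| ≤ C1 * t ^ (-ε) := by
    intro t ht
    have ha := (hα.hasDerivAt ht).2
    obtain ⟨hg1, hg2⟩ := hGb (α t) (hrange t (Ioo_subset_Icc_self ht))
    have hpos : 0 ≤ t ^ (-ε) := Real.rpow_nonneg ht.1.le _
    have e1 : |-(deriv α t) * Real.log t + -(α t - α 0) * t⁻¹| ≤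
        (L * Cl + L * T ^ ε) * t ^ (-ε) := by
      have i1 : |-(deriv α t) * Real.log t| ≤ L * (Cl * t ^ (-ε)) := by
        rw [abs_mul, abs_neg]
        exact mul_le_mul ha (hlog t ht) (abs_nonneg _) hL
      have i2 : |-(α t - α 0) * t⁻¹| ≤ L * (T ^ ε * t ^ (-ε)) := by
        rw [abs_mul, abs_neg, abs_of_pos (inv_pos.2 ht.1), ← div_eq_mul_inv]
        refine ((div_le_iff₀ ht.1).2 (hα.abs_sub_le ht)).trans ?_
        exact le_mul_of_one_le_right hL (hTε t ht)
      refine (abs_add_le _ _).trans ?_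
      linarith
    have e2 : |γ' (α t) * deriv α t| ≤ G * L * (T ^ ε * t ^ (-ε)) := by
      rw [abs_mul]
      refine (mul_le_mul hg2 ha (abs_nonneg _) hG.le).trans ?_
      exact le_mul_of_one_le_right (by positivity) (hTε t ht)
    refine (abs_add_le _ _).trans ?_
    rw [abs_mul, abs_mul, abs_mul, abs_of_pos (Real.exp_pos _)]
    calc _ ≤ E * ((L * Cl + L * T ^ ε) * t ^ (-ε)) * G +
          E * (G * L * (T ^ ε * t ^ (-ε))) := by
          have := hE t ht
          gcongr
      _ = _ := by simp only [C1]; ring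
  -- At `0` the Lipschitz bound for `α` beats the logarithm, so the exponent tends to `0`.
  -- Continuity there allows the fundamental theorem of calculus to start from `0`.
  have hΦc : ContinuousOn (kernelFactor α) (Ico 0 T) := by
    intro t ht
    rcases eq_or_lt_of_le ht.1 with rfl | h
    · have hlim : Tendsto (fun t => -(α t - α 0) * Real.log t) (𝓝[Ico 0 T] 0) (𝓝 0) := by
        have hz : Tendsto (fun t : ℝ => L * Cl * t ^ (1 - ε)) (𝓝[Ico 0 T] 0) (𝓝 0) := by
          have : Tendsto (fun t : ℝ => L * Cl * t ^ (1 - ε)) (𝓝 0) (𝓝 (L * Cl * 0 ^ (1 - ε))) :=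
            ((Real.continuousAt_rpow_const 0 (1 - ε) (Or.inr (by linarith))).tendsto).const_mul _
          rw [Real.zero_rpow (by linarith), mul_zero] at this
          exact this.mono_left nhdsWithin_le_nhds
        refine squeeze_zero_norm' ?_ hz
        filter_upwards [self_mem_nhdsWithin] with s hs
        rcases eq_or_lt_of_le hs.1 with rfl | h
        · simp [Real.zero_rpow (show 1 - ε ≠ 0 by linarith)]
        · exact hexp s ⟨h, hs.2⟩
      have h3 : Tendsto (fun t => (Real.Gamma (2 - α t))⁻¹) (𝓝[Ico 0 T] 0)
          (𝓝 (Real.Gamma (2 - α 0))⁻¹) := by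
        have := (hα.continuousOn 0 ⟨le_rfl, hT.le⟩).mono Ico_subset_Icc_self
        exact (hγ (α 0)).continuousAt.tendsto.comp this
      have h4 := (Real.continuous_exp.tendsto 0).comp hlim
      have h5 := h4.mul h3
      rw [Real.exp_zero, one_mul, ← kernelFactor_zero] at h5
      exact h5
    · exact (hΦ' t ⟨h, ht.2⟩).continuousAt.continuousWithinAt
  -- The fundamental theorem of calculus for a function whose derivative has an integrable power
  -- singularity at `0`. It is applied to the bounded factor and then to the perturbation `m`.
  have hdm : ∀ {F F' : ℝ → ℝ} {C c : ℝ}, 0 < c → ContinuousOn F (Ico 0 T) →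
      (∀ t ∈ Ioo 0 T, HasDerivAt F (F' t) t) → (∀ t ∈ Ioo 0 T, |F' t| ≤ C * t ^ (c - 1)) →
      ∀ t ∈ Ioo 0 T, F t - F 0 = ∫ τ in (0 : ℝ)..t, deriv F τ ∧
        |F t - F 0| ≤ C * (t ^ c / c) := by
    intro F F' C c hc hF hF' hb t ht
    have hpow : IntervalIntegrable (fun τ : ℝ => C * τ ^ (c - 1)) volume 0 t :=
      (intervalIntegral.intervalIntegrable_rpow' (by linarith)).const_mul C
    have hdb : ∀ τ ∈ Ioo 0 T, ‖deriv F τ‖ ≤ C * τ ^ (c - 1) := fun τ hτ => by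
      rw [(hF' τ hτ).deriv]; exact hb τ hτ
    have hint : IntervalIntegrable (deriv F) volume 0 t := by
      rw [intervalIntegrable_iff_integrableOn_Ioo_of_le ht.1.le] at hpow ⊢
      refine hpow.mono' (measurable_deriv F).aestronglyMeasurable
        ((ae_restrict_mem measurableSet_Ioo).mono fun τ hτ => hdb τ ⟨hτ.1, hτ.2.trans ht.2⟩)
    have hftc := intervalIntegral.integral_eq_sub_of_hasDerivAt_of_le ht.1.le
      (hF.mono (Icc_subset_Ico_right ht.2)) (fun τ hτ => by
        have := hF' τ ⟨hτ.1, hτ.2.trans ht.2⟩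
        rwa [← this.deriv] at this) hint
    refine ⟨hftc.symm, ?_⟩
    rw [← hftc]
    have := intervalIntegral.norm_integral_le_of_norm_le ht.1.le
      (Eventually.of_forall fun τ hτ => hdb τ ⟨hτ.1, hτ.2.trans_lt ht.2⟩) hpow
    refine this.trans (le_of_eq ?_)
    rw [intervalIntegral.integral_const_mul, integral_rpow (Or.inl (by linarith)),
      sub_add_cancel, Real.zero_rpow hc.ne', sub_zero]
  have hΦd : ∀ t ∈ Ioo 0 T, |kernelFactor α t - kernelFactor α 0| ≤
      C1 / (1 - ε) * t ^ (1 - ε) := by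
    intro t ht
    have := (hdm (c := 1 - ε) (by linarith) hΦc hΦ' (fun t ht => by
      simpa using hΦb t ht) t ht).2
    refine this.trans (le_of_eq (by ring))
  -- the perturbation
  let m : ℝ → ℝ := fun t => t ^ (1 - α 0) * (kernelFactor α t - kernelFactor α 0)
  have hm0 : m 0 = 0 := by simp [m]
  set C2 := |1 - α 0| * (C1 / (1 - ε)) + C1
  let m' : ℝ → ℝ := fun t => (1 - α 0) * t ^ (1 - α 0 - 1) *
    (kernelFactor α t - kernelFactor α 0) + t ^ (1 - α 0) * Φ' t
  have hm' : ∀ t ∈ Ioo 0 T, HasDerivAt m (m' t) t := fun t ht =>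
    (Real.hasDerivAt_rpow_const (Or.inl ht.1.ne')).mul ((hΦ' t ht).sub_const _)
  have hmb : ∀ t ∈ Ioo 0 T, |m' t| ≤ C2 * t ^ (ε - 1) := by
    intro t ht
    have hp : ∀ r : ℝ, 0 ≤ t ^ r := fun r => Real.rpow_nonneg ht.1.le r
    have e1 : t ^ (1 - α 0 - 1) * t ^ (1 - ε) = t ^ (ε - 1) := by
      rw [← Real.rpow_add ht.1]; congr 1; linarith
    have e2 : t ^ (1 - α 0) * t ^ (-ε) = t ^ (ε - 1) := by
      rw [← Real.rpow_add ht.1]; congr 1; linarith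
    refine (abs_add_le _ _).trans ?_
    rw [abs_mul, abs_mul, abs_mul, abs_of_nonneg (hp _), abs_of_nonneg (hp _)]
    calc _ ≤ |1 - α 0| * t ^ (1 - α 0 - 1) * (C1 / (1 - ε) * t ^ (1 - ε)) +
          t ^ (1 - α 0) * (C1 * t ^ (-ε)) := by
          have := hp (1 - α 0 - 1)
          have := hp (1 - α 0)
          gcongr
          · exact hΦd t ht
          · exact hΦb t ht
      _ = |1 - α 0| * (C1 / (1 - ε)) * (t ^ (1 - α 0 - 1) * t ^ (1 - ε)) +
          C1 * (t ^ (1 - α 0) * t ^ (-ε)) := by ring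
      _ = _ := by rw [e1, e2]; simp only [C2]; ring
  have hmc : ContinuousOn m (Ico 0 T) := by
    intro t ht
    rcases eq_or_lt_of_le ht.1 with rfl | h
    · have hz : Tendsto (fun t : ℝ => C1 / (1 - ε) * t ^ ε) (𝓝[Ico 0 T] 0) (𝓝 0) := by
        have : Tendsto (fun t : ℝ => C1 / (1 - ε) * t ^ ε) (𝓝 0)
            (𝓝 (C1 / (1 - ε) * 0 ^ ε)) :=
          ((Real.continuousAt_rpow_const 0 ε (Or.inr hε.le)).tendsto).const_mul _
        rw [Real.zero_rpow hε.ne', mul_zero] at this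
        exact this.mono_left nhdsWithin_le_nhds
      rw [ContinuousWithinAt, hm0]
      refine squeeze_zero_norm' ?_ hz
      filter_upwards [self_mem_nhdsWithin] with s hs
      rcases eq_or_lt_of_le hs.1 with rfl | h
      · simp [hm0, Real.zero_rpow hε.ne']
      · have hp : 0 ≤ s ^ (1 - α 0) := Real.rpow_nonneg h.le _
        simp only [m]
        rw [norm_mul, Real.norm_of_nonneg hp]
        have e : s ^ ε = s ^ (1 - α 0) * s ^ (1 - ε) := by
          rw [← Real.rpow_add h]; congr 1; linarith
        rw [e]
        calc _ ≤ s ^ (1 - α 0) * (C1 / (1 - ε) * s ^ (1 - ε)) :=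
              mul_le_mul_of_nonneg_left (hΦd s ⟨h, hs.2⟩) hp
          _ = _ := by ring
    · exact (hm' t ⟨h, ht.2⟩).continuousAt.continuousWithinAt
  -- `deriv m` agrees with `m'` on `(0, T)` and is measurable without further argument.
  refine ⟨deriv m, max 1 C2, by positivity, measurable_deriv m, fun t ht => ?_, fun t ht => ?_⟩
  · rw [(hm' t ht).deriv]
    exact (hmb t ht).trans (mul_le_mul_of_nonneg_right (le_max_right _ _)
      (Real.rpow_nonneg ht.1.le _))
  · have := (hdm hε hmc hm' hmb t ht).1
    rw [← this, hm0, sub_zero, kernel_eq_rpow_mul_kernelFactor α ht.1]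
    simp only [m, kernelFactor_zero]
    ring

end Perturbation

/-! ### Linearity of the convolution -/

section VconvLinear

variable {E : Type*} [NormedAddCommGroup E] [NormedSpace ℝ E] {T : ℝ} {f g : ℝ → ℝ} {y z : ℝ → E}

lemma vconv_add_left {t : ℝ} (hf : IntervalIntegrable (fun τ => f (t - τ) • y τ) volume 0 t)
    (hg : IntervalIntegrable (fun τ => g (t - τ) • y τ) volume 0 t) :
    vconv (fun r => f r + g r) y t = vconv f y t + vconv g y t := by
  simp only [vconv, add_smul]
  exact intervalIntegral.integral_add hf hg

lemma vconv_sub_right {t : ℝ} (hy : IntervalIntegrable (fun τ => f (t - τ) • y τ) volume 0 t)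
    (hz : IntervalIntegrable (fun τ => f (t - τ) • z τ) volume 0 t) :
    vconv f (fun r => y r - z r) t = vconv f y t - vconv f z t := by
  simp only [vconv, smul_sub]
  exact intervalIntegral.integral_sub hy hz

lemma vconv_add_right {t : ℝ} (hy : IntervalIntegrable (fun τ => f (t - τ) • y τ) volume 0 t)
    (hz : IntervalIntegrable (fun τ => f (t - τ) • z τ) volume 0 t) :
    vconv f (fun r => y r + z r) t = vconv f y t + vconv f z t := by
  simp only [vconv, smul_add]
  exact intervalIntegral.integral_add hy hz

lemma vconv_const_mul_left (c : ℝ) (f : ℝ → ℝ) (y : ℝ → E) (t : ℝ) :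
    vconv (fun r => c * f r) y t = c • vconv f y t := by
  simp only [vconv, mul_smul]
  exact intervalIntegral.integral_smul c _

lemma vconv_mul_const_right (c : ℝ) (f g : ℝ → ℝ) (t : ℝ) :
    vconv f (fun r => g r * c) t = vconv f g t * c := by
  simp only [vconv, smul_eq_mul, ← mul_assoc]
  exact intervalIntegral.integral_mul_const c _

end VconvLinear

/-! ### Convolution bounds for functions dominated by powers -/

section PowerBounds

lemma integrableOn_rpow_Ioo {T a : ℝ} (hT : 0 < T) (ha : 0 < a) :
    IntegrableOn (fun t : ℝ => t ^ (a - 1)) (Ioo 0 T) := by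
  rw [← intervalIntegrable_iff_integrableOn_Ioo_of_le hT.le]
  exact intervalIntegral.intervalIntegrable_rpow' (by linarith)

lemma integrableOn_of_abs_le_rpow {T a C : ℝ} (hT : 0 < T) (ha : 0 < a) {f : ℝ → ℝ}
    (hf : AEStronglyMeasurable f (volume.restrict (Ioo 0 T)))
    (hb : ∀ t ∈ Ioo 0 T, |f t| ≤ C * t ^ (a - 1)) : IntegrableOn f (Ioo 0 T) :=
  ((integrableOn_rpow_Ioo hT ha).const_mul C).mono' hf
    ((ae_restrict_mem measurableSet_Ioo).mono hb)

lemma abs_vconv_le {T a b A B t : ℝ} (ha : 0 < a) (hb : 0 < b) (hA : 0 ≤ A) {f g : ℝ → ℝ}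
    (hf : ∀ t ∈ Ioo 0 T, |f t| ≤ A * t ^ (a - 1)) (hg : ∀ t ∈ Ioo 0 T, |g t| ≤ B * t ^ (b - 1))
    (ht : t ∈ Ioo 0 T) : |vconv f g t| ≤ A * B * betaR b a * t ^ (b + a - 1) := by
  have hi := (intervalIntegrable_rpow_mul_rpow_sub hb ha ht.1).const_mul (A * B)
  rw [mul_assoc (A * B), ← integral_rpow_mul_rpow_sub ht.1, ← intervalIntegral.integral_const_mul]
  rw [← Real.norm_eq_abs, vconv]
  refine intervalIntegral.norm_integral_le_of_norm_le ht.1.le ?_ hi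
  filter_upwards [(countable_singleton t).ae_notMem volume] with τ hτt hτ
  have hτ2 : τ < t := lt_of_le_of_ne hτ.2 hτt
  have h1 := hf (t - τ) ⟨by linarith, by linarith [ht.2, hτ.1]⟩
  have h2 := hg τ ⟨hτ.1, hτ2.trans ht.2⟩
  rw [smul_eq_mul, norm_mul, Real.norm_eq_abs, Real.norm_eq_abs]
  calc _ ≤ A * (t - τ) ^ (a - 1) * (B * τ ^ (b - 1)) := by
        refine mul_le_mul h1 h2 (abs_nonneg _) ?_
        have : 0 ≤ (t - τ) ^ (a - 1) := Real.rpow_nonneg (by linarith) _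
        positivity
    _ = _ := by ring

lemma exp_neg_le_rpow_neg {v η : ℝ} (hv : 0 < v) (h0 : 0 ≤ η) (h1 : η ≤ 1) :
    Real.exp (-v) ≤ v ^ (-η) := by
  rw [Real.exp_neg, Real.rpow_neg hv.le]
  refine inv_anti₀ (Real.rpow_pos_of_pos hv _) ?_
  calc v ^ η ≤ (1 + v) ^ η := Real.rpow_le_rpow hv.le (by linarith) h0
    _ ≤ (1 + v) ^ (1 : ℝ) := Real.rpow_le_rpow_of_exponent_le (by linarith) h1
    _ ≤ Real.exp v := by rw [Real.rpow_one]; linarith [Real.add_one_le_exp v]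

/-- Convolution with a weakly singular kernel contracts a weighted supremum norm. -/
lemma abs_vconv_le_weighted {T b c σ A D t : ℝ} (hb : 0 < b) (hb2 : b ≤ 2) (hc : 0 < c)
    (hσ : 0 < σ) (hA : 0 ≤ A) (hD : 0 ≤ D) {f g : ℝ → ℝ}
    (hf : ∀ t ∈ Ioo 0 T, |f t| ≤ A * t ^ (b - 1))
    (hg : ∀ t ∈ Ioo 0 T, |g t| ≤ D * Real.exp (σ * t) * t ^ (c - 1)) (ht : t ∈ Ioo 0 T) :
    |vconv f g t| ≤
      D * (A * betaR c (b / 2) * T ^ (b / 2) * σ ^ (-(b / 2))) * Real.exp (σ * t) * t ^ (c - 1) := by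
  have h1 : ∀ t ∈ Ioo 0 T, |Real.exp (-(σ * t)) * f t| ≤
      (A * σ ^ (-(b / 2))) * t ^ (b / 2 - 1) := by
    intro t ht
    rw [abs_mul, abs_of_pos (Real.exp_pos _)]
    -- Half of the exponent `b` is given up to gain smallness: `e^{-σt} ≤ (σt)^(-b/2)` leaves the
    -- integrable power `t^(b/2-1)` with the factor `σ^(-b/2)`.
    have e1 := exp_neg_le_rpow_neg (v := σ * t) (mul_pos hσ ht.1) (by linarith : 0 ≤ b / 2)
      (by linarith)
    rw [Real.mul_rpow hσ.le ht.1.le] at e1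
    have e2 : t ^ (b / 2 - 1) = t ^ (-(b / 2)) * t ^ (b - 1) := by
      rw [← Real.rpow_add ht.1]; congr 1; ring
    have := Real.rpow_nonneg ht.1.le (b - 1)
    have := Real.rpow_nonneg ht.1.le (-(b / 2))
    have := Real.rpow_nonneg hσ.le (-(b / 2))
    calc _ ≤ (σ ^ (-(b / 2)) * t ^ (-(b / 2))) * (A * t ^ (b - 1)) := by
          gcongr
          exact hf t ht
      _ = _ := by rw [e2]; ring
  have h2 : ∀ t ∈ Ioo 0 T, |Real.exp (-(σ * t)) * g t| ≤ D * t ^ (c - 1) := by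
    intro t ht
    rw [abs_mul, abs_of_pos (Real.exp_pos _)]
    calc _ ≤ Real.exp (-(σ * t)) * (D * Real.exp (σ * t) * t ^ (c - 1)) := by
          gcongr
          exact hg t ht
      _ = (Real.exp (-(σ * t)) * Real.exp (σ * t)) * (D * t ^ (c - 1)) := by ring
      _ = _ := by rw [← Real.exp_add]; simp
  have h3 := abs_vconv_le (by positivity : 0 < b / 2) hc
    (mul_nonneg hA (Real.rpow_nonneg hσ.le _)) h1 h2 ht
  have e : vconv f g t = Real.exp (σ * t) *
      vconv (fun t => Real.exp (-(σ * t)) * f t) (fun t => Real.exp (-(σ * t)) * g t) t := by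
    simp only [vconv, smul_eq_mul]
    rw [← intervalIntegral.integral_const_mul]
    refine intervalIntegral.integral_congr fun τ _ => ?_
    have : Real.exp (σ * t) * (Real.exp (-(σ * (t - τ))) * Real.exp (-(σ * τ))) = 1 := by
      rw [← Real.exp_add, ← Real.exp_add, Real.exp_eq_one_iff]; ring
    linear_combination (-(f (t - τ) * g τ)) * this
  rw [e, abs_mul, abs_of_pos (Real.exp_pos _)]
  have e3 : t ^ (c + b / 2 - 1) ≤ T ^ (b / 2) * t ^ (c - 1) := by
    rw [show c + b / 2 - 1 = b / 2 + (c - 1) by ring, Real.rpow_add ht.1]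
    exact mul_le_mul_of_nonneg_right (Real.rpow_le_rpow ht.1.le ht.2.le (by positivity))
      (Real.rpow_nonneg ht.1.le _)
  have := betaR_nonneg c (b / 2)
  have := Real.rpow_nonneg hσ.le (-(b / 2))
  calc _ ≤ Real.exp (σ * t) * (A * σ ^ (-(b / 2)) * D * betaR c (b / 2) *
        (T ^ (b / 2) * t ^ (c - 1))) := by
        gcongr
        exact h3.trans (by gcongr)
    _ = _ := by ring

end PowerBounds

/-! ### Weakly singular Volterra equations of the second kind -/

section Neumann

/-- The Volterra equation `ρ + K * ρ = s` with weakly singular data is solved by its Neumann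
series, with a bound that depends only on the bounds of the data. -/
theorem exists_volterra_solution {T b c A D : ℝ} (hT : 0 < T) (hb : 0 < b) (hb2 : b ≤ 2)
    (hc : 0 < c) (hA : 0 ≤ A) (hD : 0 < D) :
    ∃ C : ℝ, 0 < C ∧ ∀ K s : ℝ → ℝ, AEStronglyMeasurable K (volume.restrict (Ioo 0 T)) →
      AEStronglyMeasurable s (volume.restrict (Ioo 0 T)) →
      (∀ t ∈ Ioo 0 T, |K t| ≤ A * t ^ (b - 1)) → (∀ t ∈ Ioo 0 T, |s t| ≤ D * t ^ (c - 1)) →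
      ∃ ρ : ℝ → ℝ, IntegrableOn ρ (Ioo 0 T) ∧ (∀ t ∈ Ioo 0 T, |ρ t| ≤ C * t ^ (c - 1)) ∧
        ∀ t ∈ Ioo 0 T, ρ t = s t - vconv K ρ t := by
  -- A large weight `σ` makes convolution with `K` a contraction by `1/2`. It depends only on the
  -- bounds of the data, which is what makes the final constant uniform.
  obtain ⟨σ, hσ, hδ⟩ : ∃ σ : ℝ, 0 < σ ∧
      A * betaR c (b / 2) * T ^ (b / 2) * σ ^ (-(b / 2)) ≤ 1 / 2 := by
    have h := ((tendsto_rpow_neg_atTop (y := b / 2) (by positivity)).const_mul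
      (A * betaR c (b / 2) * T ^ (b / 2)))
    rw [mul_zero] at h
    obtain ⟨σ, h1, h2⟩ := ((h.eventually (gt_mem_nhds (by norm_num : (0 : ℝ) < 1 / 2))).and
      (eventually_gt_atTop 0)).exists
    exact ⟨σ, h2, h1.le⟩
  refine ⟨2 * D * Real.exp (σ * T), by positivity, fun K s hKm hsm hK hs => ?_⟩
  let a : ℕ → ℝ → ℝ := fun n => Nat.rec s (fun _ g => vconv K g) n
  have ha0 : a 0 = s := rfl
  have has : ∀ n, a (n + 1) = vconv K (a n) := fun n => rfl
  have hKi := integrableOn_of_abs_le_rpow hT hb hKm hK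
  have hai : ∀ n, IntegrableOn (a n) (Ioo 0 T) := by
    intro n
    induction n with
    | zero => exact integrableOn_of_abs_le_rpow hT hc hsm hs
    | succ n ih => rw [has]; exact integrableOn_vconv hKi ih
  have hab : ∀ n, ∀ t ∈ Ioo 0 T,
      |a n t| ≤ D * (1 / 2) ^ n * Real.exp (σ * t) * t ^ (c - 1) := by
    intro n
    induction n with
    | zero =>
      intro t ht
      rw [ha0, pow_zero, mul_one]
      refine (hs t ht).trans (mul_le_mul_of_nonneg_right ?_ (Real.rpow_nonneg ht.1.le _))
      exact le_mul_of_one_le_right hD.le (Real.one_le_exp (mul_pos hσ ht.1).le)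
    | succ n ih =>
      intro t ht
      rw [has]
      refine (abs_vconv_le_weighted hb hb2 hc hσ hA (by positivity) hK ih ht).trans ?_
      have := Real.rpow_nonneg ht.1.le (c - 1)
      refine mul_le_mul_of_nonneg_right (mul_le_mul_of_nonneg_right ?_ (Real.exp_pos _).le) this
      rw [pow_succ, ← mul_assoc D]
      exact mul_le_mul_of_nonneg_left hδ (by positivity)
  have hab' : ∀ n, ∀ t ∈ Ioo 0 T,
      ‖(-1) ^ n * a n t‖ ≤ (1 / 2) ^ n * (D * Real.exp (σ * T) * t ^ (c - 1)) := by
    intro n t ht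
    rw [norm_mul, norm_pow, norm_neg, norm_one, one_pow, one_mul]
    have := Real.rpow_nonneg ht.1.le (c - 1)
    calc _ ≤ D * (1 / 2) ^ n * Real.exp (σ * T) * t ^ (c - 1) := by
          refine (hab n t ht).trans ?_
          have := ht.2.le
          gcongr
      _ = _ := by ring
  have hgeo : ∀ B : ℝ, HasSum (fun n : ℕ => (1 / 2 : ℝ) ^ n * B) (2 * B) := fun B =>
    hasSum_geometric_two.mul_right B
  let ρ : ℝ → ℝ := fun t => ∑' n, (-1) ^ n * a n t
  have hρs : ∀ t ∈ Ioo 0 T, HasSum (fun n => (-1) ^ n * a n t) (ρ t) := fun t ht =>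
    (Summable.of_norm_bounded (hgeo _).summable fun n => hab' n t ht).hasSum
  have hρb : ∀ t ∈ Ioo 0 T, |ρ t| ≤ 2 * D * Real.exp (σ * T) * t ^ (c - 1) := fun t ht => by
    have := tsum_of_norm_bounded (hgeo (D * Real.exp (σ * T) * t ^ (c - 1)))
      fun n => hab' n t ht
    refine this.trans (le_of_eq (by ring))
  have hρm : AEStronglyMeasurable ρ (volume.restrict (Ioo 0 T)) := by
    refine aestronglyMeasurable_of_tendsto_ae atTop
      (f := fun (N : ℕ) t => ∑ n ∈ Finset.range N, (-1) ^ n * a n t) (fun N => ?_) ?_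
    · exact Finset.aestronglyMeasurable_fun_sum _ fun n _ =>
        ((hai n).aestronglyMeasurable).const_mul _
    · exact (ae_restrict_mem measurableSet_Ioo).mono fun t ht => (hρs t ht).tendsto_sum_nat
  refine ⟨ρ, integrableOn_of_abs_le_rpow hT hc hρm hρb, hρb, fun t ht => ?_⟩
  have h1 := hρs t ht
  -- Splitting off the term `s` leaves `-K *` applied termwise to the series itself.
  rw [← hasSum_nat_add_iff' 1] at h1
  simp only [Finset.range_one, Finset.sum_singleton, pow_zero, one_mul, ha0] at h1
  have hsub : Ioo 0 t ⊆ Ioo 0 T := Ioo_subset_Ioo_right ht.2.le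
  have hmeas : AEStronglyMeasurable (fun τ => K (t - τ)) (volume.restrict (Ioc 0 t)) := by
    have h0 : AEStronglyMeasurable K (volume.restrict (Ioo 0 t)) :=
      hKm.mono_measure (Measure.restrict_mono_set _ hsub)
    have hmp : MeasurePreserving (fun τ : ℝ => t - τ) (volume.restrict (Ioo 0 t))
        (volume.restrict (Ioo 0 t)) := by
      have := (Measure.measurePreserving_sub_left volume t).restrict_preimage
        (measurableSet_Ioo (a := (0 : ℝ)) (b := t))
      simpa using this
    rw [← restrict_Ioo_eq_restrict_Ioc]
    exact h0.comp_measurePreserving hmp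
  -- The convolution may be applied termwise by dominated convergence: the terms are bounded by a
  -- geometric series times a Beta integrand.
  have h2 : HasSum (fun n => vconv K (fun τ => (-1) ^ n * a n τ) t) (vconv K ρ t) := by
    refine intervalIntegral.hasSum_integral_of_dominated_convergence
      (fun n τ => (1 / 2) ^ n * (A * D * Real.exp (σ * T) *
        (τ ^ (c - 1) * (t - τ) ^ (b - 1)))) (fun n => ?_) (fun n => ?_) ?_ ?_ ?_
    · rw [uIoc_of_le ht.1.le]
      refine hmeas.smul ?_
      rw [← restrict_Ioo_eq_restrict_Ioc]
      exact (((hai n).mono_set hsub).aestronglyMeasurable).const_mul _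
    · rw [uIoc_of_le ht.1.le]
      filter_upwards [(countable_singleton t).ae_notMem volume] with τ hτt hτ
      have hτ2 : τ < t := lt_of_le_of_ne hτ.2 hτt
      have e1 := hK (t - τ) ⟨by linarith, by linarith [ht.2, hτ.1]⟩
      have e2 := hab' n τ ⟨hτ.1, hτ2.trans ht.2⟩
      rw [norm_smul, Real.norm_eq_abs]
      calc _ ≤ (A * (t - τ) ^ (b - 1)) *
            ((1 / 2) ^ n * (D * Real.exp (σ * T) * τ ^ (c - 1))) := by
            refine mul_le_mul e1 e2 (norm_nonneg _) ?_
            have : 0 ≤ (t - τ) ^ (b - 1) := Real.rpow_nonneg (by linarith) _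
            positivity
        _ = _ := by ring
    · exact Eventually.of_forall fun τ _ => (hgeo _).summable
    · simp only [(hgeo _).tsum_eq]
      exact ((intervalIntegrable_rpow_mul_rpow_sub hc hb ht.1).const_mul _).const_mul 2
    · rw [uIoc_of_le ht.1.le]
      filter_upwards [(countable_singleton t).ae_notMem volume] with τ hτt hτ
      exact (hρs τ ⟨hτ.1, (lt_of_le_of_ne hτ.2 hτt).trans ht.2⟩).const_smul (K (t - τ))
  have h3 : (fun n => (-1) ^ (n + 1) * a (n + 1) t) =
      fun n => -vconv K (fun τ => (-1) ^ n * a n τ) t := by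
    funext n
    rw [has, pow_succ]
    simp only [mul_comm _ (a n _), vconv_mul_const_right]
    ring
  rw [h3] at h1
  have := h1.unique h2.neg
  linarith

end Neumann

/-! ### The resolvent kernel of variable exponent -/

section Resolvent

variable {T L : ℝ} {α : ℝ → ℝ}

lemma vconv_one_left {E : Type*} [NormedAddCommGroup E] [NormedSpace ℝ E] (y : ℝ → E) (t : ℝ) :
    vconv (fun _ => 1) y t = ∫ τ in (0 : ℝ)..t, y τ := by
  simp [vconv]

lemma vconv_one_one (t : ℝ) : vconv (fun _ => 1) (fun _ => (1 : ℝ)) t = t := by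
  simp [vconv]

lemma integrableOn_constant_order_kernel (hT : 0 < T) {a : ℝ} (ha : a < 2) :
    IntegrableOn (fun r : ℝ => r ^ (1 - a) / Real.Gamma (2 - a)) (Ioo 0 T) := by
  have := (integrableOn_rpow_Ioo hT (a := 2 - a) (by linarith)).div_const (Real.Gamma (2 - a))
  rwa [show 2 - a - 1 = 1 - a by ring] at this

lemma integrableOn_kernel (hT : 0 < T) (hα : IsAdmissibleExponent T L α) :
    IntegrableOn (kernel α) (Ioo 0 T) := by
  obtain ⟨h1, h2⟩ := hα.range 0 ⟨le_rfl, hT.le⟩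
  obtain ⟨q, Cq, hCq, hqm, hqb, hk⟩ := exists_kernel_decomposition hT hα
  have hq := integrableOn_of_abs_le_rpow hT (by linarith : 0 < (2 - α 0) / 2)
    hqm.aestronglyMeasurable hqb
  have h1 : IntegrableOn (fun _ : ℝ => (1 : ℝ)) (Ioo 0 T) := by simp
  refine (integrableOn_congr_fun (fun t ht => ?_) measurableSet_Ioo).2
    ((integrableOn_constant_order_kernel hT h2).add (integrableOn_vconv h1 hq))
  rw [hk t ht, Pi.add_apply, vconv_one_left]

/-- The resolvent kernels of the scalar problems of variable exponent, bounded uniformly in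
`μ`. -/
theorem exists_resolvent_kernel (hT : 0 < T) (hα : IsAdmissibleExponent T L α) :
    ∃ C : ℝ, 0 < C ∧ ∀ μ : ℝ, 0 < μ → ∃ ρ : ℝ → ℝ, IntegrableOn ρ (Ioo 0 T) ∧
      (∀ t ∈ Ioo 0 T, |ρ t| ≤ C * t ^ (α 0 - 2)) ∧
      ∀ᵐ t ∂(volume.restrict (Ioo 0 T)),
        vconv (kernel α) ρ t + μ * vconv (fun r => r) ρ t = 1 := by
  obtain ⟨h1, h2⟩ := hα.range 0 ⟨le_rfl, hT.le⟩
  obtain ⟨q, Cq, hCq, hqm, hqb, hk⟩ := exists_kernel_decomposition hT hα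
  obtain ⟨Cs, hCs, hs⟩ := exists_constant_order_kernel h1 h2
  have hε : 0 < (2 - α 0) / 2 := by linarith
  obtain ⟨C, hC, hV⟩ := exists_volterra_solution (T := T) (b := (2 - α 0) / 2 + (α 0 - 1))
    (c := α 0 - 1) (A := Cs * Cq * betaR ((2 - α 0) / 2) (α 0 - 1)) (D := Cs) hT (by linarith)
    (by linarith) (by linarith) (by have := betaR_nonneg ((2 - α 0) / 2) (α 0 - 1); positivity) hCs
  refine ⟨C, hC, fun μ hμ => ?_⟩
  obtain ⟨s, hsm, hsb, hs1⟩ := hs μ hμ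
  have hsb' : ∀ t ∈ Ioo 0 T, |s t| ≤ Cs * t ^ (α 0 - 1 - 1) := fun t ht => by
    rw [show α 0 - 1 - 1 = α 0 - 2 by ring]; exact hsb t ht.1
  have hsi := integrableOn_of_abs_le_rpow hT (by linarith) hsm.aestronglyMeasurable hsb'
  have hqi := integrableOn_of_abs_le_rpow hT hε hqm.aestronglyMeasurable hqb
  have hKi : IntegrableOn (vconv s q) (Ioo 0 T) := integrableOn_vconv hsi hqi
  -- The solution of `ρ + (s * q) * ρ = s`. The kernel `s * q` is bounded by a power whose constant
  -- does not involve `μ`, since that of `s` does not.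
  obtain ⟨ρ, hρi, hρb, hρ⟩ := hV (vconv s q) s hKi.aestronglyMeasurable hsm.aestronglyMeasurable
    (fun t ht => abs_vconv_le (by linarith) hε hCs.le hsb' hqb ht) hsb'
  refine ⟨ρ, hρi, fun t ht => ?_, ?_⟩
  · rw [show α 0 - 2 = α 0 - 1 - 1 by ring]; exact hρb t ht
  set k0 : ℝ → ℝ := fun r => r ^ (1 - α 0) / Real.Gamma (2 - α 0)
  have hk0 : IntegrableOn k0 (Ioo 0 T) := integrableOn_constant_order_kernel hT h2
  have hone : IntegrableOn (fun _ : ℝ => (1 : ℝ)) (Ioo 0 T) := by simp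
  have hid : IntegrableOn (fun r : ℝ => μ * r) (Ioo 0 T) :=
    ((continuous_const.mul continuous_id).continuousOn.integrableOn_Icc
      (a := (0 : ℝ)) (b := T)).mono_set Ioo_subset_Icc_self
  set N : ℝ → ℝ := fun r => k0 r + μ * r
  have hN : IntegrableOn N (Ioo 0 T) := hk0.add hid
  set m : ℝ → ℝ := vconv (fun _ => 1) q
  have hm : IntegrableOn m (Ioo 0 T) := integrableOn_vconv hone hqi
  have hmem := ae_restrict_mem (μ := volume) (measurableSet_Ioo (a := (0 : ℝ)) (b := T))
  have hNs : ∀ᵐ t ∂(volume.restrict (Ioo 0 T)), vconv N s t = 1 := by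
    filter_upwards [hmem, ae_intervalIntegrable_vconv hk0 hsi, ae_intervalIntegrable_vconv hid hsi]
      with t ht i1 i2
    rw [vconv_add_left i1 i2, vconv_const_mul_left, smul_eq_mul]
    exact hs1 t ht.1
  -- As `N * s = 1`, associativity gives `N * (s * q) = 1 * q = m`, the difference between the two
  -- kernels.
  have hNK : ∀ᵐ t ∂(volume.restrict (Ioo 0 T)), vconv N (vconv s q) t = m t := by
    filter_upwards [hmem, ae_vconv_assoc hN hsi hqi] with t ht i1
    rw [← i1, vconv_congr_left ht q hNs]
  filter_upwards [hmem, hNs, ae_vconv_assoc hN hKi hρi, ae_intervalIntegrable_vconv hN hsi,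
    ae_intervalIntegrable_vconv hN (integrableOn_vconv hKi hρi),
    ae_intervalIntegrable_vconv hk0 hρi, ae_intervalIntegrable_vconv hid hρi,
    ae_intervalIntegrable_vconv hm hρi] with t ht e1 e2 i1 i2 i3 i4 i5
  have a1 : vconv (kernel α) ρ t = vconv k0 ρ t + vconv m ρ t := by
    rw [← vconv_add_left i3 i5]
    refine vconv_congr_left ht ρ (hmem.mono fun r hr => ?_)
    rw [hk r hr]
    simp only [m, vconv_one_left, k0]
  have a2 : vconv N ρ t = vconv k0 ρ t + μ * vconv (fun r => r) ρ t := by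
    rw [vconv_add_left i3 i4, vconv_const_mul_left, smul_eq_mul]
  -- Applying `N *` to the equation for `ρ` gives `N * ρ = 1 - m * ρ`. Moving `m * ρ` to the left
  -- turns `k₀` into `kernel α`.
  have a3 : vconv N ρ t = 1 - vconv m ρ t := by
    rw [vconv_congr_right (z := fun r => s r - vconv (vconv s q) ρ r) ht N
      (hmem.mono fun r hr => hρ r hr), vconv_sub_right i1 i2, e1, ← e2,
      vconv_congr_left ht ρ hNK]
  linarith

end Resolvent

/-! ### The Hilbert space `H¹₀(Ω)` and the weak formulation of the Laplacian -/

section SobolevSpace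

variable {d : ℕ} {Ω : Opens (EuclideanSpace ℝ (Fin d))}

theorem testFunction_memLp (ψ : 𝓓(Ω, ℝ)) :
    MemLp ψ 2 ((volume : Measure (EuclideanSpace ℝ (Fin d))).restrict
      (Ω : Set (EuclideanSpace ℝ (Fin d)))) :=
  ψ.continuous.memLp_of_hasCompactSupport ψ.hasCompactSupport

/-- The class in `L²(Ω)` of a test function. -/
noncomputable def toL2 : 𝓓(Ω, ℝ) →ₗ[ℝ] L2 Ω where
  toFun ψ := (testFunction_memLp ψ).toLp ψ
  map_add' _ _ := rfl
  map_smul' _ _ := rfl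

theorem coeFn_toL2 (ψ : 𝓓(Ω, ℝ)) :
    toL2 ψ =ᵐ[volume.restrict (Ω : Set (EuclideanSpace ℝ (Fin d)))] ψ :=
  (testFunction_memLp ψ).coeFn_toLp

/-- The partial derivative of a test function. -/
noncomputable def pd (j : Fin d) : 𝓓(Ω, ℝ) →ₗ[ℝ] 𝓓(Ω, ℝ) :=
  (TestFunction.lineDerivCLM ℝ (EuclideanSpace.single j (1 : ℝ))).toLinearMap

theorem pd_apply (j : Fin d) (ψ : 𝓓(Ω, ℝ)) (x : EuclideanSpace ℝ (Fin d)) :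
    pd j ψ x = fderiv ℝ ψ x (EuclideanSpace.single j 1) := by
  have h : pd j ψ x = lineDeriv ℝ ψ x (EuclideanSpace.single j (1 : ℝ)) :=
    TestFunction.lineDerivCLM_apply_of_le (by simp)
  rw [h, (ψ.contDiff.differentiable (by simp)).differentiableAt.lineDeriv_eq_fderiv]

theorem inner_toL2_right (v : L2 Ω) (ψ : 𝓓(Ω, ℝ)) :
    inner ℝ v (toL2 ψ) = ∫ x in (Ω : Set (EuclideanSpace ℝ (Fin d))), v x * ψ x := by
  rw [L2.inner_def]
  refine integral_congr_ae ?_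
  filter_upwards [coeFn_toL2 ψ] with x hx
  rw [hx]
  simp [mul_comm]

theorem inner_toL2_toL2 (χ ψ : 𝓓(Ω, ℝ)) :
    inner ℝ (toL2 χ) (toL2 ψ) = ∫ x, χ x * ψ x := by
  rw [inner_toL2_right]
  have h : ∫ x in (Ω : Set (EuclideanSpace ℝ (Fin d))), (toL2 χ : L2 Ω) x * ψ x =
      ∫ x in (Ω : Set (EuclideanSpace ℝ (Fin d))), χ x * ψ x := by
    refine integral_congr_ae ?_
    filter_upwards [coeFn_toL2 χ] with x hx
    rw [hx]
  rw [h]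
  refine setIntegral_eq_integral_of_forall_compl_eq_zero fun x hx => ?_
  have : ψ x = 0 := image_eq_zero_of_notMem_tsupport fun hx' => hx (ψ.tsupport_subset hx')
  rw [this, mul_zero]

theorem inner_toL2_pd (χ ψ : 𝓓(Ω, ℝ)) (j : Fin d) :
    inner ℝ (toL2 χ) (toL2 (pd j ψ)) = - inner ℝ (toL2 (pd j χ)) (toL2 ψ) := by
  have hint : ∀ f g : 𝓓(Ω, ℝ), Integrable (fun x => f x * g x) := fun f g =>
    (f.continuous.mul g.continuous).integrable_of_hasCompactSupport
      (f.hasCompactSupport.mul_right)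
  rw [inner_toL2_toL2, inner_toL2_toL2]
  simp_rw [pd_apply]
  refine integral_mul_fderiv_eq_neg_fderiv_mul_of_integrable ?_ ?_ (hint χ ψ) ?_ ?_
  · simpa only [pd_apply] using hint (pd j χ) ψ
  · simpa only [pd_apply] using hint χ (pd j ψ)
  · exact fun x _ => (χ.contDiff.differentiable (by simp)).differentiableAt
  · exact fun x _ => (ψ.contDiff.differentiable (by simp)).differentiableAt

theorem laplacian_testFunction (ψ : 𝓓(Ω, ℝ)) (x : EuclideanSpace ℝ (Fin d)) :
    Laplacian.laplacian (ψ : _ → ℝ) x = ∑ j, pd j (pd j ψ) x := by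
  rw [InnerProductSpace.laplacian_eq_iteratedFDeriv_orthonormalBasis _
    (EuclideanSpace.basisFun (Fin d) ℝ)]
  refine Finset.sum_congr rfl fun j _ => ?_
  have h : ((pd j ψ : 𝓓(Ω, ℝ)) : EuclideanSpace ℝ (Fin d) → ℝ) =
      fun y => fderiv ℝ ψ y (EuclideanSpace.single j 1) := funext fun y => pd_apply j ψ y
  have hd : DifferentiableAt ℝ (fderiv ℝ (ψ : EuclideanSpace ℝ (Fin d) → ℝ)) x :=
    ((ψ.contDiff.fderiv_right (m := ((⊤ : ℕ∞) : WithTop ℕ∞)) (by simp)).differentiable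
      (by simp)).differentiableAt
  rw [pd_apply, h, fderiv_clm_apply hd (by fun_prop)]
  simp [iteratedFDeriv_two_apply]

theorem integral_mul_laplacian (v : L2 Ω) (ψ : 𝓓(Ω, ℝ)) :
    ∫ x in (Ω : Set (EuclideanSpace ℝ (Fin d))), v x * Laplacian.laplacian (ψ : _ → ℝ) x =
      ∑ j, inner ℝ v (toL2 (pd j (pd j ψ))) := by
  rw [← inner_sum, ← map_sum, inner_toL2_right]
  simp_rw [laplacian_testFunction]
  simp

variable (Ω) in
/-- The ambient space of pairs of a function and its gradient. -/
abbrev GradL2 : Type := PiLp 2 (fun _ : Option (Fin d) => L2 Ω)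

/-- A test function with its gradient. -/
noncomputable def gradMap : 𝓓(Ω, ℝ) →ₗ[ℝ] GradL2 Ω where
  toFun ψ := WithLp.toLp 2 (fun o => o.elim (toL2 ψ) (fun j => toL2 (pd j ψ)))
  map_add' ψ χ := by
    ext1 o
    cases o <;> simp
  map_smul' c ψ := by
    ext1 o
    cases o <;> simp

@[simp] theorem gradMap_none (ψ : 𝓓(Ω, ℝ)) : gradMap ψ none = toL2 ψ := rfl

@[simp] theorem gradMap_some (ψ : 𝓓(Ω, ℝ)) (j : Fin d) :
    gradMap ψ (some j) = toL2 (pd j ψ) := rfl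

variable (Ω) in
/-- `H¹₀(Ω)`, as a space of functions with their gradients. -/
noncomputable def H10 : Submodule ℝ (GradL2 Ω) := (LinearMap.range gradMap).topologicalClosure

instance : CompleteSpace (H10 Ω) :=
  (Submodule.isClosed_topologicalClosure _).completeSpace_coe

variable (Ω) in
/-- The inclusion of `H¹₀(Ω)` in `L²(Ω)`. -/
noncomputable def H10.toL2 : H10 Ω →L[ℝ] L2 Ω :=
  (PiLp.proj 2 (fun _ : Option (Fin d) => L2 Ω) none : GradL2 Ω →L[ℝ] L2 Ω) ∘L (H10 Ω).subtypeL

@[simp] theorem H10.toL2_apply (w : H10 Ω) : H10.toL2 Ω w = (w : GradL2 Ω) none := rfl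

theorem H10.inner_def (w v : H10 Ω) :
    inner ℝ w v = inner ℝ ((w : GradL2 Ω) none) ((v : GradL2 Ω) none) +
      ∑ j, inner ℝ ((w : GradL2 Ω) (some j)) ((v : GradL2 Ω) (some j)) := by
  rw [Submodule.coe_inner, PiLp.inner_apply, Fintype.sum_option]

theorem gradMap_mem (ψ : 𝓓(Ω, ℝ)) : gradMap ψ ∈ H10 Ω :=
  Submodule.le_topologicalClosure _ ⟨ψ, rfl⟩

/-- A closed condition holding for all test functions holds on `H¹₀(Ω)`. -/
theorem H10.induction {P : GradL2 Ω → Prop} (hP : IsClosed {w | P w})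
    (h : ∀ ψ, P (gradMap ψ)) {w : GradL2 Ω} (hw : w ∈ H10 Ω) : P w := by
  have : (H10 Ω : Set (GradL2 Ω)) ⊆ {w | P w} := by
    rw [H10, Submodule.topologicalClosure_coe]
    refine closure_minimal ?_ hP
    rintro _ ⟨ψ, rfl⟩
    exact h ψ
  exact this hw

theorem continuous_coord (o : Option (Fin d)) : Continuous fun w : GradL2 Ω => w o :=
  (PiLp.proj 2 (fun _ : Option (Fin d) => L2 Ω) o : GradL2 Ω →L[ℝ] L2 Ω).continuous

/-- Integration by parts against test functions passes to limits in the graph norm, so the last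
coordinates of an element of `H10` are the weak derivatives of the first. -/
theorem H10.inner_some (w : GradL2 Ω) (hw : w ∈ H10 Ω) (ψ : 𝓓(Ω, ℝ)) (j : Fin d) :
    inner ℝ (w (some j)) (DiffusionWave.toL2 ψ) =
      - inner ℝ (w none) (DiffusionWave.toL2 (pd j ψ)) := by
  have := continuous_coord (Ω := Ω) none
  have := continuous_coord (Ω := Ω) (some j)
  refine H10.induction (P := fun w => inner ℝ (w (some j)) (DiffusionWave.toL2 ψ) =
      - inner ℝ (w none) (DiffusionWave.toL2 (pd j ψ)))
    (isClosed_eq (by fun_prop) (by fun_prop)) (fun χ => ?_) hw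
  rw [gradMap_none, gradMap_some, inner_toL2_pd, neg_neg]

/-- There are finitely many coordinates, so convergence of the function and of each partial
derivative is convergence of `gradMap` in the product. -/
theorem memH10_iff {v : L2 Ω} : MemH10 Ω v ↔ ∃ w : H10 Ω, H10.toL2 Ω w = v := by
  have key : ∀ (χ : ℕ → 𝓓(Ω, ℝ)) (g : L2 Ω),
      Tendsto (fun n => toL2 (χ n)) atTop (𝓝 g) ↔
        Tendsto (fun n => eLpNorm (fun x => χ n x - g x) 2
          (volume.restrict (Ω : Set (EuclideanSpace ℝ (Fin d))))) atTop (𝓝 0) := by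
    intro χ g
    have := Lp.tendsto_Lp_iff_tendsto_eLpNorm'' (fi := atTop) (fun n => (χ n : _ → ℝ))
      (fun n => testFunction_memLp (χ n)) g (Lp.memLp g)
    rw [Lp.toLp_coeFn] at this
    exact this
  constructor
  · rintro ⟨ψ, G, h0, hG⟩
    let w : GradL2 Ω := WithLp.toLp 2 (fun o => o.elim v G)
    have hlim : Tendsto (fun n => gradMap (ψ n)) atTop (𝓝 w) := by
      have hc : Tendsto (fun n => (fun o => gradMap (ψ n) o)) atTop (𝓝 (fun o => w o)) := by
        refine tendsto_pi_nhds.2 fun o => ?_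
        cases o with
        | none => exact (key ψ v).2 h0
        | some j =>
          refine (key (fun n => pd j (ψ n)) (G j)).2 ?_
          simp_rw [pd_apply]
          exact hG j
      exact ((PiLp.continuous_toLp 2 (fun _ : Option (Fin d) => L2 Ω)).tendsto _).comp hc
    have hw : w ∈ H10 Ω := by
      rw [H10, ← SetLike.mem_coe, Submodule.topologicalClosure_coe]
      exact mem_closure_of_tendsto hlim (Eventually.of_forall fun n => ⟨ψ n, rfl⟩)
    exact ⟨⟨w, hw⟩, rfl⟩
  · rintro ⟨⟨w, hw⟩, rfl⟩
    have hw' := hw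
    rw [H10, ← SetLike.mem_coe, Submodule.topologicalClosure_coe, mem_closure_iff_seq_limit] at hw'
    obtain ⟨s, hs, hlim⟩ := hw'
    choose ψ hψ using hs
    refine ⟨ψ, fun j => w (some j), ?_, fun j => ?_⟩
    · refine (key ψ _).1 ?_
      have := ((continuous_coord (Ω := Ω) none).tendsto w).comp hlim
      refine this.congr fun n => ?_
      rw [Function.comp_apply, ← hψ n, gradMap_none]
    · have h1 := (key (fun n => pd j (ψ n)) (w (some j))).1 <| by
        have := ((continuous_coord (Ω := Ω) (some j)).tendsto w).comp hlim
        refine this.congr fun n => ?_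
        rw [Function.comp_apply, ← hψ n, gradMap_some]
      simpa only [pd_apply] using h1

/-- The weak formulation: the distributional Laplacian of `w ∈ H¹₀(Ω)` is `h` if and only if the
associated Dirichlet form is `-(h, ·)`. -/
theorem hasWeakLaplacian_iff (w : H10 Ω) (h : L2 Ω) :
    HasWeakLaplacian Ω (H10.toL2 Ω w) h ↔
      ∀ v : H10 Ω, inner ℝ w v = inner ℝ (H10.toL2 Ω w - h) (H10.toL2 Ω v) := by
  have hlap : ∀ ψ : 𝓓(Ω, ℝ), ∑ j, inner ℝ ((w : GradL2 Ω) none) (toL2 (pd j (pd j ψ))) =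
      - ∑ j, inner ℝ ((w : GradL2 Ω) (some j)) (toL2 (pd j ψ)) := fun ψ => by
    rw [← Finset.sum_neg_distrib]
    refine Finset.sum_congr rfl fun j _ => ?_
    rw [H10.inner_some _ w.2, neg_neg]
  constructor
  · rintro hw ⟨v, hv⟩
    have h0 := continuous_coord (Ω := Ω) none
    have h1 := fun j => continuous_coord (Ω := Ω) (some j)
    rw [H10.inner_def, inner_sub_left, sub_eq_add_neg]
    simp only [H10.toL2_apply, add_right_inj]
    refine H10.induction (P := fun v => ∑ j, inner ℝ ((w : GradL2 Ω) (some j)) (v (some j)) =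
      - inner ℝ h (v none)) (isClosed_eq (by fun_prop) (by fun_prop)) (fun ψ => ?_) hv
    have := hw ψ
    rw [integral_mul_laplacian, ← inner_toL2_right, H10.toL2_apply, hlap] at this
    simp only [gradMap_none, gradMap_some]
    linarith
  · intro hw ψ
    rw [integral_mul_laplacian, ← inner_toL2_right, H10.toL2_apply, hlap]
    have := hw ⟨gradMap ψ, gradMap_mem ψ⟩
    rw [H10.inner_def, inner_sub_left] at this
    simp only [H10.toL2_apply, gradMap_none, gradMap_some] at this
    linarith

end SobolevSpace

/-! ### Translation estimates and a quantitative form of Rellich's theorem -/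

section Rellich

/-- The quadratic polynomial `∫ (f - t)²` in `t` is nonnegative, so its discriminant is not
positive. -/
theorem sq_integral_le {X : Type*} [MeasurableSpace X] {μ : Measure X} [IsFiniteMeasure μ]
    {f : X → ℝ} (hf : Integrable f μ) (hf2 : Integrable (fun x => f x ^ 2) μ) :
    (∫ x, f x ∂μ) ^ 2 ≤ μ.real univ * ∫ x, f x ^ 2 ∂μ := by
  have h : ∀ t : ℝ, 0 ≤ μ.real univ * (t * t) + (-2 * ∫ x, f x ∂μ) * t + ∫ x, f x ^ 2 ∂μ := by
    intro t
    have h1 : 0 ≤ ∫ x, (f x - t) ^ 2 ∂μ := integral_nonneg fun x => sq_nonneg _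
    have h2 : ∫ x, (f x - t) ^ 2 ∂μ =
        ∫ x, (f x ^ 2 - (2 * t) * f x + t ^ 2) ∂μ := by
      congr 1
      ext x
      ring
    have h3 : ∫ x, (f x ^ 2 - (2 * t) * f x + t ^ 2) ∂μ =
        ∫ x, (f x ^ 2 - (2 * t) * f x) ∂μ + ∫ _, t ^ 2 ∂μ :=
      integral_add (hf2.sub (hf.const_mul _)) (integrable_const _)
    rw [h2, h3, integral_sub hf2 (hf.const_mul _), integral_const_mul, integral_const,
      smul_eq_mul] at h1
    linarith
  have := discrim_le_zero h
  rw [discrim] at this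
  linarith

variable {d : ℕ} {Ω : Opens (EuclideanSpace ℝ (Fin d))}

/-- The squared length of the gradient of a test function. -/
noncomputable def gradSq (ψ : 𝓓(Ω, ℝ)) (x : EuclideanSpace ℝ (Fin d)) : ℝ := ∑ j, pd j ψ x ^ 2

theorem continuous_gradSq (ψ : 𝓓(Ω, ℝ)) : Continuous (gradSq ψ) :=
  continuous_finsetSum _ fun j _ => (pd j ψ).continuous.pow 2

theorem gradSq_nonneg (ψ : 𝓓(Ω, ℝ)) (x : EuclideanSpace ℝ (Fin d)) : 0 ≤ gradSq ψ x :=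
  Finset.sum_nonneg fun _ _ => sq_nonneg _

theorem testFunction_integrable_sq (ψ : 𝓓(Ω, ℝ)) : Integrable (fun x => ψ x ^ 2) := by
  simp_rw [sq]
  exact (ψ.continuous.mul ψ.continuous).integrable_of_hasCompactSupport
      (ψ.hasCompactSupport.mul_right)

theorem norm_toL2_sq (ψ : 𝓓(Ω, ℝ)) : ‖toL2 ψ‖ ^ 2 = ∫ x, ψ x ^ 2 := by
  rw [← real_inner_self_eq_norm_sq, inner_toL2_toL2]
  simp_rw [sq]

theorem lintegral_sq (ψ : 𝓓(Ω, ℝ)) :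
    ∫⁻ x, ENNReal.ofReal (ψ x ^ 2) = ENNReal.ofReal (‖toL2 ψ‖ ^ 2) := by
  rw [norm_toL2_sq, ofReal_integral_eq_lintegral_ofReal (testFunction_integrable_sq ψ)
    (ae_of_all _ fun x => sq_nonneg _)]

theorem lintegral_gradSq (ψ : 𝓓(Ω, ℝ)) :
    ∫⁻ x, ENNReal.ofReal (gradSq ψ x) = ENNReal.ofReal (∑ j, ‖toL2 (pd j ψ)‖ ^ 2) := by
  rw [ENNReal.ofReal_sum_of_nonneg fun _ _ => sq_nonneg _]
  simp_rw [← lintegral_sq, gradSq]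
  rw [← lintegral_finsetSum _ fun j _ => by fun_prop]
  congr 1
  ext x
  rw [ENNReal.ofReal_sum_of_nonneg fun _ _ => sq_nonneg _]

theorem fderiv_sq_le (ψ : 𝓓(Ω, ℝ)) (x h : EuclideanSpace ℝ (Fin d)) :
    (fderiv ℝ ψ x h) ^ 2 ≤ ‖h‖ ^ 2 * gradSq ψ x := by
  have : fderiv ℝ ψ x h = ∑ j, h j * pd j ψ x := by
    conv_lhs => rw [← (EuclideanSpace.basisFun (Fin d) ℝ).sum_repr h]
    simp [pd_apply]
  rw [this, EuclideanSpace.real_norm_sq_eq, gradSq]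
  exact Finset.sum_mul_sq_le_sq_mul_sq _ _ _

theorem sub_sq_le_integral (ψ : 𝓓(Ω, ℝ)) (x h : EuclideanSpace ℝ (Fin d)) :
    (ψ (x + h) - ψ x) ^ 2 ≤ ‖h‖ ^ 2 * ∫ s in Ioc (0 : ℝ) 1, gradSq ψ (x + s • h) := by
  have hψ : Differentiable ℝ (ψ : EuclideanSpace ℝ (Fin d) → ℝ) :=
    ψ.contDiff.differentiable (by simp)
  have hψ' : Continuous (fderiv ℝ (ψ : EuclideanSpace ℝ (Fin d) → ℝ)) :=
    ψ.contDiff.continuous_fderiv (by simp)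
  have hder : ∀ s : ℝ, HasDerivAt (fun s : ℝ => ψ (x + s • h)) (fderiv ℝ ψ (x + s • h) h) s := by
    intro s
    have h1 : HasDerivAt (fun s : ℝ => x + s • h) h s := by
      simpa using ((hasDerivAt_id s).smul_const h).const_add x
    exact (hψ (x + s • h)).hasFDerivAt.comp_hasDerivAt s h1
  have hc : Continuous fun s : ℝ => fderiv ℝ ψ (x + s • h) h := by fun_prop
  have hftc : ∫ s in (0 : ℝ)..1, fderiv ℝ ψ (x + s • h) h = ψ (x + h) - ψ x := by
    rw [intervalIntegral.integral_eq_sub_of_hasDerivAt (fun s _ => hder s)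
      (hc.intervalIntegrable _ _)]
    simp
  rw [← hftc, intervalIntegral.integral_of_le zero_le_one]
  have hi : ∀ g : ℝ → ℝ, Continuous g → IntegrableOn g (Ioc 0 1) := fun g hg =>
    (hg.integrableOn_Icc).mono_set Ioc_subset_Icc_self
  refine (sq_integral_le (hi _ hc) (hi _ (hc.pow 2))).trans ?_
  simp only [measureReal_restrict_apply_univ, Real.volume_real_Ioc_of_le zero_le_one, sub_zero,
    one_mul]
  rw [← integral_const_mul]
  have hg := continuous_gradSq ψ
  exact integral_mono (hi _ (hc.pow 2)) (hi _ (by fun_prop)) fun s => fderiv_sq_le ψ _ h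

/-- The increment along a segment is the integral of the derivative; after Cauchy–Schwarz,
translation invariance removes the shift. Both Rellich's theorem and the Poincaré inequality are
drawn from this estimate. -/
theorem lintegral_translate_sub_sq_le (ψ : 𝓓(Ω, ℝ)) (h : EuclideanSpace ℝ (Fin d)) :
    ∫⁻ x, ENNReal.ofReal ((ψ (x + h) - ψ x) ^ 2) ≤
      ENNReal.ofReal (‖h‖ ^ 2) * ENNReal.ofReal (∑ j, ‖toL2 (pd j ψ)‖ ^ 2) := by
  have hg := continuous_gradSq ψ
  calc ∫⁻ x, ENNReal.ofReal ((ψ (x + h) - ψ x) ^ 2)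
      ≤ ∫⁻ x, ENNReal.ofReal (‖h‖ ^ 2) *
          ∫⁻ s in Ioc (0 : ℝ) 1, ENNReal.ofReal (gradSq ψ (x + s • h)) := by
        refine lintegral_mono fun x => ?_
        rw [← ofReal_integral_eq_lintegral_ofReal, ← ENNReal.ofReal_mul (sq_nonneg _)]
        · exact ENNReal.ofReal_le_ofReal (sub_sq_le_integral ψ x h)
        · exact (Continuous.integrableOn_Icc (by fun_prop)).mono_set Ioc_subset_Icc_self
        · exact ae_of_all _ fun s => gradSq_nonneg ψ _
    _ = ENNReal.ofReal (‖h‖ ^ 2) * ∫⁻ s in Ioc (0 : ℝ) 1, ∫⁻ x,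
          ENNReal.ofReal (gradSq ψ (x + s • h)) := by
        rw [lintegral_const_mul' _ _ ENNReal.ofReal_ne_top, lintegral_lintegral_swap]
        exact Measurable.aemeasurable (by
          apply Measurable.ennreal_ofReal
          exact Continuous.measurable (by fun_prop))
    _ = _ := by
        simp_rw [lintegral_add_right_eq_self
          (fun x => ENNReal.ofReal (gradSq ψ x)), lintegral_gradSq]
        simp

/-- Compare `ψ x` with its mean over the ball: `a² ≤ 2 b² + 2 (b - a)²`, the squared deviation is at
most the mean of `(ψ y - ψ x)²`, and the ball lies in the one of radius `2ε` about `x`. -/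
theorem sq_le_ball_average (ψ : 𝓓(Ω, ℝ)) {ε : ℝ} (hε : 0 < ε)
    {x z : EuclideanSpace ℝ (Fin d)} (hx : x ∈ Metric.ball z ε) :
    ψ x ^ 2 ≤ 2 * ((volume.real (Metric.ball (0 : EuclideanSpace ℝ (Fin d)) ε))⁻¹ *
        ∫ y in Metric.ball z ε, ψ y) ^ 2 +
      2 * ((volume.real (Metric.ball (0 : EuclideanSpace ℝ (Fin d)) ε))⁻¹ *
        ∫ h in Metric.ball (0 : EuclideanSpace ℝ (Fin d)) (2 * ε), (ψ (x + h) - ψ x) ^ 2) := by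
  set m := volume.real (Metric.ball (0 : EuclideanSpace ℝ (Fin d)) ε) with hm
  have hmz : volume.real (Metric.ball z ε) = m := by
    rw [hm, measureReal_def, Measure.addHaar_ball_center, measureReal_def]
  have hm0 : 0 < m :=
    ENNReal.toReal_pos (Metric.measure_ball_pos _ _ hε).ne' measure_ball_lt_top.ne
  have : IsFiniteMeasure (volume.restrict (Metric.ball z ε)) :=
    ⟨by simpa using measure_ball_lt_top⟩
  have hi : ∀ (g : EuclideanSpace ℝ (Fin d) → ℝ) (z : EuclideanSpace ℝ (Fin d)) (r : ℝ),
      Continuous g → IntegrableOn g (Metric.ball z r) := fun g z r hg =>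
    (hg.continuousOn.integrableOn_compact (isCompact_closedBall z r)).mono_set
      Metric.ball_subset_closedBall
  have hψ := ψ.continuous
  have h1 := sq_integral_le (hi (fun y => ψ y - ψ x) z ε (by fun_prop))
    (hi (fun y => (ψ y - ψ x) ^ 2) z ε (by fun_prop))
  rw [measureReal_restrict_apply_univ, hmz, integral_sub (hi _ _ _ hψ) (integrable_const _),
    integral_const, measureReal_restrict_apply_univ, hmz, smul_eq_mul] at h1
  have h2 : ∫ y in Metric.ball z ε, (ψ y - ψ x) ^ 2 ≤
      ∫ h in Metric.ball (0 : EuclideanSpace ℝ (Fin d)) (2 * ε), (ψ (x + h) - ψ x) ^ 2 := by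
    have : ∫ y in Metric.ball x (2 * ε), (ψ y - ψ x) ^ 2 =
        ∫ h in Metric.ball (0 : EuclideanSpace ℝ (Fin d)) (2 * ε), (ψ (x + h) - ψ x) ^ 2 := by
      have := (measurePreserving_add_left volume x).setIntegral_preimage_emb
        (MeasurableEquiv.addLeft x).measurableEmbedding (fun y => (ψ y - ψ x) ^ 2)
        (Metric.ball x (2 * ε))
      rw [← this]
      simp
    rw [← this]
    refine setIntegral_mono_set (hi _ _ _ (by fun_prop)) (ae_of_all _ fun y => sq_nonneg _)
      (LE.le.eventuallyLE ?_)
    refine Metric.ball_subset_ball' ?_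
    rw [Metric.mem_ball, dist_comm] at hx
    linarith
  set I := ∫ y in Metric.ball z ε, ψ y
  set S := ∫ h in Metric.ball (0 : EuclideanSpace ℝ (Fin d)) (2 * ε), (ψ (x + h) - ψ x) ^ 2
  have h3 : (m⁻¹ * I - ψ x) ^ 2 ≤ m⁻¹ * S := by
    have h4 : (m⁻¹ * I - ψ x) ^ 2 = m⁻¹ ^ 2 * (I - m * ψ x) ^ 2 := by
      field_simp
    have h5 : m⁻¹ * S = m⁻¹ ^ 2 * (m * S) := by
      field_simp
    rw [h4, h5]
    exact mul_le_mul_of_nonneg_left (h1.trans (mul_le_mul_of_nonneg_left h2 hm0.le)) (sq_nonneg _)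
  nlinarith [sq_nonneg (2 * (m⁻¹ * I) - ψ x)]

/-- Up to an error controlled by the gradient, a function on `Ω` is determined by its means over
finitely many small balls that cover `Ω`. The elements of `s` represent these means. -/
theorem exists_norm_sq_le (hΩ : Bornology.IsBounded (Ω : Set (EuclideanSpace ℝ (Fin d))))
    {ε : ℝ} (hε : 0 < ε) :
    ∃ (s : Finset (L2 Ω)) (C : ℝ), ∀ w : H10 Ω,
      ‖H10.toL2 Ω w‖ ^ 2 ≤ C * ∑ e ∈ s, (inner ℝ e (H10.toL2 Ω w)) ^ 2 + ε * ‖w‖ ^ 2 := by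
  classical
  -- The coefficient of the gradient will be the factor `2 m⁻¹`, times the volume `2^d m` of the
  -- ball of radius `2δ`, times the translation bound `(2δ)²`.
  obtain ⟨δ, hδ, hδε⟩ : ∃ δ : ℝ, 0 < δ ∧ 2 * (2 ^ d * (2 * δ) ^ 2) ≤ ε := by
    refine ⟨√(ε / (8 * 2 ^ d)), by positivity, ?_⟩
    rw [mul_pow, Real.sq_sqrt (by positivity)]
    apply le_of_eq
    field_simp
    norm_num
  obtain ⟨t, htf, ht⟩ := Metric.totallyBounded_iff.1 (hΩ.isCompact_closure.totallyBounded.subset subset_closure) δ hδ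
  set B := Metric.ball (0 : EuclideanSpace ℝ (Fin d)) δ
  set B2 := Metric.ball (0 : EuclideanSpace ℝ (Fin d)) (2 * δ)
  set m := volume.real B with hm
  have hm0 : 0 < m :=
    ENNReal.toReal_pos (Metric.measure_ball_pos _ _ hδ).ne' measure_ball_lt_top.ne
  have hB2 : volume B2 = ENNReal.ofReal (2 ^ d) * volume B := by
    have := Measure.addHaar_ball_mul_of_pos (volume : Measure (EuclideanSpace ℝ (Fin d))) 0
      (two_pos) δ
    simpa using this
  have hBm : volume B = ENNReal.ofReal m := (ENNReal.ofReal_toReal measure_ball_lt_top.ne).symm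
  have hΩfin : volume (Ω : Set (EuclideanSpace ℝ (Fin d))) ≠ ∞ := hΩ.measure_lt_top.ne
  let e : EuclideanSpace ℝ (Fin d) → L2 Ω := fun z =>
    m⁻¹ • indicatorConstLp 2 (measurableSet_ball (x := z) (ε := δ))
      (((Measure.restrict_apply_le _ _).trans_lt measure_ball_lt_top).ne) (1 : ℝ)
  have he : ∀ z (ψ : 𝓓(Ω, ℝ)), inner ℝ (e z) (toL2 ψ) =
      m⁻¹ * ∫ y in Metric.ball z δ, ψ y := by
    intro z ψ
    rw [real_inner_smul_left, L2.inner_indicatorConstLp_one]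
    congr 1
    rw [integral_congr_ae (ae_restrict_of_ae (coeFn_toL2 ψ)),
      Measure.restrict_restrict measurableSet_ball]
    refine (setIntegral_eq_of_subset_of_forall_sdiff_eq_zero measurableSet_ball
      inter_subset_left fun x hx => ?_).symm
    exact image_eq_zero_of_notMem_tsupport fun hx' => hx.2 ⟨hx.1, ψ.tsupport_subset hx'⟩
  set V := volume.real (Ω : Set (EuclideanSpace ℝ (Fin d))) with hV
  refine ⟨htf.toFinset.image e, 2 * V, ?_⟩
  have htest : ∀ ψ : 𝓓(Ω, ℝ), ‖toL2 ψ‖ ^ 2 ≤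
      2 * V * ∑ v ∈ htf.toFinset.image e, (inner ℝ v (toL2 ψ)) ^ 2 +
        ε * ∑ j, ‖toL2 (pd j ψ)‖ ^ 2 := by
    intro ψ
    set Sg := ∑ j, ‖toL2 (pd j ψ)‖ ^ 2 with hSg
    have hSg0 : 0 ≤ Sg := Finset.sum_nonneg fun _ _ => sq_nonneg _
    set A := ∑ v ∈ htf.toFinset.image e, (inner ℝ v (toL2 ψ)) ^ 2 with hA
    have hA0 : 0 ≤ A := Finset.sum_nonneg fun _ _ => sq_nonneg _
    have hψ := ψ.continuous
    have hpt : ∀ x ∈ (Ω : Set (EuclideanSpace ℝ (Fin d))), ENNReal.ofReal (ψ x ^ 2) ≤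
        ENNReal.ofReal (2 * A) + ENNReal.ofReal (2 * m⁻¹) *
          ∫⁻ h in B2, ENNReal.ofReal ((ψ (x + h) - ψ x) ^ 2) := by
      intro x hx
      obtain ⟨z, hz, hxz⟩ := mem_iUnion₂.1 (ht hx)
      have h1 := sq_le_ball_average ψ hδ hxz
      rw [← he z ψ] at h1
      have h2 : (inner ℝ (e z) (toL2 ψ)) ^ 2 ≤ A :=
        Finset.single_le_sum (f := fun v => (inner ℝ v (toL2 ψ)) ^ 2) (fun _ _ => sq_nonneg _)
          (Finset.mem_image_of_mem e (htf.mem_toFinset.2 hz))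
      have hI : IntegrableOn (fun h => (ψ (x + h) - ψ x) ^ 2) B2 :=
        ((by fun_prop : Continuous fun h => (ψ (x + h) - ψ x) ^ 2).continuousOn.integrableOn_compact
          (isCompact_closedBall 0 (2 * δ))).mono_set Metric.ball_subset_closedBall
      rw [← ofReal_integral_eq_lintegral_ofReal hI (ae_of_all _ fun _ => sq_nonneg _),
        ← ENNReal.ofReal_mul (by positivity), ← ENNReal.ofReal_add (by positivity)
          (mul_nonneg (by positivity) (integral_nonneg fun _ => sq_nonneg _))]
      refine ENNReal.ofReal_le_ofReal (h1.trans ?_)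
      rw [mul_assoc 2 m⁻¹]
      gcongr
    have hmain : ENNReal.ofReal (‖toL2 ψ‖ ^ 2) ≤
        ENNReal.ofReal (2 * V * A + ε * Sg) := by
      calc ENNReal.ofReal (‖toL2 ψ‖ ^ 2)
          = ∫⁻ x in (Ω : Set (EuclideanSpace ℝ (Fin d))), ENNReal.ofReal (ψ x ^ 2) := by
            rw [← lintegral_sq, setLIntegral_eq_of_support_subset]
            intro x hx
            by_contra hx'
            refine hx ?_
            have : ψ x = 0 :=
              image_eq_zero_of_notMem_tsupport fun h => hx' (ψ.tsupport_subset h)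
            simp [this]
        _ ≤ ∫⁻ x in (Ω : Set (EuclideanSpace ℝ (Fin d))), (ENNReal.ofReal (2 * A) +
            ENNReal.ofReal (2 * m⁻¹) * ∫⁻ h in B2, ENNReal.ofReal ((ψ (x + h) - ψ x) ^ 2)) :=
            setLIntegral_mono' Ω.isOpen.measurableSet hpt
        _ = ENNReal.ofReal (2 * A) * volume (Ω : Set (EuclideanSpace ℝ (Fin d))) +
            ENNReal.ofReal (2 * m⁻¹) * ∫⁻ x in (Ω : Set (EuclideanSpace ℝ (Fin d))),
              ∫⁻ h in B2, ENNReal.ofReal ((ψ (x + h) - ψ x) ^ 2) := by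
            rw [lintegral_add_left measurable_const, lintegral_const_mul' _ _ ENNReal.ofReal_ne_top]
            simp
        _ ≤ ENNReal.ofReal (2 * A) * volume (Ω : Set (EuclideanSpace ℝ (Fin d))) +
            ENNReal.ofReal (2 * m⁻¹) * ∫⁻ h in B2, ∫⁻ x,
              ENNReal.ofReal ((ψ (x + h) - ψ x) ^ 2) := by
            rw [← lintegral_lintegral_swap]
            · gcongr
              exact Measure.restrict_le_self
            · exact Measurable.aemeasurable (Measurable.ennreal_ofReal
                (Continuous.measurable (by fun_prop)))
        _ ≤ ENNReal.ofReal (2 * A) * volume (Ω : Set (EuclideanSpace ℝ (Fin d))) +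
            ENNReal.ofReal (2 * m⁻¹) * ∫⁻ h in B2,
              ENNReal.ofReal ((2 * δ) ^ 2) * ENNReal.ofReal Sg := by
            refine add_le_add le_rfl (mul_le_mul_right ?_ _)
            refine setLIntegral_mono' measurableSet_ball fun h hh => ?_
            refine (lintegral_translate_sub_sq_le ψ h).trans ?_
            gcongr
            rw [mem_ball_zero_iff] at hh
            exact hh.le
        _ = ENNReal.ofReal (2 * V * A + 2 * (2 ^ d * (2 * δ) ^ 2) * Sg) := by
            rw [setLIntegral_const, hB2, hBm, ← ENNReal.ofReal_toReal hΩfin, ← measureReal_def, ← hV]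
            rw [← ENNReal.ofReal_mul (by positivity), ← ENNReal.ofReal_mul (by positivity),
              ← ENNReal.ofReal_mul (by positivity), ← ENNReal.ofReal_mul (by positivity),
              ← ENNReal.ofReal_mul (by positivity), ← ENNReal.ofReal_add (by positivity)
                (by positivity)]
            congr 1
            field_simp
        _ ≤ _ := by gcongr
    exact (ENNReal.ofReal_le_ofReal_iff (by positivity)).1 hmain
  rintro ⟨w, hw⟩
  simp only [H10.toL2_apply, Submodule.coe_norm]
  have h0 := continuous_coord (Ω := Ω) none
  refine H10.induction (P := fun w => ‖w none‖ ^ 2 ≤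
    2 * V * ∑ v ∈ htf.toFinset.image e, (inner ℝ v (w none)) ^ 2 + ε * ‖w‖ ^ 2)
    (isClosed_le (by fun_prop) (by fun_prop)) (fun ψ => ?_) hw
  rw [gradMap_none]
  refine (htest ψ).trans ?_
  gcongr
  rw [PiLp.norm_sq_eq_of_L2, Fintype.sum_option]
  simp only [gradMap_none, gradMap_some]
  exact le_add_of_nonneg_left (sq_nonneg _)

end Rellich

/-! ### Completeness of the eigenfunctions and positivity of the eigenvalues -/

section Spectrum

/-- On the unit ball the finitely many inner products range over a bounded subset of a
finite-dimensional space. Two vectors for which these nearly agree have nearby images, so the image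
of the ball is totally bounded. -/
theorem isCompactOperator_of_norm_sq_le {V H : Type*} [NormedAddCommGroup V]
    [InnerProductSpace ℝ V] [NormedAddCommGroup H] [InnerProductSpace ℝ H] [CompleteSpace H]
    (J : V →L[ℝ] H)
    (h : ∀ ε > 0, ∃ (s : Finset H) (C : ℝ), ∀ w : V,
      ‖J w‖ ^ 2 ≤ C * ∑ e ∈ s, (inner ℝ e (J w)) ^ 2 + ε * ‖w‖ ^ 2) :
    IsCompactOperator J := by
  refine (isCompactOperator_iff_isCompact_closure_image_closedBall J.toLinearMap zero_lt_one).2 ?_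
  refine (TotallyBounded.closure ?_).isCompact_of_isClosed isClosed_closure
  refine Metric.totallyBounded_of_finite_discretization fun η hη => ?_
  -- Since `‖w - w'‖ ≤ 2`, this term contributes at most `η²/4`; the choice of `δ` makes the other
  -- at most `η²/4`, so the sum stays below `η²`.
  obtain ⟨s, C, hC⟩ := h (η ^ 2 / 16) (by positivity)
  set K := |C| * (s.card + 1) + 1 with hK
  have hK0 : 0 < K := by positivity
  obtain ⟨δ, hδ, hδη⟩ : ∃ δ : ℝ, 0 < δ ∧ K * (2 * δ) ^ 2 ≤ η ^ 2 / 4 := by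
    refine ⟨√(η ^ 2 / (16 * K)), by positivity, ?_⟩
    rw [mul_pow, Real.sq_sqrt (by positivity)]
    apply le_of_eq
    field_simp
    norm_num
  let Φ : H →L[ℝ] (s → ℝ) := ContinuousLinearMap.pi fun e => innerSL ℝ (e : H)
  have hb : Bornology.IsBounded ((Φ ∘L J) '' Metric.closedBall (0 : V) 1) :=
    (Φ ∘L J).lipschitz.isBounded_image Metric.isBounded_closedBall
  obtain ⟨t, htf, ht⟩ := Metric.totallyBounded_iff.1
    (hb.isCompact_closure.totallyBounded.subset subset_closure) δ hδ
  have hmem : ∀ x : J.toLinearMap '' Metric.closedBall (0 : V) 1,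
      ∃ y : htf.toFinset, dist (Φ x) y < δ := by
    rintro ⟨_, w, hw, rfl⟩
    have := ht ⟨w, hw, rfl⟩
    simp only [mem_iUnion, Metric.mem_ball, exists_prop] at this
    obtain ⟨y, hy, hyd⟩ := this
    exact ⟨⟨y, htf.mem_toFinset.2 hy⟩, hyd⟩
  choose F hF using hmem
  refine ⟨htf.toFinset, inferInstance, F, ?_⟩
  rintro ⟨_, w, hw, rfl⟩ ⟨_, w', hw', rfl⟩ hFF
  have h1 := hF ⟨_, w, hw, rfl⟩
  have h2 := hF ⟨_, w', hw', rfl⟩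
  rw [hFF] at h1
  simp only at h1 h2
  have h3 : dist (Φ (J w)) (Φ (J w')) < 2 * δ := by
    have := (dist_triangle_right (Φ (J w)) (Φ (J w')) _).trans_lt (add_lt_add h1 h2)
    linarith
  have h4 : ∀ e ∈ s, (inner ℝ e (J (w - w'))) ^ 2 ≤ (2 * δ) ^ 2 := by
    intro e he
    have h5 := (dist_le_pi_dist (Φ (J w)) (Φ (J w')) ⟨e, he⟩).trans h3.le
    have h6 : Φ (J w) ⟨e, he⟩ - Φ (J w') ⟨e, he⟩ = inner ℝ e (J (w - w')) := by
      rw [map_sub, inner_sub_right]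
      rfl
    rw [Real.dist_eq, h6] at h5
    rw [← sq_abs]
    exact pow_le_pow_left₀ (abs_nonneg _) h5 2
  have h7 : ‖w - w'‖ ≤ 2 := by
    rw [mem_closedBall_zero_iff] at hw hw'
    exact (norm_sub_le _ _).trans (by linarith)
  have h8 : ∑ e ∈ s, (inner ℝ e (J (w - w'))) ^ 2 ≤ s.card * (2 * δ) ^ 2 := by
    simpa using Finset.sum_le_sum h4
  have h9 : ‖J (w - w')‖ ^ 2 < η ^ 2 := by
    have hs0 : 0 ≤ ∑ e ∈ s, (inner ℝ e (J (w - w'))) ^ 2 :=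
      Finset.sum_nonneg fun _ _ => sq_nonneg _
    calc ‖J (w - w')‖ ^ 2 ≤ C * ∑ e ∈ s, (inner ℝ e (J (w - w'))) ^ 2 +
          η ^ 2 / 16 * ‖w - w'‖ ^ 2 := hC _
      _ ≤ |C| * (s.card * (2 * δ) ^ 2) + η ^ 2 / 16 * 2 ^ 2 := by
        gcongr
        exact le_abs_self C
      _ ≤ K * (2 * δ) ^ 2 + η ^ 2 / 16 * 2 ^ 2 := by
        rw [hK]
        have : 0 ≤ (|C| + 1) * (2 * δ) ^ 2 := by positivity
        nlinarith
      _ < η ^ 2 := by nlinarith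
  have h10 : ‖J (w - w')‖ < η := lt_of_pow_lt_pow_left₀ 2 hη.le h9
  rw [map_sub, ← dist_eq_norm] at h10
  exact h10

variable {d : ℕ} {Ω : Opens (EuclideanSpace ℝ (Fin d))}

theorem isCompactOperator_toL2
    (hΩ : Bornology.IsBounded (Ω : Set (EuclideanSpace ℝ (Fin d)))) :
    IsCompactOperator (H10.toL2 Ω) :=
  isCompactOperator_of_norm_sq_le _ fun _ hε => exists_norm_sq_le hΩ hε

theorem eq_zero_of_inner_toL2 {w : L2 Ω} (h : ∀ ψ : 𝓓(Ω, ℝ), inner ℝ w (toL2 ψ) = 0) : w = 0 := by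
  have hw : LocallyIntegrableOn w (Ω : Set (EuclideanSpace ℝ (Fin d))) volume := by
    refine (locallyIntegrableOn_iff Ω.isOpen.isLocallyClosed).2 fun k hk hkc => ?_
    have h1 : MemLp w 2 ((volume.restrict (Ω : Set (EuclideanSpace ℝ (Fin d)))).restrict k) :=
      (Lp.memLp w).restrict k
    rw [Measure.restrict_restrict_of_subset hk] at h1
    have : IsFiniteMeasure ((volume : Measure (EuclideanSpace ℝ (Fin d))).restrict k) :=
      ⟨by simpa using hkc.measure_lt_top⟩
    exact h1.integrable (by norm_num)
  have h0 := Ω.isOpen.ae_eq_zero_of_integral_contDiff_smul_eq_zero hw fun g hg hgc hgs => by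
    have := h ⟨g, hg, hgc, hgs⟩
    rw [inner_toL2_right] at this
    rw [← this, ← setIntegral_eq_integral_of_forall_compl_eq_zero
      (s := (Ω : Set (EuclideanSpace ℝ (Fin d))))]
    · simp [mul_comm]
    · intro x hx
      have : g x = 0 := image_eq_zero_of_notMem_tsupport fun hx' => hx (hgs hx')
      simp [this]
  refine Lp.ext ?_
  filter_upwards [(ae_restrict_iff' Ω.isOpen.measurableSet).2 h0, Lp.coeFn_zero ℝ 2
    (volume.restrict (Ω : Set (EuclideanSpace ℝ (Fin d))))] with x h1 h2
  rw [h1, h2]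
  rfl

/-- The eigenfunctions span a dense subspace. -/
theorem IsEigensystem.topologicalClosure_span_eq_top {lam : ℕ → ℝ} {φ : ℕ → L2 Ω}
    (hφ : IsEigensystem Ω lam φ)
    (hΩ : Bornology.IsBounded (Ω : Set (EuclideanSpace ℝ (Fin d)))) :
    (Submodule.span ℝ (range φ)).topologicalClosure = ⊤ := by
  set J := H10.toL2 Ω with hJ
  set Jt := ContinuousLinearMap.adjoint J with hJt
  -- For the full `H¹` inner product, `Jt h` is the weak solution in `H¹₀` of `w - A w = h`. So `S`
  -- is the inverse of `1 - A`, and the spectral theorem for compact self-adjoint operators applies.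
  set S : L2 Ω →L[ℝ] L2 Ω := J ∘L Jt with hS
  have hcomp : IsCompactOperator S := (isCompactOperator_toL2 hΩ).comp_clm Jt
  have hsymm : S.IsSymmetric := fun x y => by
    change inner ℝ (J (Jt x)) y = inner ℝ x (J (Jt y))
    rw [← ContinuousLinearMap.adjoint_inner_right J, ← ContinuousLinearMap.adjoint_inner_left J]
  have hspec := ContinuousLinearMap.orthogonalComplement_iSup_eigenspaces_eq_bot hcomp hsymm
  have hle : (⨆ ν, Module.End.eigenspace (S : Module.End ℝ (L2 Ω)) ν) ≤
      (Submodule.span ℝ (range φ)).topologicalClosure := by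
    refine iSup_le fun ν w hw => ?_
    have hw' : J (Jt w) = ν • w := Module.End.mem_eigenspace_iff.1 hw
    rcases eq_or_ne ν 0 with rfl | hν
    -- The eigenvalue `0` does not occur: a vector in the kernel of `Jt` is orthogonal to all test
    -- functions.
    · have h0 : Jt w = 0 := by
        have : inner ℝ (Jt w) (Jt w) = 0 := by
          rw [ContinuousLinearMap.adjoint_inner_left, hw']
          simp
        exact inner_self_eq_zero.1 this
      have : w = 0 := eq_zero_of_inner_toL2 fun ψ => by
        have h1 := ContinuousLinearMap.adjoint_inner_left J ⟨gradMap ψ, gradMap_mem ψ⟩ w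
        rw [← hJt, h0, inner_zero_left] at h1
        exact h1.symm
      rw [this]
      exact Submodule.zero_mem _
    -- `(1 - A)⁻¹ w = ν w` means `-A w = (ν⁻¹ - 1) w`.
    · refine hφ.exhaustive (ν⁻¹ - 1) w ?_
      have hv : J (Jt (ν⁻¹ • w)) = w := by
        rw [map_smul, map_smul, hw', smul_smul, inv_mul_cancel₀ hν, one_smul]
      refine ⟨memH10_iff.2 ⟨_, hv⟩, ?_⟩
      rw [← hv, hasWeakLaplacian_iff, ← hJ, hv]
      intro v
      rw [ContinuousLinearMap.adjoint_inner_left, inner_sub_left, inner_neg_left,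
        real_inner_smul_left, real_inner_smul_left]
      ring
  have hbot : (Submodule.span ℝ (range φ)).topologicalClosureᗮ = ⊥ :=
    le_bot_iff.1 ((Submodule.orthogonal_le hle).trans hspec.le)
  rw [Submodule.topologicalClosure_eq_top_iff, ← Submodule.orthogonal_closure]
  exact hbot

theorem IsEigenpair.inner_eq {μ : ℝ} {w : H10 Ω} (h : IsEigenpair Ω μ (H10.toL2 Ω w))
    (v : H10 Ω) : inner ℝ w v = (1 + μ) * inner ℝ (H10.toL2 Ω w) (H10.toL2 Ω v) := by
  rw [(hasWeakLaplacian_iff w _).1 h.2 v, inner_sub_left, inner_neg_left, real_inner_smul_left]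
  ring

/-- If the shift by `h` moves `Ω` off itself, then `ψ (x + h) = 0` for `x ∈ Ω`, and the translation
estimate bounds `ψ` itself. -/
theorem norm_toL2_sq_le_of_translate (ψ : 𝓓(Ω, ℝ)) (h : EuclideanSpace ℝ (Fin d))
    (hh : ∀ x ∈ Ω, x + h ∉ Ω) :
    ‖toL2 ψ‖ ^ 2 ≤ ‖h‖ ^ 2 * ∑ j, ‖toL2 (pd j ψ)‖ ^ 2 := by
  have h1 := lintegral_translate_sub_sq_le ψ h
  have h0 : ∀ x, x ∉ Ω → ψ x = 0 := fun x hx =>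
    image_eq_zero_of_notMem_tsupport fun hx' => hx (ψ.tsupport_subset hx')
  have h2 : ENNReal.ofReal (‖toL2 ψ‖ ^ 2) ≤ ∫⁻ x, ENNReal.ofReal ((ψ (x + h) - ψ x) ^ 2) := by
    rw [← lintegral_sq]
    refine lintegral_mono fun x => ENNReal.ofReal_le_ofReal ?_
    by_cases hx : x ∈ Ω
    · rw [h0 _ (hh x hx)]
      simp
    · rw [h0 x hx]
      simpa using sq_nonneg _
  rw [← ENNReal.ofReal_mul (sq_nonneg _)] at h1
  exact (ENNReal.ofReal_le_ofReal_iff (by positivity)).1 (h2.trans h1)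

/-- The Poincaré inequality. -/
theorem exists_poincare [Nontrivial (EuclideanSpace ℝ (Fin d))]
    (hΩ : Bornology.IsBounded (Ω : Set (EuclideanSpace ℝ (Fin d)))) :
    ∃ C > 0, ∀ w : H10 Ω, ‖(w : GradL2 Ω) none‖ ^ 2 ≤
      C * ∑ j, ‖(w : GradL2 Ω) (some j)‖ ^ 2 := by
  obtain ⟨R, hR⟩ := hΩ.subset_closedBall 0
  -- A vector longer than the diameter of a ball containing `Ω`; it exists because the space is
  -- nontrivial.
  obtain ⟨h, hh⟩ := NormedSpace.exists_lt_norm ℝ (EuclideanSpace ℝ (Fin d)) (2 * |R|)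
  have htr : ∀ x ∈ Ω, x + h ∉ Ω := by
    intro x hx hxh
    have h1 := hR hx
    have h2 := hR hxh
    rw [mem_closedBall_zero_iff] at h1 h2
    have h3 : ‖h‖ ≤ ‖x + h‖ + ‖x‖ := by
      simpa using norm_sub_le (x + h) x
    linarith [le_abs_self R]
  refine ⟨‖h‖ ^ 2, by have := abs_nonneg R; have : 0 < ‖h‖ := by linarith
                      positivity, ?_⟩
  rintro ⟨w, hw⟩
  have h0 := continuous_coord (Ω := Ω) none
  have h1 := fun j => continuous_coord (Ω := Ω) (some j)
  refine H10.induction (P := fun w : GradL2 Ω => ‖w none‖ ^ 2 ≤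
      ‖h‖ ^ 2 * ∑ j, ‖w (some j)‖ ^ 2) (isClosed_le (by fun_prop) (by fun_prop))
      (fun ψ => ?_) hw
  exact norm_toL2_sq_le_of_translate ψ h htr

/-- For `d = 0` the underlying space is a point and any two elements of `L²` are linearly dependent,
so no infinite orthonormal family exists. This excludes the dimension in which no long translation
is available. -/
theorem nontrivial_of_orthonormal {φ : ℕ → L2 Ω} (hφ : Orthonormal ℝ φ) :
    Nontrivial (EuclideanSpace ℝ (Fin d)) := by
  by_contra hE
  rw [not_nontrivial_iff_subsingleton] at hE
  have key : ∀ f g : L2 Ω, g 0 • f - f 0 • g = 0 := by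
    intro f g
    refine Lp.ext ?_
    filter_upwards [Lp.coeFn_sub (g 0 • f) (f 0 • g), Lp.coeFn_smul (g 0) f,
      Lp.coeFn_smul (f 0) g, Lp.coeFn_zero ℝ 2
        (volume.restrict (Ω : Set (EuclideanSpace ℝ (Fin d))))] with x h1 h2 h3 h4
    rw [h1, h4, Pi.sub_apply, h2, h3, Subsingleton.elim x 0]
    simp [mul_comm]
  have h := key (φ 0) (φ 1)
  have h01 : inner ℝ (φ 0) (φ 1) = 0 := hφ.2 (by norm_num)
  have h1 : φ 0 0 = 0 := by
    have := congrArg (fun v => inner ℝ v (φ 1)) h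
    simp only [inner_sub_left, real_inner_smul_left, h01, real_inner_self_eq_norm_sq, hφ.1 1,
      inner_zero_left] at this
    linarith
  have h2 : φ 0 = 0 := by
    refine Lp.ext ?_
    filter_upwards [Lp.coeFn_zero ℝ 2
        (volume.restrict (Ω : Set (EuclideanSpace ℝ (Fin d))))] with x h4
    rw [h4, Subsingleton.elim x 0, h1]
    rfl
  have h3 := hφ.1 0
  rw [h2, norm_zero] at h3
  exact zero_ne_one h3

/-- Testing the eigenvalue equation with `φ i` itself gives `lam i = ‖∇ φ i‖²`, which the Poincaré
inequality bounds below. -/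
theorem IsEigensystem.exists_forall_le {lam : ℕ → ℝ} {φ : ℕ → L2 Ω}
    (hφ : IsEigensystem Ω lam φ)
    (hΩ : Bornology.IsBounded (Ω : Set (EuclideanSpace ℝ (Fin d)))) :
    ∃ c > 0, ∀ i, c ≤ lam i := by
  have := nontrivial_of_orthonormal hφ.orthonormal
  obtain ⟨C, hC, hP⟩ := exists_poincare hΩ
  refine ⟨C⁻¹, inv_pos.2 hC, fun i => ?_⟩
  have he := hφ.eigenpair i
  obtain ⟨w, hw⟩ := memH10_iff.1 he.1
  have h1 := IsEigenpair.inner_eq (hw ▸ he) w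
  have hn := hφ.orthonormal.1 i
  rw [hw, real_inner_self_eq_norm_sq (φ i), hn, H10.inner_def, ← H10.toL2_apply, hw,
    real_inner_self_eq_norm_sq, hn] at h1
  simp_rw [real_inner_self_eq_norm_sq] at h1
  have h2 := hP w
  rw [← H10.toL2_apply, hw, hn] at h2
  have h3 : ∑ j, ‖(w : GradL2 Ω) (some j)‖ ^ 2 = lam i := by linarith
  rw [h3] at h2
  rw [inv_le_iff_one_le_mul₀ hC]
  linarith

theorem IsEigensystem.inner_of_hasWeakLaplacian {lam : ℕ → ℝ} {φ : ℕ → L2 Ω}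
    (hφ : IsEigensystem Ω lam φ) {v h : L2 Ω} (hv : MemH10 Ω v) (hh : HasWeakLaplacian Ω v h)
    (i : ℕ) : inner ℝ (φ i) h = - lam i * inner ℝ (φ i) v := by
  obtain ⟨w, rfl⟩ := memH10_iff.1 hv
  obtain ⟨wi, hwi⟩ := memH10_iff.1 (hφ.eigenpair i).1
  have h1 := IsEigenpair.inner_eq (hwi ▸ hφ.eigenpair i) w
  have h2 := (hasWeakLaplacian_iff w h).1 hh wi
  rw [hwi] at h1 h2
  rw [real_inner_comm, h1, inner_sub_left, real_inner_comm (φ i) h,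
    real_inner_comm (φ i) (H10.toL2 Ω w)] at h2
  linarith

/-- Let `w` be the weak solution in `H¹₀` of `w - A w = v - h`. Its coefficients agree with those of
`v` because `1 + lam i ≠ 0`, so `w = v` by completeness. Thus membership in `H¹₀` need not be
assumed. -/
theorem IsEigensystem.hasWeakLaplacian_of_inner {lam : ℕ → ℝ} {φ : ℕ → L2 Ω}
    (hφ : IsEigensystem Ω lam φ)
    (hΩ : Bornology.IsBounded (Ω : Set (EuclideanSpace ℝ (Fin d)))) {v h : L2 Ω}
    (hvh : ∀ i, inner ℝ (φ i) h = - lam i * inner ℝ (φ i) v) :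
    MemH10 Ω v ∧ HasWeakLaplacian Ω v h := by
  obtain ⟨c, hc, hlam⟩ := hφ.exists_forall_le hΩ
  set w := ContinuousLinearMap.adjoint (H10.toL2 Ω) (v - h) with hw
  have hwv : H10.toL2 Ω w = v := by
    have hz : ∀ i, inner ℝ (φ i) (H10.toL2 Ω w - v) = 0 := by
      intro i
      obtain ⟨wi, hwi⟩ := memH10_iff.1 (hφ.eigenpair i).1
      have h1 := IsEigenpair.inner_eq (hwi ▸ hφ.eigenpair i) w
      have h2 := ContinuousLinearMap.adjoint_inner_right (H10.toL2 Ω) wi (v - h)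
      rw [← hw, h1, hwi, inner_sub_right, hvh i] at h2
      have h3 : (1 + lam i) * inner ℝ (φ i) (H10.toL2 Ω w - v) = 0 := by
        rw [inner_sub_right]
        linarith
      exact (mul_eq_zero.1 h3).resolve_left (by linarith [hlam i])
    have hperp : H10.toL2 Ω w - v ∈ (Submodule.span ℝ (range φ))ᗮ := by
      rw [Submodule.mem_orthogonal]
      intro u hu
      induction hu using Submodule.span_induction with
      | mem x hx =>
        obtain ⟨i, rfl⟩ := hx
        exact hz i
      | zero => simp
      | add x y _ _ hx hy => rw [inner_add_left, hx, hy, add_zero]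
      | smul a x _ hx => rw [real_inner_smul_left, hx, mul_zero]
    rw [Submodule.topologicalClosure_eq_top_iff.1 (hφ.topologicalClosure_span_eq_top hΩ),
      Submodule.mem_bot] at hperp
    exact sub_eq_zero.1 hperp
  refine ⟨memH10_iff.2 ⟨w, hwv⟩, ?_⟩
  have := (hasWeakLaplacian_iff w h).2 fun u => by
    rw [hwv, hw, ContinuousLinearMap.adjoint_inner_left]
  rwa [hwv] at this

end Spectrum

/-! ### Weak derivatives in time, primitives and initial values -/

section WeakDeriv

variable {X : Type*} [NormedAddCommGroup X] [NormedSpace ℝ X] {T : ℝ} {j : ℕ}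
  {u v w z : ℝ → X}

theorem integrable_testFunction_smul (hz : LocallyIntegrableOn z (Ioo 0 T))
    (ψ : 𝓓(timeInterval T, ℝ)) : IntegrableOn (fun t => ψ t • z t) (Ioo 0 T) :=
  (TestFunction.integrable_bilin (Ω := timeInterval T) (ContinuousLinearMap.lsmul ℝ ℝ) hz
    ψ).integrableOn

theorem testFunction_eq_zero (ψ : 𝓓(timeInterval T, ℝ)) {t : ℝ} (ht : t ∉ Ioo 0 T) : ψ t = 0 :=
  image_eq_zero_of_notMem_tsupport fun h => ht (ψ.tsupport_subset h)

theorem ae_eq_zero_of_testFunction [CompleteSpace X] (hz : LocallyIntegrableOn z (Ioo 0 T))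
    (h : ∀ ψ : 𝓓(timeInterval T, ℝ), ∫ t in Ioo 0 T, ψ t • z t = 0) :
    ∀ᵐ t ∂(volume.restrict (Ioo 0 T)), z t = 0 := by
  refine (ae_restrict_iff' measurableSet_Ioo).2
    (isOpen_Ioo.ae_eq_zero_of_integral_contDiff_smul_eq_zero hz fun g hg hgc hgs => ?_)
  have := h ⟨g, hg, hgc, hgs⟩
  rw [← this]
  refine (setIntegral_eq_integral_of_forall_compl_eq_zero fun t ht => ?_).symm
  rw [image_eq_zero_of_notMem_tsupport fun h => ht (hgs h), zero_smul]

/-- The derivative of a test function. -/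
noncomputable def derivTest (ψ : 𝓓(timeInterval T, ℝ)) : 𝓓(timeInterval T, ℝ) :=
  TestFunction.lineDerivCLM ℝ (1 : ℝ) ψ

theorem derivTest_apply (ψ : 𝓓(timeInterval T, ℝ)) (t : ℝ) : derivTest ψ t = deriv ψ t := by
  have h : derivTest ψ t = lineDeriv ℝ ψ t (1 : ℝ) :=
    TestFunction.lineDerivCLM_apply_of_le (by simp)
  rw [h, (ψ.contDiff.differentiable (by simp)).differentiableAt.lineDeriv_eq_fderiv,
    fderiv_apply_one_eq_deriv]

theorem coe_derivTest (ψ : 𝓓(timeInterval T, ℝ)) : (derivTest ψ : ℝ → ℝ) = deriv ψ :=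
  funext (derivTest_apply ψ)

theorem IsWeakDeriv.ae_eq [CompleteSpace X] (h : IsWeakDeriv T j u v) (h' : IsWeakDeriv T j u w) :
    ∀ᵐ t ∂(volume.restrict (Ioo 0 T)), v t = w t := by
  have h0 : ∀ᵐ t ∂(volume.restrict (Ioo 0 T)), (v - w) t = 0 := by
    refine ae_eq_zero_of_testFunction (h.2.1.sub h'.2.1) fun ψ => ?_
    have h1 := (h.2.2 ψ).symm.trans (h'.2.2 ψ)
    have h2 := smul_right_injective X (pow_ne_zero j (by norm_num : (-1 : ℝ) ≠ 0)) h1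
    simp_rw [Pi.sub_apply, smul_sub]
    rw [integral_sub (integrable_testFunction_smul h.2.1 ψ)
      (integrable_testFunction_smul h'.2.1 ψ), h2, sub_self]
  filter_upwards [h0] with t ht
  exact sub_eq_zero.1 ht

theorem IsWeakDeriv.weakDeriv (h : IsWeakDeriv T j u v) :
    IsWeakDeriv T j u (weakDeriv T j u) := by
  have hex : ∃ v, IsWeakDeriv T j u v := ⟨v, h⟩
  rw [DiffusionWave.weakDeriv, dif_pos hex]
  exact hex.choose_spec

theorem IsWeakDeriv.weakDeriv_ae_eq [CompleteSpace X] (h : IsWeakDeriv T j u v) :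
    ∀ᵐ t ∂(volume.restrict (Ioo 0 T)), DiffusionWave.weakDeriv T j u t = v t :=
  h.weakDeriv.ae_eq h

theorem isWeakDeriv_zero (hu : LocallyIntegrableOn u (Ioo 0 T)) : IsWeakDeriv T 0 u u :=
  ⟨hu, hu, fun ψ => by simp⟩

theorem isWeakDeriv_one_iff : IsWeakDeriv T 1 u v ↔
    LocallyIntegrableOn u (Ioo 0 T) ∧ LocallyIntegrableOn v (Ioo 0 T) ∧
    ∀ ψ : 𝓓(timeInterval T, ℝ),
      ∫ t in Ioo 0 T, deriv ψ t • u t = - ∫ t in Ioo 0 T, ψ t • v t := by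
  simp [IsWeakDeriv]

theorem isWeakDeriv_two_iff (h : IsWeakDeriv T 1 u v) :
    IsWeakDeriv T 2 u w ↔ IsWeakDeriv T 1 v w := by
  rw [isWeakDeriv_one_iff] at h ⊢
  have key : ∀ ψ : 𝓓(timeInterval T, ℝ), ∫ t in Ioo 0 T, iteratedDeriv 2 (ψ : ℝ → ℝ) t • u t =
      - ∫ t in Ioo 0 T, deriv ψ t • v t := by
    intro ψ
    have := h.2.2 (derivTest ψ)
    rw [coe_derivTest] at this
    rw [← this, iteratedDeriv_succ, iteratedDeriv_one]
  refine ⟨fun hw => ⟨h.2.1, hw.2.1, fun ψ => ?_⟩, fun hw => ⟨h.1, hw.2.1, fun ψ => ?_⟩⟩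
  · have := hw.2.2 ψ
    rw [key ψ] at this
    rw [neg_eq_iff_eq_neg.1 this]
    simp
  · rw [key ψ, hw.2.2 ψ]
    simp

theorem setIntegral_deriv_testFunction (ψ : 𝓓(timeInterval T, ℝ)) {s : ℝ} (hs : s ≤ T) :
    ∫ t in Ioo s T, deriv ψ t = - ψ s := by
  have hd : Differentiable ℝ (ψ : ℝ → ℝ) := ψ.contDiff.differentiable (by simp)
  have hc : Continuous (deriv (ψ : ℝ → ℝ)) := by
    rw [← coe_derivTest]
    exact (derivTest ψ).continuous
  rw [← integral_Ioc_eq_integral_Ioo, ← intervalIntegral.integral_of_le hs,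
    intervalIntegral.integral_eq_sub_of_hasDerivAt (fun t _ => (hd t).hasDerivAt)
      (hc.intervalIntegrable _ _), testFunction_eq_zero ψ (t := T) (by simp), zero_sub]

theorem setIntegral_deriv_smul_const [CompleteSpace X] (hT : 0 < T) (ψ : 𝓓(timeInterval T, ℝ))
    (c : X) : ∫ t in Ioo 0 T, deriv ψ t • c = 0 := by
  rw [integral_smul_const, setIntegral_deriv_testFunction ψ hT.le,
    testFunction_eq_zero ψ (t := 0) (by simp), neg_zero, zero_smul]

theorem continuousOn_primitive (hv : IntegrableOn v (Ioo 0 T)) :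
    ContinuousOn (fun t => ∫ s in (0 : ℝ)..t, v s) (Icc 0 T) := by
  rcases le_total 0 T with hT | hT
  · rw [← uIcc_of_le hT]
    exact intervalIntegral.continuousOn_primitive_interval
      (by rw [uIcc_of_le hT]; exact (integrableOn_Icc_iff_integrableOn_Ioo).2 hv)
  · rcases hT.lt_or_eq with h | rfl
    · simp [Icc_eq_empty (not_le.2 h)]
    · simp

/-- A primitive of an integrable function has it as its weak derivative. -/
theorem isWeakDeriv_primitive [CompleteSpace X] (hT : 0 < T) (hv : IntegrableOn v (Ioo 0 T))
    (c : X) : IsWeakDeriv T 1 (fun t => c + ∫ s in (0 : ℝ)..t, v s) v := by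
  have hcont : ContinuousOn (fun t => ∫ s in (0 : ℝ)..t, v s) (Icc 0 T) :=
    continuousOn_primitive hv
  have hprim : LocallyIntegrableOn (fun t => ∫ s in (0 : ℝ)..t, v s) (Ioo 0 T) :=
    (hcont.integrableOn_Icc.mono_set Ioo_subset_Icc_self).locallyIntegrableOn
  have hconst : LocallyIntegrableOn (fun _ : ℝ => c) (Ioo 0 T) :=
    (integrableOn_const (by simp)).locallyIntegrableOn
  rw [isWeakDeriv_one_iff]
  refine ⟨hconst.add hprim, hv.locallyIntegrableOn, fun ψ => ?_⟩
  have hi1 := integrable_testFunction_smul hconst (derivTest ψ)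
  have hi2 := integrable_testFunction_smul hprim (derivTest ψ)
  simp_rw [derivTest_apply] at hi1 hi2
  simp_rw [smul_add]
  rw [integral_add hi1 hi2, setIntegral_deriv_smul_const hT ψ c, zero_add]
  set μ := (volume : Measure ℝ).restrict (Ioo 0 T) with hμ
  have hψ : Integrable (fun t => deriv ψ t) μ := by
    simp_rw [← derivTest_apply]
    exact ((derivTest ψ).continuous.integrable_of_hasCompactSupport
      (derivTest ψ).hasCompactSupport).integrableOn
  have hD : MeasurableSet {q : ℝ × ℝ | q.2 < q.1} := measurableSet_lt measurable_snd measurable_fst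
  -- Fubini's theorem on the triangle `s < t`; integrating `deriv ψ` over `(s, T)` gives `-ψ s`.
  have hint : Integrable (Function.uncurry fun t s =>
      {q : ℝ × ℝ | q.2 < q.1}.indicator (fun q => deriv ψ q.1 • v q.2) (t, s)) (μ.prod μ) :=
    (hψ.smul_prod hv).indicator hD
  have h1 : ∀ t ∈ Ioo 0 T, deriv ψ t • ∫ s in (0 : ℝ)..t, v s =
      ∫ s, {q : ℝ × ℝ | q.2 < q.1}.indicator (fun q => deriv ψ q.1 • v q.2) (t, s) ∂μ := by
    intro t ht
    rw [intervalIntegral.integral_of_le ht.1.le, integral_Ioc_eq_integral_Ioo,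
      ← integral_smul]
    have : ∀ s, {q : ℝ × ℝ | q.2 < q.1}.indicator (fun q => deriv ψ q.1 • v q.2) (t, s) =
        (Iio t).indicator (fun s => deriv ψ t • v s) s := fun s => by
      simp [indicator_apply]
    simp_rw [this]
    rw [integral_indicator measurableSet_Iio, hμ, Measure.restrict_restrict measurableSet_Iio]
    congr 2
    ext s
    simp only [mem_inter_iff, mem_Iio, mem_Ioo]
    exact ⟨fun h => ⟨h.2, h.1, h.2.trans ht.2⟩, fun h => ⟨h.2.1, h.1⟩⟩
  have h2 : ∀ s ∈ Ioo 0 T, - (ψ s • v s) =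
      ∫ t, {q : ℝ × ℝ | q.2 < q.1}.indicator (fun q => deriv ψ q.1 • v q.2) (t, s) ∂μ := by
    intro s hs
    rw [← neg_smul, ← setIntegral_deriv_testFunction ψ hs.2.le, ← integral_smul_const]
    have : ∀ t, {q : ℝ × ℝ | q.2 < q.1}.indicator (fun q => deriv ψ q.1 • v q.2) (t, s) =
        (Ioi s).indicator (fun t => deriv ψ t • v s) t := fun t => by
      simp [indicator_apply]
    simp_rw [this]
    rw [integral_indicator measurableSet_Ioi, hμ, Measure.restrict_restrict measurableSet_Ioi]
    congr 2
    ext t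
    simp only [mem_inter_iff, mem_Ioi, mem_Ioo]
    exact ⟨fun h => ⟨h.1, hs.1.trans h.1, h.2⟩, fun h => ⟨h.1, h.2.2⟩⟩
  rw [setIntegral_congr_fun measurableSet_Ioo h1, ← integral_neg,
    setIntegral_congr_fun measurableSet_Ioo h2]
  exact integral_integral_swap hint

theorem exists_testFunction_integral_eq_one (hT : 0 < T) :
    ∃ θ : 𝓓(timeInterval T, ℝ), ∫ t in Ioo 0 T, θ t = 1 := by
  let b : ContDiffBump (T / 2 : ℝ) := ⟨T / 8, T / 4, by positivity, by linarith⟩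
  have hsub : tsupport (b.normed volume) ⊆ Ioo 0 T := by
    rw [ContDiffBump.tsupport_normed_eq, Real.closedBall_eq_Icc]
    change Icc (T / 2 - T / 4) (T / 2 + T / 4) ⊆ Ioo 0 T
    exact fun t ht => ⟨by linarith [ht.1], by linarith [ht.2]⟩
  refine ⟨⟨b.normed volume, b.contDiff_normed, b.hasCompactSupport_normed, hsub⟩, ?_⟩
  rw [← b.integral_normed (μ := volume)]
  refine setIntegral_eq_integral_of_forall_compl_eq_zero fun t ht => ?_
  exact image_eq_zero_of_notMem_tsupport fun h => ht (hsub h)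

/-- The primitive from `0` vanishes to the left of the support, and also to the right of it because
the total integral is zero; hence it is again a test function. -/
theorem exists_deriv_eq_of_integral_eq_zero (χ : 𝓓(timeInterval T, ℝ))
    (h0 : ∫ t in Ioo 0 T, χ t = 0) : ∃ η : 𝓓(timeInterval T, ℝ), ∀ t, deriv η t = χ t := by
  obtain ⟨a, b, ha, hb, hab⟩ : ∃ a b : ℝ, 0 < a ∧ b < T ∧ tsupport χ ⊆ Icc a b := by
    rcases (tsupport χ).eq_empty_or_nonempty with he | hne
    · exact ⟨1, T - 1, one_pos, by linarith, by simp [he]⟩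
    · obtain ⟨a, haK, ha⟩ := IsCompact.exists_isLeast (s := tsupport χ) χ.hasCompactSupport hne
      obtain ⟨b, hbK, hb⟩ := IsCompact.exists_isGreatest (s := tsupport χ) χ.hasCompactSupport hne
      exact ⟨a, b, (χ.tsupport_subset haK).1, (χ.tsupport_subset hbK).2, fun t ht => ⟨ha ht, hb ht⟩⟩
  have hχ0 : ∀ t, t ∉ Icc a b → χ t = 0 := fun t ht =>
    image_eq_zero_of_notMem_tsupport fun h => ht (hab h)
  let η : ℝ → ℝ := fun t => ∫ s in (0 : ℝ)..t, χ s
  have hder : ∀ t, HasDerivAt η (χ t) t := fun t =>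
    intervalIntegral.integral_hasDerivAt_right (χ.continuous.intervalIntegrable _ _)
      (χ.continuous.stronglyMeasurableAtFilter _ _) χ.continuous.continuousAt
  have hdη : deriv η = χ := funext fun t => (hder t).deriv
  have hη0 : ∀ t, t ∉ Icc a b → η t = 0 := by
    intro t ht
    rw [mem_Icc, not_and_or, not_le, not_le] at ht
    rcases ht with ht | ht
    · have : ∀ s ∈ uIcc 0 t, χ s = 0 := fun s hs =>
        hχ0 s fun h => not_lt.2 h.1 (hs.2.trans_lt (max_lt ha ht))
      change ∫ s in (0 : ℝ)..t, χ s = 0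
      rw [intervalIntegral.integral_congr this]
      simp
    · have h1 : ∫ s in t..T, χ s = 0 := by
        have : ∀ s ∈ uIcc t T, χ s = 0 := fun s hs =>
          hχ0 s fun h => not_lt.2 h.2 ((lt_min ht hb).trans_le hs.1)
        rw [intervalIntegral.integral_congr this]
        simp
      have h2 : ∫ s in (0 : ℝ)..T, χ s = 0 := by
        rcases le_total 0 T with hT | hT
        · rw [intervalIntegral.integral_of_le hT, integral_Ioc_eq_integral_Ioo, h0]
        · have : ∀ s ∈ uIcc 0 T, χ s = 0 := fun s hs =>
            testFunction_eq_zero χ fun h => by linarith [h.1, h.2]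
          rw [intervalIntegral.integral_congr this]
          simp
      have h3 := intervalIntegral.integral_add_adjacent_intervals
        (χ.continuous.intervalIntegrable (μ := volume) 0 t)
        (χ.continuous.intervalIntegrable (μ := volume) t T)
      rw [h1, h2, add_zero] at h3
      exact h3
  have hts : tsupport η ⊆ Icc a b :=
    closure_minimal (fun t ht => by_contra fun h => ht (hη0 t h)) isClosed_Icc
  refine ⟨⟨η, ?_, isCompact_Icc.of_isClosed_subset (isClosed_tsupport η) hts, fun t ht =>
    ⟨ha.trans_le (hts ht).1, (hts ht).2.trans_lt hb⟩⟩, fun t => (hder t).deriv⟩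
  refine contDiff_infty_iff_deriv.2 ⟨fun t => (hder t).differentiableAt, ?_⟩
  rw [hdη]
  exact χ.contDiff

/-- A function with vanishing weak derivative is constant. -/
theorem ae_eq_const_of_integral_deriv_eq_zero [CompleteSpace X] (hT : 0 < T)
    (hz : LocallyIntegrableOn z (Ioo 0 T))
    (h : ∀ ψ : 𝓓(timeInterval T, ℝ), ∫ t in Ioo 0 T, deriv ψ t • z t = 0) :
    ∃ c, ∀ᵐ t ∂(volume.restrict (Ioo 0 T)), z t = c := by
  obtain ⟨θ, hθ⟩ := exists_testFunction_integral_eq_one hT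
  set c := ∫ t in Ioo 0 T, θ t • z t with hc
  have hconst : LocallyIntegrableOn (fun _ : ℝ => c) (Ioo 0 T) :=
    (integrableOn_const (by simp)).locallyIntegrableOn
  have hint : ∀ ψ : 𝓓(timeInterval T, ℝ), IntegrableOn ψ (Ioo 0 T) := fun ψ =>
    (ψ.continuous.integrable_of_hasCompactSupport ψ.hasCompactSupport).integrableOn
  refine ⟨c, ?_⟩
  have h0 : ∀ᵐ t ∂(volume.restrict (Ioo 0 T)), (z - fun _ : ℝ => c) t = 0 := by
    refine ae_eq_zero_of_testFunction (hz.sub hconst) fun ψ => ?_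
    set m := ∫ t in Ioo 0 T, ψ t with hm
    -- Subtracting `m • θ` makes the integral vanish, so the difference is the derivative of a test
    -- function. This identifies the constant as the `θ`-weighted mean of `z`.
    obtain ⟨η, hη⟩ := exists_deriv_eq_of_integral_eq_zero (ψ - m • θ) (by
      simp only [sub_apply, smul_apply, smul_eq_mul]
      rw [integral_sub (hint ψ) ((hint θ).const_mul m), integral_const_mul, hθ, ← hm]
      ring)
    have h1 := h η
    simp only [hη, sub_apply, smul_apply, smul_eq_mul, sub_smul, mul_smul] at h1
    have h2 : IntegrableOn (fun t => m • θ t • z t) (Ioo 0 T) :=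
      (integrable_testFunction_smul hz θ).smul m
    rw [integral_sub (integrable_testFunction_smul hz ψ) h2, integral_smul, ← hc] at h1
    simp only [Pi.sub_apply, smul_sub]
    rw [integral_sub (integrable_testFunction_smul hz ψ)
      (integrable_testFunction_smul hconst ψ), integral_smul_const, ← hm]
    exact h1
  filter_upwards [h0] with t ht
  exact sub_eq_zero.1 ht

/-- A function with integrable weak derivative is a primitive of it. -/
theorem IsWeakDeriv.exists_ae_eq_primitive [CompleteSpace X] (hT : 0 < T)
    (h : IsWeakDeriv T 1 u v) (hv : IntegrableOn v (Ioo 0 T)) :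
    ∃ c, ∀ᵐ t ∂(volume.restrict (Ioo 0 T)), u t = c + ∫ s in (0 : ℝ)..t, v s := by
  have h' := isWeakDeriv_primitive hT hv 0
  rw [isWeakDeriv_one_iff] at h h'
  obtain ⟨c, hc⟩ := ae_eq_const_of_integral_deriv_eq_zero hT (h.1.sub h'.1) fun ψ => by
    have h1 := integrable_testFunction_smul h.1 (derivTest ψ)
    have h2 := integrable_testFunction_smul h'.1 (derivTest ψ)
    simp_rw [derivTest_apply] at h1 h2
    simp only [Pi.sub_apply, smul_sub]
    rw [integral_sub h1 h2, h.2.2, h'.2.2, sub_self]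
  refine ⟨c, ?_⟩
  filter_upwards [hc] with t ht
  rw [Pi.sub_apply, zero_add] at ht
  rw [← ht, sub_add_cancel]

theorem hasInitialValue_of_ae_eq (hv : IntegrableOn v (Ioo 0 T)) (c : X)
    (h : ∀ᵐ t ∂(volume.restrict (Ioo 0 T)), u t = c + ∫ s in (0 : ℝ)..t, v s) :
    HasInitialValue T u c :=
  ⟨_, continuousOn_const.add (continuousOn_primitive hv), h, by simp⟩

theorem HasInitialValue.eq (hT : 0 < T) (hv : IntegrableOn v (Ioo 0 T)) {c x : X}
    (h : ∀ᵐ t ∂(volume.restrict (Ioo 0 T)), u t = c + ∫ s in (0 : ℝ)..t, v s)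
    (hx : HasInitialValue T u x) : c = x := by
  obtain ⟨g, hg, hug, rfl⟩ := hx
  have h1 : g =ᵐ[volume.restrict (Icc 0 T)] fun t => c + ∫ s in (0 : ℝ)..t, v s := by
    rw [← restrict_Ioo_eq_restrict_Icc]
    filter_upwards [h, hug] with t h1 h2
    rw [← h2, h1]
  have := Measure.eqOn_Icc_of_ae_eq volume hT.ne h1 hg
    (continuousOn_const.add (continuousOn_primitive hv)) (left_mem_Icc.2 hT.le)
  simpa using this.symm

end WeakDeriv

/-! ### Young's convolution inequality -/

section Young

/-- Hölder's inequality with respect to the measure `b dμ`: factor `a b` as `(a^p b)^(1/p) b^(1 -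
1/p)`. -/
theorem lintegral_mul_rpow_le {X : Type*} [MeasurableSpace X] {μ : Measure X} {p : ℝ} (hp : 1 ≤ p)
    {a b : X → ℝ≥0∞} (ha : AEMeasurable a μ) (hb : AEMeasurable b μ) :
    (∫⁻ x, a x * b x ∂μ) ^ p ≤ (∫⁻ x, a x ^ p * b x ∂μ) * (∫⁻ x, b x ∂μ) ^ (p - 1) := by
  have hp0 : 0 < p := one_pos.trans_le hp
  have hp' : 0 ≤ 1 - 1 / p := by
    rw [sub_nonneg, div_le_one hp0]
    exact hp
  have h1 := ENNReal.lintegral_mul_norm_pow_le ((ha.pow_const p).mul hb) hb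
    (p := 1 / p) (q := 1 - 1 / p) (by positivity) hp' (by ring)
  have h2 : ∀ x, ((fun x => a x ^ p) * b) x ^ (1 / p) * b x ^ (1 - 1 / p) = a x * b x := by
    intro x
    rw [Pi.mul_apply, ENNReal.mul_rpow_of_nonneg _ _ (by positivity), ← ENNReal.rpow_mul,
      mul_one_div_cancel hp0.ne', ENNReal.rpow_one, mul_assoc,
      ← ENNReal.rpow_add_of_nonneg _ _ (by positivity) hp', add_sub_cancel, ENNReal.rpow_one]
  simp_rw [h2] at h1
  refine (ENNReal.rpow_le_rpow h1 hp0.le).trans_eq ?_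
  rw [ENNReal.mul_rpow_of_nonneg _ _ hp0.le, ← ENNReal.rpow_mul, ← ENNReal.rpow_mul,
    one_div_mul_cancel hp0.ne', ENNReal.rpow_one, sub_mul, one_div_mul_cancel hp0.ne', one_mul]
  rfl

theorem lintegral_conv_rpow_le_of_measurable {p : ℝ} (hp : 1 ≤ p) {a b : ℝ → ℝ≥0∞}
    (ha : Measurable a) (hb : Measurable b) :
    ∫⁻ t, (∫⁻ τ, a (t - τ) * b τ) ^ p ≤ (∫⁻ t, a t ^ p) * (∫⁻ τ, b τ) ^ p := by
  have hp0 : 0 < p := one_pos.trans_le hp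
  calc ∫⁻ t, (∫⁻ τ, a (t - τ) * b τ) ^ p
      ≤ ∫⁻ t, (∫⁻ τ, a (t - τ) ^ p * b τ) * (∫⁻ τ, b τ) ^ (p - 1) :=
        lintegral_mono fun t => lintegral_mul_rpow_le hp (by fun_prop) (by fun_prop)
    _ = (∫⁻ t, ∫⁻ τ, a (t - τ) ^ p * b τ) * (∫⁻ τ, b τ) ^ (p - 1) := by
        rw [lintegral_mul_const]
        exact Measurable.lintegral_prod_right' (f := fun q : ℝ × ℝ => a (q.1 - q.2) ^ p * b q.2)
          (by fun_prop)
    _ = (∫⁻ τ, ∫⁻ t, a (t - τ) ^ p * b τ) * (∫⁻ τ, b τ) ^ (p - 1) := by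
        rw [lintegral_lintegral_swap]
        exact Measurable.aemeasurable (by fun_prop)
    _ = (∫⁻ τ, (∫⁻ t, a t ^ p) * b τ) * (∫⁻ τ, b τ) ^ (p - 1) := by
        congr 2
        ext τ
        rw [lintegral_mul_const _ (by fun_prop), lintegral_sub_right_eq_self (fun t => a t ^ p)]
    _ = _ := by
        rw [lintegral_const_mul _ hb, mul_assoc]
        congr 1
        nth_rewrite 1 [← ENNReal.rpow_one (∫⁻ τ, b τ)]
        rw [← ENNReal.rpow_add_of_nonneg _ _ zero_le_one (by linarith), add_sub_cancel]

/-- Young's inequality. -/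
theorem lintegral_conv_rpow_le {p : ℝ} (hp : 1 ≤ p) {a b : ℝ → ℝ≥0∞}
    (ha : AEMeasurable a) (hb : AEMeasurable b) :
    ∫⁻ t, (∫⁻ τ, a (t - τ) * b τ) ^ p ≤ (∫⁻ t, a t ^ p) * (∫⁻ τ, b τ) ^ p := by
  have h := lintegral_conv_rpow_le_of_measurable hp ha.measurable_mk hb.measurable_mk
  have ha1 : ∫⁻ t, a t ^ p = ∫⁻ t, ha.mk a t ^ p :=
    lintegral_congr_ae (by filter_upwards [ha.ae_eq_mk] with t ht; rw [ht])
  have hb1 : ∫⁻ t, b t = ∫⁻ t, hb.mk b t := lintegral_congr_ae hb.ae_eq_mk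
  have hab : ∀ t, ∫⁻ τ, a (t - τ) * b τ = ∫⁻ τ, ha.mk a (t - τ) * hb.mk b τ := by
    intro t
    refine lintegral_congr_ae ?_
    have h1 := (quasiMeasurePreserving_sub_left (volume : Measure ℝ) t).ae_eq_comp ha.ae_eq_mk
    filter_upwards [h1, hb.ae_eq_mk] with τ h1 h2
    simp only [Function.comp_apply] at h1
    rw [h1, h2]
  rw [ha1, hb1]
  simp_rw [hab]
  exact h

theorem eLpNorm_ofReal_rpow {X E : Type*} [MeasurableSpace X] [NormedAddCommGroup E]
    {μ : Measure X} {p : ℝ} (hp : 0 < p) (f : X → E) :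
    eLpNorm f (ENNReal.ofReal p) μ = (∫⁻ x, ‖f x‖ₑ ^ p ∂μ) ^ (1 / p) := by
  rw [eLpNorm_eq_lintegral_rpow_enorm_toReal (by simpa using hp) ENNReal.ofReal_ne_top,
    ENNReal.toReal_ofReal hp.le]

variable {E : Type*} [NormedAddCommGroup E] [NormedSpace ℝ E] {T p : ℝ} {f : ℝ → ℝ} {y : ℝ → E}

theorem lintegral_indicator_enorm_rpow {F : Type*} [NormedAddCommGroup F] (hp : 0 < p) (g : ℝ → F) :
    ∫⁻ t, ‖(Ioo 0 T).indicator g t‖ₑ ^ p = ∫⁻ t in Ioo 0 T, ‖g t‖ₑ ^ p := by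
  rw [← lintegral_indicator measurableSet_Ioo]
  congr 1
  ext t
  by_cases ht : t ∈ Ioo 0 T
  · simp [ht]
  · simp [ht, hp]

theorem eLpNorm_vconv_le_of_conv {A B : ℝ≥0∞} (hp : 1 ≤ p)
    (h : ∫⁻ t, (∫⁻ τ, ‖(Ioo 0 T).indicator f τ‖ₑ * ‖(Ioo 0 T).indicator y (t - τ)‖ₑ) ^ p ≤
      A ^ p * B ^ p) :
    eLpNorm (vconv f y) (ENNReal.ofReal p) (volume.restrict (Ioo 0 T)) ≤ A * B := by
  have hp0 : 0 < p := one_pos.trans_le hp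
  rw [eLpNorm_ofReal_rpow hp0]
  have h1 : ∫⁻ t in Ioo 0 T, ‖vconv f y t‖ₑ ^ p ≤ A ^ p * B ^ p := by
    refine le_trans ?_ ((setLIntegral_le_lintegral (Ioo 0 T) _).trans h)
    refine setLIntegral_mono' measurableSet_Ioo fun t ht => ENNReal.rpow_le_rpow ?_ hp0.le
    rw [vconv_eq_convolution ht.1.le ht.2.le, convolution]
    refine (enorm_integral_le_lintegral_enorm _).trans_eq ?_
    simp [enorm_smul]
  refine (ENNReal.rpow_le_rpow h1 (by positivity)).trans_eq ?_
  rw [← ENNReal.mul_rpow_of_nonneg _ _ hp0.le, ← ENNReal.rpow_mul, mul_one_div_cancel hp0.ne',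
    ENNReal.rpow_one]

theorem aemeasurable_enorm_indicator {F : Type*} [NormedAddCommGroup F] {g : ℝ → F}
    (hg : AEStronglyMeasurable g (volume.restrict (Ioo 0 T))) :
    AEMeasurable fun t => ‖(Ioo 0 T).indicator g t‖ₑ :=
  ((aestronglyMeasurable_indicator_iff measurableSet_Ioo).2 hg).enorm

theorem eLpNorm_vconv_le_mul_eLpNorm (hp : 1 ≤ p)
    (hf : AEStronglyMeasurable f (volume.restrict (Ioo 0 T)))
    (hy : AEStronglyMeasurable y (volume.restrict (Ioo 0 T))) :
    eLpNorm (vconv f y) (ENNReal.ofReal p) (volume.restrict (Ioo 0 T)) ≤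
      eLpNorm y (ENNReal.ofReal p) (volume.restrict (Ioo 0 T)) * ∫⁻ t in Ioo 0 T, ‖f t‖ₑ := by
  have hp0 : 0 < p := one_pos.trans_le hp
  refine eLpNorm_vconv_le_of_conv hp ?_
  have h := lintegral_conv_rpow_le hp (aemeasurable_enorm_indicator hy)
    (aemeasurable_enorm_indicator hf)
  rw [lintegral_indicator_enorm_rpow hp0] at h
  have h1 := lintegral_indicator_enorm_rpow (T := T) one_pos f
  simp only [ENNReal.rpow_one] at h1
  rw [h1] at h
  rw [eLpNorm_ofReal_rpow hp0, ← ENNReal.rpow_mul, one_div_mul_cancel hp0.ne', ENNReal.rpow_one]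
  simpa only [mul_comm] using h

/-- The version in which the kernel carries the exponent `p`, so that data merely integrable in time
suffice. -/
theorem eLpNorm_vconv_le_eLpNorm_mul (hp : 1 ≤ p)
    (hf : AEStronglyMeasurable f (volume.restrict (Ioo 0 T)))
    (hy : AEStronglyMeasurable y (volume.restrict (Ioo 0 T))) :
    eLpNorm (vconv f y) (ENNReal.ofReal p) (volume.restrict (Ioo 0 T)) ≤
      eLpNorm f (ENNReal.ofReal p) (volume.restrict (Ioo 0 T)) * ∫⁻ t in Ioo 0 T, ‖y t‖ₑ := by
  have hp0 : 0 < p := one_pos.trans_le hp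
  refine eLpNorm_vconv_le_of_conv hp ?_
  have h := lintegral_conv_rpow_le hp (aemeasurable_enorm_indicator hf)
    (aemeasurable_enorm_indicator hy)
  rw [lintegral_indicator_enorm_rpow hp0] at h
  have h1 := lintegral_indicator_enorm_rpow (T := T) one_pos y
  simp only [ENNReal.rpow_one] at h1
  rw [h1] at h
  rw [eLpNorm_ofReal_rpow hp0, ← ENNReal.rpow_mul, one_div_mul_cancel hp0.ne', ENNReal.rpow_one]
  refine le_trans (le_of_eq ?_) h
  congr 1
  ext t
  rw [← lintegral_sub_left_eq_self _ t]
  simp only [sub_sub_cancel]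

end Young

/-! ### Diagonal convolution operators in a Hilbert basis -/

section Diagonal

variable {H : Type*} [NormedAddCommGroup H] [InnerProductSpace ℝ H]

theorem norm_sum_smul_le {b : ℕ → H} (hb : Orthonormal ℝ b) {γ : ℝ} (hγ : 0 ≤ γ)
    {a : ℕ → ℝ} (z : H) (s : Finset ℕ) (h : ∀ i ∈ s, |a i| ≤ γ * |inner ℝ (b i) z|) :
    ‖∑ i ∈ s, a i • b i‖ ≤ γ * ‖z‖ := by
  refine (sq_le_sq₀ (norm_nonneg _) (by positivity)).1 ?_
  calc ‖∑ i ∈ s, a i • b i‖ ^ 2 = ∑ i ∈ s, a i ^ 2 := by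
        rw [← real_inner_self_eq_norm_sq, hb.inner_sum]
        simp [sq]
    _ ≤ ∑ i ∈ s, γ ^ 2 * ‖inner ℝ (b i) z‖ ^ 2 := by
        refine Finset.sum_le_sum fun i hi => ?_
        rw [← mul_pow, ← sq_abs]
        exact pow_le_pow_left₀ (abs_nonneg _) (h i hi) 2
    _ ≤ (γ * ‖z‖) ^ 2 := by
        rw [← Finset.mul_sum, mul_pow]
        exact mul_le_mul_of_nonneg_left (hb.sum_inner_products_le z) (sq_nonneg _)

variable [CompleteSpace H] {T : ℝ} {g : ℝ → ℝ} {ρ : ℕ → ℝ → ℝ} {y : ℝ → H}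

/-- Applying scalar convolution kernels in each coordinate. -/
theorem exists_diagonal_convolution (b : HilbertBasis ℕ ℝ H)
    (hg : IntegrableOn g (Ioo 0 T)) (hρ : ∀ i, IntegrableOn (ρ i) (Ioo 0 T))
    (hρg : ∀ i, ∀ t ∈ Ioo 0 T, |ρ i t| ≤ g t) (x : H) (hy : IntegrableOn y (Ioo 0 T)) :
    ∃ w : ℝ → H, AEStronglyMeasurable w (volume.restrict (Ioo 0 T)) ∧
      (∀ᵐ t ∂(volume.restrict (Ioo 0 T)), ∀ i, inner ℝ (b i) (w t) =
        ρ i t * inner ℝ (b i) x + vconv (ρ i) (fun τ => inner ℝ (b i) (y τ)) t) ∧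
      ∀ᵐ t ∂(volume.restrict (Ioo 0 T)), ‖w t‖ ≤ g t * ‖x‖ + vconv g (fun τ => ‖y τ‖) t := by
  classical
  have hyi : ∀ i, IntegrableOn (fun τ => inner ℝ (b i) (y τ)) (Ioo 0 T) := fun i =>
    Integrable.const_inner (b i) hy
  set c : ℝ → ℕ → ℝ := fun t i =>
    ρ i t * inner ℝ (b i) x + vconv (ρ i) (fun τ => inner ℝ (b i) (y τ)) t with hc
  -- Bessel's inequality under the integral sign bounds all finite partial sums at once, which
  -- yields both the square summability of the coefficients and the norm bound for the sum.
  have hbound : ∀ᵐ t ∂(volume.restrict (Ioo 0 T)), ∀ s : Finset ℕ,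
      ‖∑ i ∈ s, c t i • b i‖ ≤ g t * ‖x‖ + vconv g (fun τ => ‖y τ‖) t := by
    have h1 := ae_all_iff.2 fun i => ae_intervalIntegrable_vconv (hρ i) (hyi i)
    filter_upwards [h1, ae_intervalIntegrable_vconv hg hy.norm, ae_restrict_mem measurableSet_Ioo]
      with t h1 h2 ht s
    have h3 : ∑ i ∈ s, c t i • b i = ∑ i ∈ s, (ρ i t * inner ℝ (b i) x) • b i +
        ∫ τ in (0 : ℝ)..t, ∑ i ∈ s, (ρ i (t - τ) * inner ℝ (b i) (y τ)) • b i := by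
      have h4 : ∀ i, IntervalIntegrable
          (fun τ => (ρ i (t - τ) * inner ℝ (b i) (y τ)) • b i) volume 0 t := fun i =>
        ⟨Integrable.smul_const (h1 i).1 (b i), Integrable.smul_const (h1 i).2 (b i)⟩
      rw [intervalIntegral.integral_finsetSum fun i _ => h4 i,
        ← Finset.sum_add_distrib]
      refine Finset.sum_congr rfl fun i _ => ?_
      rw [intervalIntegral.integral_smul_const, hc, add_smul]
      rfl
    rw [h3]
    refine (norm_add_le _ _).trans (add_le_add ?_ ?_)
    · refine norm_sum_smul_le b.orthonormal ((abs_nonneg _).trans (hρg 0 t ht)) x s fun i _ => ?_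
      rw [abs_mul]
      exact mul_le_mul_of_nonneg_right (hρg i t ht) (abs_nonneg _)
    · refine intervalIntegral.norm_integral_le_of_norm_le ht.1.le ?_ h2
      filter_upwards [Measure.ae_ne volume t] with τ hne hτ
      have hτ' : t - τ ∈ Ioo 0 T :=
        ⟨sub_pos.2 (lt_of_le_of_ne hτ.2 hne), by linarith [hτ.1, ht.2]⟩
      refine norm_sum_smul_le b.orthonormal ((abs_nonneg _).trans (hρg 0 _ hτ')) (y τ) s
        fun i _ => ?_
      rw [abs_mul]
      exact mul_le_mul_of_nonneg_right (hρg i _ hτ') (abs_nonneg _)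
  -- The value `0` is taken only on the null set of times at which the coefficients may fail to be
  -- square summable.
  let w : ℝ → H := fun t =>
    if h : Memℓp (c t) 2 then b.repr.symm (⟨c t, h⟩ : lp (fun _ : ℕ => ℝ) 2) else 0
  have hw : ∀ᵐ t ∂(volume.restrict (Ioo 0 T)), HasSum (fun i => c t i • b i) (w t) ∧
      ∀ i, inner ℝ (b i) (w t) = c t i := by
    filter_upwards [hbound] with t ht
    have hmem : Memℓp (c t) 2 := by
      refine memℓp_gen' (C := (g t * ‖x‖ + vconv g (fun τ => ‖y τ‖) t) ^ 2) fun s => ?_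
      have h1 := pow_le_pow_left₀ (norm_nonneg _) (ht s) 2
      rw [← real_inner_self_eq_norm_sq, b.orthonormal.inner_sum] at h1
      simpa [sq] using h1
    have hwt : w t = b.repr.symm (⟨c t, hmem⟩ : lp (fun _ : ℕ => ℝ) 2) := dif_pos hmem
    rw [hwt]
    refine ⟨b.hasSum_repr_symm _, fun i => ?_⟩
    rw [← b.repr_apply_apply, LinearIsometryEquiv.apply_symm_apply]
  refine ⟨w, ?_, hw.mono fun t ht => ht.2, ?_⟩
  · refine aestronglyMeasurable_of_tendsto_ae atTop
      (f := fun n t => ∑ i ∈ Finset.range n, c t i • b i) (fun n => ?_)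
      (hw.mono fun t ht => ht.1.tendsto_sum_nat)
    refine Finset.aestronglyMeasurable_fun_sum _ fun i _ => ?_
    refine AEStronglyMeasurable.smul_const ?_ _
    exact ((hρ i).aestronglyMeasurable.mul_const _).add
      (integrableOn_vconv (hρ i) (hyi i)).aestronglyMeasurable
  · filter_upwards [hw, hbound] with t h1 h2
    exact le_of_tendsto h1.1.tendsto_sum_nat.norm (Eventually.of_forall fun n => h2 _)

end Diagonal

/-! ### Scalar equations solved by a resolvent kernel -/

section ScalarEquation

variable {T μ : ℝ} {k ρ y w : ℝ → ℝ}

theorem integrableOn_one (T : ℝ) : IntegrableOn (fun _ : ℝ => (1 : ℝ)) (Ioo 0 T) := by simp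

theorem integrableOn_id (T : ℝ) : IntegrableOn (fun r : ℝ => r) (Ioo 0 T) :=
  (continuous_id.integrableOn_Icc).mono_set Ioo_subset_Icc_self

theorem ae_vconv_representation (hk : IntegrableOn k (Ioo 0 T)) (hρ : IntegrableOn ρ (Ioo 0 T))
    (hy : IntegrableOn y (Ioo 0 T)) (x : ℝ)
    (hw : ∀ᵐ t ∂(volume.restrict (Ioo 0 T)), w t = ρ t * x + vconv ρ y t) :
    ∀ᵐ t ∂(volume.restrict (Ioo 0 T)),
      vconv k w t = vconv k ρ t * x + vconv (vconv k ρ) y t := by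
  filter_upwards [ae_vconv_assoc hk hρ hy, ae_intervalIntegrable_vconv hk (hρ.mul_const x),
    ae_intervalIntegrable_vconv hk (integrableOn_vconv hρ hy), ae_restrict_mem measurableSet_Ioo]
    with t h1 h2 h3 ht
  rw [vconv_congr_right ht k hw, vconv_add_right h2 h3, vconv_mul_const_right, h1]

/-- The scalar equation solved by means of its resolvent kernel. -/
theorem ae_vconv_add_eq_of_resolvent (hk : IntegrableOn k (Ioo 0 T)) (hρ : IntegrableOn ρ (Ioo 0 T))
    (hres : ∀ᵐ t ∂(volume.restrict (Ioo 0 T)), vconv k ρ t + μ * vconv (fun r => r) ρ t = 1)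
    (hy : IntegrableOn y (Ioo 0 T)) (x : ℝ)
    (hw : ∀ᵐ t ∂(volume.restrict (Ioo 0 T)), w t = ρ t * x + vconv ρ y t) :
    ∀ᵐ t ∂(volume.restrict (Ioo 0 T)),
      vconv k w t + μ * vconv (fun r => r) w t = x + ∫ τ in (0 : ℝ)..t, y τ := by
  have hid := integrableOn_id T
  have hi := integrableOn_vconv hid hρ
  filter_upwards [ae_vconv_representation hk hρ hy x hw, ae_vconv_representation hid hρ hy x hw,
    hres, ae_intervalIntegrable_vconv (integrableOn_vconv hk hρ) hy,
    ae_intervalIntegrable_vconv (hi.const_mul μ) hy, ae_restrict_mem measurableSet_Ioo]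
    with t h1 h2 h3 h4 h5 ht
  have h6 := vconv_add_left (g := fun r => μ * vconv (fun r => r) ρ r) h4 h5
  rw [vconv_congr_left ht y hres, vconv_one_left, vconv_const_mul_left, smul_eq_mul] at h6
  rw [h1, h2, h6]
  linear_combination x * h3

theorem ae_vconv_id {E : Type*} [NormedAddCommGroup E] [NormedSpace ℝ E] [CompleteSpace E]
    {w : ℝ → E} (hw : IntegrableOn w (Ioo 0 T)) :
    ∀ᵐ t ∂(volume.restrict (Ioo 0 T)),
      vconv (fun r => r) w t = ∫ s in (0 : ℝ)..t, ∫ r in (0 : ℝ)..s, w r := by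
  filter_upwards [ae_vconv_assoc (integrableOn_one T) (integrableOn_one T) hw] with t ht
  have h1 : vconv (fun _ => 1) (fun _ => (1 : ℝ)) = fun r => r := funext vconv_one_one
  have h2 : vconv (fun _ => 1) w = fun s => ∫ r in (0 : ℝ)..s, w r := funext (vconv_one_left w)
  rw [h1, h2, vconv_one_left] at ht
  exact ht

/-- Convolving the homogeneous equation with `ρ` and commuting the factors turns its left side into
`1 * y`. So the primitive of `y` vanishes, and with it the double primitive `t * y`. -/
theorem ae_vconv_id_eq_zero (hk : IntegrableOn k (Ioo 0 T)) (hρ : IntegrableOn ρ (Ioo 0 T))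
    (hres : ∀ᵐ t ∂(volume.restrict (Ioo 0 T)), vconv k ρ t + μ * vconv (fun r => r) ρ t = 1)
    (hy : IntegrableOn y (Ioo 0 T))
    (h0 : ∀ᵐ t ∂(volume.restrict (Ioo 0 T)), vconv k y t + μ * vconv (fun r => r) y t = 0) :
    ∀ᵐ t ∂(volume.restrict (Ioo 0 T)), vconv (fun r => r) y t = 0 := by
  have hid := integrableOn_id T
  have hprim : ∀ᵐ t ∂(volume.restrict (Ioo 0 T)), ∫ s in (0 : ℝ)..t, y s = 0 := by
    have hky := integrableOn_vconv hk hy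
    have hiy := integrableOn_vconv hid hy
    filter_upwards [ae_vconv_assoc hρ hk hy, ae_vconv_assoc hρ hid hy,
      ae_intervalIntegrable_vconv (integrableOn_vconv hk hρ) hy,
      ae_intervalIntegrable_vconv ((integrableOn_vconv hid hρ).const_mul μ) hy,
      ae_intervalIntegrable_vconv hρ hky,
      ae_intervalIntegrable_vconv hρ (hiy.mul_const μ), ae_restrict_mem measurableSet_Ioo]
      with t h1 h2 h3 h4 h5 h6 ht
    have h7 := vconv_add_left (g := fun r => μ * vconv (fun r => r) ρ r) h3 h4
    rw [vconv_congr_left ht y hres, vconv_one_left, vconv_const_mul_left, smul_eq_mul] at h7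
    have h8 := vconv_add_right (z := fun r => vconv (fun r => r) y r * μ) h5 h6
    rw [vconv_mul_const_right, vconv_congr_right (z := fun _ => 0) ht ρ
      (h0.mono fun s hs => by rw [← hs]; ring)] at h8
    have h9 : vconv ρ (fun _ => (0 : ℝ)) t = 0 := by simp [vconv]
    have h10 : ∀ g, vconv ρ g = vconv g ρ := fun g => funext (vconv_comm ρ g)
    rw [h10 k] at h1
    rw [h10 (fun r => r)] at h2
    rw [h7, h1, h2, mul_comm μ, ← h8, h9]
  filter_upwards [ae_vconv_id hy, ae_restrict_mem measurableSet_Ioo] with t h1 ht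
  rw [h1, ← vconv_one_left, vconv_congr_right (z := fun _ => 0) ht _ hprim]
  simp [vconv]

end ScalarEquation

/-! ### Existence and uniqueness for the diagonalized evolution equation -/

section HilbertEquation

variable {H : Type*} [NormedAddCommGroup H] [InnerProductSpace ℝ H]

theorem HilbertBasis.eq_of_inner_eq (b : HilbertBasis ℕ ℝ H) {x y : H}
    (h : ∀ i, inner ℝ (b i) x = inner ℝ (b i) y) : x = y := by
  refine b.repr.injective (lp.ext (funext fun i => ?_))
  rw [b.repr_apply_apply, b.repr_apply_apply, h i]

variable [CompleteSpace H] {T κ : ℝ} {k : ℝ → ℝ} {lam : ℕ → ℝ} {ρ : ℕ → ℝ → ℝ}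

theorem inner_intervalIntegral (e : H) {f : ℝ → H} {a c : ℝ}
    (hf : IntervalIntegrable f volume a c) :
    inner ℝ e (∫ t in a..c, f t) = ∫ t in a..c, inner ℝ e (f t) :=
  ((innerSL ℝ e).intervalIntegral_comp_comm hf).symm

theorem inner_vconv (e : H) {f : ℝ → ℝ} {w : ℝ → H} {t : ℝ}
    (h : IntervalIntegrable (fun τ => f (t - τ) • w τ) volume 0 t) :
    inner ℝ e (vconv f w t) = vconv f (fun τ => inner ℝ e (w τ)) t := by
  rw [vconv, inner_intervalIntegral e h]
  simp only [real_inner_smul_right, vconv, smul_eq_mul]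

theorem intervalIntegrable_of_integrableOn_Ioo {E : Type*} [NormedAddCommGroup E] {f : ℝ → E}
    (hf : IntegrableOn f (Ioo 0 T)) {t : ℝ} (ht : t ∈ Ioo 0 T) :
    IntervalIntegrable f volume 0 t := by
  rw [intervalIntegrable_iff_integrableOn_Ioo_of_le ht.1.le]
  exact hf.mono_set (Ioo_subset_Ioo_right ht.2.le)

/-- The function with second derivative `w` and initial data `a₀`, `a₁`. -/
noncomputable def doublePrimitive (a₀ a₁ : H) (w : ℝ → H) (t : ℝ) : H :=
  a₀ + ∫ s in (0 : ℝ)..t, (a₁ + ∫ r in (0 : ℝ)..s, w r)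

theorem integrableOn_primitive {E : Type*} [NormedAddCommGroup E] [NormedSpace ℝ E] {w : ℝ → E}
    (hw : IntegrableOn w (Ioo 0 T)) (a : E) :
    IntegrableOn (fun t => a + ∫ s in (0 : ℝ)..t, w s) (Ioo 0 T) :=
  ((continuousOn_const.add (continuousOn_primitive hw)).integrableOn_Icc).mono_set
    Ioo_subset_Icc_self

theorem ae_doublePrimitive_eq (a₀ a₁ : H) {w : ℝ → H} (hw : IntegrableOn w (Ioo 0 T)) :
    ∀ᵐ t ∂(volume.restrict (Ioo 0 T)),
      doublePrimitive a₀ a₁ w t = a₀ + t • a₁ + vconv (fun r => r) w t := by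
  filter_upwards [ae_vconv_id hw, ae_restrict_mem measurableSet_Ioo] with t h1 ht
  have h2 : IntegrableOn (fun s => ∫ r in (0 : ℝ)..s, w r) (Ioo 0 T) := by
    simpa using integrableOn_primitive hw 0
  rw [doublePrimitive, h1, intervalIntegral.integral_add intervalIntegrable_const
    (intervalIntegrable_of_integrableOn_Ioo h2 ht)]
  simp [add_assoc]

theorem ae_inner_doublePrimitive (b : HilbertBasis ℕ ℝ H) (a₀ a₁ : H) {w : ℝ → H}
    (hw : IntegrableOn w (Ioo 0 T)) :
    ∀ᵐ t ∂(volume.restrict (Ioo 0 T)), ∀ i, inner ℝ (b i) (doublePrimitive a₀ a₁ w t) =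
      inner ℝ (b i) a₀ + t * inner ℝ (b i) a₁ +
        vconv (fun r => r) (fun τ => inner ℝ (b i) (w τ)) t := by
  filter_upwards [ae_doublePrimitive_eq a₀ a₁ hw, ae_intervalIntegrable_vconv (integrableOn_id T) hw]
    with t h1 h2 i
  rw [h1, inner_add_right, inner_add_right, real_inner_smul_right, inner_vconv _ h2]

/-- Existence for the diagonalized evolution equation. -/
theorem exists_diagonal_solution (b : HilbertBasis ℕ ℝ H) {g : ℝ → ℝ}
    (hg : IntegrableOn g (Ioo 0 T)) (hk : IntegrableOn k (Ioo 0 T))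
    (hρ : ∀ i, IntegrableOn (ρ i) (Ioo 0 T))
    (hρg : ∀ i, ∀ t ∈ Ioo 0 T, |ρ i t| ≤ g t)
    (hres : ∀ i, ∀ᵐ t ∂(volume.restrict (Ioo 0 T)),
      vconv k (ρ i) t + κ * lam i * vconv (fun r => r) (ρ i) t = 1)
    {a₀ a₁ l₀ l₁ F₀ : H} {f' : ℝ → H} (hf' : IntegrableOn f' (Ioo 0 T))
    (hl₀ : ∀ i, inner ℝ (b i) l₀ = lam i * inner ℝ (b i) a₀)
    (hl₁ : ∀ i, inner ℝ (b i) l₁ = lam i * inner ℝ (b i) a₁) :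
    ∃ w : ℝ → H, IntegrableOn w (Ioo 0 T) ∧
      (∀ᵐ t ∂(volume.restrict (Ioo 0 T)), ‖w t‖ ≤
        g t * ‖F₀ - κ • l₀‖ + vconv g (fun τ => ‖f' τ - κ • l₁‖) t) ∧
      ∀ᵐ t ∂(volume.restrict (Ioo 0 T)), ∀ i, inner ℝ (b i) (vconv k w t) +
        κ * lam i * inner ℝ (b i) (doublePrimitive a₀ a₁ w t) =
          inner ℝ (b i) (F₀ + ∫ s in (0 : ℝ)..t, f' s) := by
  have hy : IntegrableOn (fun τ => f' τ - κ • l₁) (Ioo 0 T) :=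
    hf'.sub (integrableOn_const (by simp))
  -- The contributions of `a₀` and `t a₁` go to the right side, where they become the constant `F₀ -
  -- κ l₀` and the primitive of `f' - κ l₁`.
  obtain ⟨w, hwm, hwi, hwb⟩ := exists_diagonal_convolution b hg hρ hρg (F₀ - κ • l₀) hy
  have hw : IntegrableOn w (Ioo 0 T) :=
    Integrable.mono' ((hg.mul_const _).add (integrableOn_vconv hg hy.norm)) hwm hwb
  refine ⟨w, hw, hwb, ?_⟩
  have hyi : ∀ i, IntegrableOn (fun τ => inner ℝ (b i) (f' τ - κ • l₁)) (Ioo 0 T) := fun i =>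
    Integrable.const_inner (b i) hy
  have h1 := ae_all_iff.2 fun i => ae_vconv_add_eq_of_resolvent hk (hρ i) (hres i) (hyi i)
    (inner ℝ (b i) (F₀ - κ • l₀)) (hwi.mono fun t ht => ht i)
  filter_upwards [h1, ae_inner_doublePrimitive b a₀ a₁ hw, ae_intervalIntegrable_vconv hk hw,
    ae_restrict_mem measurableSet_Ioo] with t h1 h2 h3 ht i
  have hfi := intervalIntegrable_of_integrableOn_Ioo hf' ht
  have h4 : ∫ τ in (0 : ℝ)..t, inner ℝ (b i) (f' τ - κ • l₁) =
      inner ℝ (b i) (∫ s in (0 : ℝ)..t, f' s) - t * (κ * (lam i * inner ℝ (b i) a₁)) := by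
    rw [← inner_intervalIntegral _ (hfi.sub intervalIntegrable_const),
      intervalIntegral.integral_sub hfi intervalIntegrable_const, inner_sub_right,
      intervalIntegral.integral_const, real_inner_smul_right, real_inner_smul_right, hl₁, sub_zero]
  have h5 := h1 i
  rw [h4, inner_sub_right, real_inner_smul_right, hl₀] at h5
  rw [inner_vconv _ h3, h2 i, inner_add_right]
  linear_combination h5

/-- Uniqueness for the diagonalized evolution equation. -/
theorem ae_doublePrimitive_eq_of_equation (b : HilbertBasis ℕ ℝ H) (hk : IntegrableOn k (Ioo 0 T))
    (hρ : ∀ i, IntegrableOn (ρ i) (Ioo 0 T))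
    (hres : ∀ i, ∀ᵐ t ∂(volume.restrict (Ioo 0 T)),
      vconv k (ρ i) t + κ * lam i * vconv (fun r => r) (ρ i) t = 1)
    {a₀ a₁ : H} {F w z : ℝ → H} (hw : IntegrableOn w (Ioo 0 T)) (hz : IntegrableOn z (Ioo 0 T))
    (hweq : ∀ᵐ t ∂(volume.restrict (Ioo 0 T)), ∀ i, inner ℝ (b i) (vconv k w t) +
        κ * lam i * inner ℝ (b i) (doublePrimitive a₀ a₁ w t) = inner ℝ (b i) (F t))
    (hzeq : ∀ᵐ t ∂(volume.restrict (Ioo 0 T)), ∀ i, inner ℝ (b i) (vconv k z t) +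
        κ * lam i * inner ℝ (b i) (doublePrimitive a₀ a₁ z t) = inner ℝ (b i) (F t)) :
    ∀ᵐ t ∂(volume.restrict (Ioo 0 T)),
      doublePrimitive a₀ a₁ w t = doublePrimitive a₀ a₁ z t := by
  have hid := integrableOn_id T
  have hwi : ∀ i, IntegrableOn (fun τ => inner ℝ (b i) (w τ)) (Ioo 0 T) := fun i =>
    Integrable.const_inner (b i) hw
  have hzi : ∀ i, IntegrableOn (fun τ => inner ℝ (b i) (z τ)) (Ioo 0 T) := fun i =>
    Integrable.const_inner (b i) hz
  have hsub : ∀ (f : ℝ → ℝ), IntegrableOn f (Ioo 0 T) → ∀ i, ∀ᵐ t ∂(volume.restrict (Ioo 0 T)),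
      vconv f (fun τ => inner ℝ (b i) (w τ) - inner ℝ (b i) (z τ)) t =
        vconv f (fun τ => inner ℝ (b i) (w τ)) t - vconv f (fun τ => inner ℝ (b i) (z τ)) t := by
    intro f hf i
    filter_upwards [ae_intervalIntegrable_vconv hf (hwi i), ae_intervalIntegrable_vconv hf (hzi i)]
      with t h1 h2
    exact vconv_sub_right h1 h2
  have hkey : ∀ i, ∀ᵐ t ∂(volume.restrict (Ioo 0 T)),
      vconv (fun r => r) (fun τ => inner ℝ (b i) (w τ) - inner ℝ (b i) (z τ)) t = 0 := by
    intro i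
    refine ae_vconv_id_eq_zero hk (hρ i) (hres i) ((hwi i).sub (hzi i)) ?_
    filter_upwards [hweq, hzeq, ae_inner_doublePrimitive b a₀ a₁ hw,
      ae_inner_doublePrimitive b a₀ a₁ hz, ae_intervalIntegrable_vconv hk hw,
      ae_intervalIntegrable_vconv hk hz, hsub k hk i, hsub _ hid i] with t h1 h2 h3 h4 h5 h6 h7 h8
    have h9 := h1 i
    have h10 := h2 i
    rw [inner_vconv _ h5, h3 i] at h9
    rw [inner_vconv _ h6, h4 i] at h10
    rw [h7, h8]
    linear_combination h9 - h10
  filter_upwards [ae_all_iff.2 hkey, ae_all_iff.2 fun i => hsub _ hid i,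
    ae_inner_doublePrimitive b a₀ a₁ hw, ae_inner_doublePrimitive b a₀ a₁ hz] with t h1 h2 h3 h4
  refine HilbertBasis.eq_of_inner_eq b fun i => ?_
  have h5 := h1 i
  rw [h2 i] at h5
  rw [h3 i, h4 i]
  linear_combination h5

end HilbertEquation

/-! ### The `Ȟ²` norm and the eigenbasis -/

section SpectralNorm

variable {d : ℕ} {Ω : Opens (EuclideanSpace ℝ (Fin d))} {lam : ℕ → ℝ} {φ : ℕ → L2 Ω}

/-- The Hilbert basis of eigenfunctions. -/
noncomputable def IsEigensystem.basis (hφ : IsEigensystem Ω lam φ)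
    (hΩ : Bornology.IsBounded (Ω : Set (EuclideanSpace ℝ (Fin d)))) : HilbertBasis ℕ ℝ (L2 Ω) :=
  HilbertBasis.mk hφ.orthonormal (hφ.topologicalClosure_span_eq_top hΩ).ge

@[simp] theorem IsEigensystem.basis_apply (hφ : IsEigensystem Ω lam φ)
    (hΩ : Bornology.IsBounded (Ω : Set (EuclideanSpace ℝ (Fin d)))) (i : ℕ) :
    hφ.basis hΩ i = φ i := by
  rw [IsEigensystem.basis, HilbertBasis.coe_mk]

theorem hasSum_sq_inner {H : Type*} [NormedAddCommGroup H] [InnerProductSpace ℝ H]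
    (b : HilbertBasis ℕ ℝ H) (x : H) : HasSum (fun i => inner ℝ (b i) x ^ 2) (‖x‖ ^ 2) := by
  have h := b.hasSum_inner_mul_inner x x
  rw [real_inner_self_eq_norm_sq] at h
  refine h.congr_fun fun i => ?_
  rw [real_inner_comm, sq]

/-- Parseval's identity. Only squares of coefficients enter, so `h` may be the Laplacian of `q` or
its negative. -/
theorem IsEigensystem.hNorm_two_eq (hφ : IsEigensystem Ω lam φ)
    (hΩ : Bornology.IsBounded (Ω : Set (EuclideanSpace ℝ (Fin d)))) {q h : L2 Ω}
    (hq : ∀ i, inner ℝ (φ i) h ^ 2 = (lam i * inner ℝ (φ i) q) ^ 2) :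
    hNorm lam φ 2 q = ‖h‖ₑ := by
  have hs := hasSum_sq_inner (hφ.basis hΩ) h
  simp only [IsEigensystem.basis_apply] at hs
  have h1 : ∀ i, lam i ^ (2 : ℝ) * inner ℝ q (φ i) ^ 2 = inner ℝ (φ i) h ^ 2 := fun i => by
    rw [hq i, mul_pow, Real.rpow_two, real_inner_comm]
  rw [hNorm]
  simp_rw [h1]
  rw [← ENNReal.ofReal_tsum_of_nonneg (fun i => sq_nonneg _) hs.summable, hs.tsum_eq,
    ENNReal.ofReal_rpow_of_nonneg (sq_nonneg _) (by norm_num), ← Real.sqrt_eq_rpow,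
    Real.sqrt_sq (norm_nonneg _), ofReal_norm]

theorem IsEigensystem.exists_of_hNorm_lt_top (hφ : IsEigensystem Ω lam φ)
    (hΩ : Bornology.IsBounded (Ω : Set (EuclideanSpace ℝ (Fin d)))) {q : L2 Ω}
    (hq : hNorm lam φ 2 q < ∞) :
    ∃ h : L2 Ω, (∀ i, inner ℝ (φ i) h = lam i * inner ℝ (φ i) q) ∧ hNorm lam φ 2 q = ‖h‖ₑ := by
  have h1 : ∑' i, ENNReal.ofReal (lam i ^ (2 : ℝ) * inner ℝ q (φ i) ^ 2) ≠ ∞ := by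
    intro h
    rw [hNorm, h, ENNReal.top_rpow_of_pos (by norm_num)] at hq
    exact hq.ne rfl
  have h2 := ENNReal.summable_toReal h1
  have hmem : Memℓp (fun i => lam i * inner ℝ (φ i) q) 2 := by
    refine memℓp_gen (h2.congr fun i => ?_)
    rw [Real.rpow_two, ENNReal.toReal_ofReal (by positivity), real_inner_comm]
    simp [mul_pow]
  set h : L2 Ω := (hφ.basis hΩ).repr.symm (⟨_, hmem⟩ : lp (fun _ : ℕ => ℝ) 2) with hh
  have hc : ∀ i, inner ℝ (φ i) h = lam i * inner ℝ (φ i) q := fun i => by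
    rw [← hφ.basis_apply hΩ i, ← HilbertBasis.repr_apply_apply, hh,
      LinearIsometryEquiv.apply_symm_apply, hφ.basis_apply]
  exact ⟨h, hc, hφ.hNorm_two_eq hΩ fun i => by rw [hc i]⟩

theorem IsEigensystem.enorm_le (hφ : IsEigensystem Ω lam φ)
    (hΩ : Bornology.IsBounded (Ω : Set (EuclideanSpace ℝ (Fin d)))) {c : ℝ} (hc : 0 < c)
    (hlam : ∀ i, c ≤ lam i) {q h : L2 Ω}
    (hq : ∀ i, inner ℝ (φ i) h = lam i * inner ℝ (φ i) q) :
    ‖q‖ₑ ≤ ENNReal.ofReal c⁻¹ * ‖h‖ₑ := by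
  have h1 := (hasSum_sq_inner (hφ.basis hΩ) q).mul_left (c ^ 2)
  have h2 := hasSum_sq_inner (hφ.basis hΩ) h
  have h3 : c ^ 2 * ‖q‖ ^ 2 ≤ ‖h‖ ^ 2 := by
    refine hasSum_le (fun i => ?_) h1 h2
    rw [hφ.basis_apply, hq i, mul_pow]
    exact mul_le_mul_of_nonneg_right (pow_le_pow_left₀ hc.le (hlam i) 2) (sq_nonneg _)
  have h4 : c * ‖q‖ ≤ ‖h‖ := by
    rw [← mul_pow] at h3
    exact (sq_le_sq₀ (by positivity) (norm_nonneg _)).1 h3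
  rw [← ofReal_norm, ← ofReal_norm, ← ENNReal.ofReal_mul (by positivity)]
  refine ENNReal.ofReal_le_ofReal ?_
  rw [inv_mul_eq_div, le_div_iff₀ hc]
  linarith

end SpectralNorm

/-! ### Norms of functions of time with values in a Banach space -/

section BochnerNorms

variable {X : Type*} [NormedAddCommGroup X] {T p : ℝ} {u z : ℝ → X}

theorem eLpNorm_const_Ioo (hp : 0 < p) (a : X) :
    eLpNorm (fun _ : ℝ => a) (ENNReal.ofReal p) (volume.restrict (Ioo 0 T)) =
      ‖a‖ₑ * ENNReal.ofReal T ^ (1 / p) := by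
  rw [eLpNorm_const' a (by simpa using hp) ENNReal.ofReal_ne_top, ENNReal.toReal_ofReal hp.le]
  simp

theorem integrableOn_of_memLp (hp : 1 ≤ p)
    (hz : MemLp z (ENNReal.ofReal p) (volume.restrict (Ioo 0 T))) : IntegrableOn z (Ioo 0 T) :=
  hz.integrable (by simpa using ENNReal.ofReal_le_ofReal hp)

variable [NormedSpace ℝ X]

theorem sobolevNorm_le (m : ℕ) (hp : 0 < p) {B : ℝ≥0∞}
    (h : ∀ j ≤ m, eLpNorm (weakDeriv T j u) (ENNReal.ofReal p) (volume.restrict (Ioo 0 T)) ≤ B) :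
    sobolevNorm m p T u ≤ ((m : ℝ≥0∞) + 1) ^ (1 / p) * B := by
  have h1 : ∑ j ∈ Finset.range (m + 1),
      eLpNorm (weakDeriv T j u) (ENNReal.ofReal p) (volume.restrict (Ioo 0 T)) ^ p ≤
        ((m : ℝ≥0∞) + 1) * B ^ p := by
    refine (Finset.sum_le_card_nsmul _ _ (B ^ p) fun j hj => ?_).trans_eq (by simp)
    exact ENNReal.rpow_le_rpow (h j (Nat.lt_succ_iff.1 (Finset.mem_range.1 hj))) hp.le
  refine (ENNReal.rpow_le_rpow h1 (by positivity)).trans_eq ?_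
  rw [ENNReal.mul_rpow_of_nonneg _ _ (by positivity), ← ENNReal.rpow_mul,
    mul_one_div_cancel hp.ne', ENNReal.rpow_one]

theorem eLpNorm_integral_le (hp : 1 ≤ p) (hz : AEStronglyMeasurable z (volume.restrict (Ioo 0 T))) :
    eLpNorm (fun t => ∫ s in (0 : ℝ)..t, z s) (ENNReal.ofReal p) (volume.restrict (Ioo 0 T)) ≤
      ENNReal.ofReal T * eLpNorm z (ENNReal.ofReal p) (volume.restrict (Ioo 0 T)) := by
  have h := eLpNorm_vconv_le_mul_eLpNorm (f := fun _ => 1) hp aestronglyMeasurable_const hz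
  simp only [funext (vconv_one_left z)] at h
  simpa [mul_comm] using h

theorem eLpNorm_integral_le' (hp : 1 ≤ p)
    (hz : AEStronglyMeasurable z (volume.restrict (Ioo 0 T))) :
    eLpNorm (fun t => ∫ s in (0 : ℝ)..t, z s) (ENNReal.ofReal p) (volume.restrict (Ioo 0 T)) ≤
      ENNReal.ofReal T ^ (1 / p) * ∫⁻ t in Ioo 0 T, ‖z t‖ₑ := by
  have h := eLpNorm_vconv_le_eLpNorm_mul (f := fun _ => 1) hp aestronglyMeasurable_const hz
  simp only [funext (vconv_one_left z)] at h
  rwa [eLpNorm_const_Ioo (one_pos.trans_le hp), enorm_one, one_mul] at h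

theorem MemSobolev.isWeakDeriv {m j : ℕ} (h : MemSobolev m p T u) (hj : j ≤ m) :
    IsWeakDeriv T j u (weakDeriv T j u) := by
  obtain ⟨v, hv, -⟩ := h j hj
  exact hv.weakDeriv

theorem MemSobolev.memLp [CompleteSpace X] {m j : ℕ} (h : MemSobolev m p T u) (hj : j ≤ m) :
    MemLp (weakDeriv T j u) (ENNReal.ofReal p) (volume.restrict (Ioo 0 T)) := by
  obtain ⟨v, hv, hvp⟩ := h j hj
  exact hvp.ae_eq (hv.weakDeriv_ae_eq.mono fun t ht => ht.symm)

/-- The function `f ∈ W^{1,1}` as a primitive, with a bound for its initial value. -/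
theorem MemSobolev.exists_primitive [CompleteSpace X] (hT : 0 < T) {f : ℝ → X}
    (hf : MemSobolev 1 1 T f) :
    ∃ (F₀ : X) (f' : ℝ → X), IntegrableOn f' (Ioo 0 T) ∧
      (∀ᵐ t ∂(volume.restrict (Ioo 0 T)), f t = F₀ + ∫ s in (0 : ℝ)..t, f' s) ∧
      ∫⁻ t in Ioo 0 T, ‖f' t‖ₑ ≤ sobolevNorm 1 1 T f ∧
      ‖F₀‖ₑ ≤ ENNReal.ofReal (T⁻¹ + 1) * sobolevNorm 1 1 T f ∧ sobolevNorm 1 1 T f < ∞ := by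
  have hs : sobolevNorm 1 1 T f = (∫⁻ t in Ioo 0 T, ‖weakDeriv T 0 f t‖ₑ) +
      ∫⁻ t in Ioo 0 T, ‖weakDeriv T 1 f t‖ₑ := by
    simp [sobolevNorm, Finset.sum_range_succ, eLpNorm_one_eq_lintegral_enorm]
  have hl0 := hf.memLp (Nat.zero_le 1)
  have hl1 := hf.memLp (le_refl 1)
  have hi0 := integrableOn_of_memLp le_rfl hl0
  have hi1 := integrableOn_of_memLp le_rfl hl1
  have hw1 := hf.isWeakDeriv (le_refl 1)
  have h0 := (isWeakDeriv_zero hw1.1).weakDeriv_ae_eq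
  obtain ⟨F₀, hF⟩ := hw1.exists_ae_eq_primitive hT hi1
  set f' := weakDeriv T 1 f with hf'
  refine ⟨F₀, f', hi1, hF, ?_, ?_, ?_⟩
  · rw [hs]
    exact le_add_self
  -- The initial value is bounded by averaging `F₀ = f - ∫ f'` over `(0, T)`.
  · have h1 : ENNReal.ofReal T * ‖F₀‖ₑ ≤ (∫⁻ t in Ioo 0 T, ‖weakDeriv T 0 f t‖ₑ) +
        ENNReal.ofReal T * ∫⁻ t in Ioo 0 T, ‖f' t‖ₑ := by
      have h2 := eLpNorm_integral_le le_rfl hi1.aestronglyMeasurable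
      simp only [ENNReal.ofReal_one, eLpNorm_one_eq_lintegral_enorm] at h2
      refine le_trans ?_ (add_le_add le_rfl h2)
      rw [← lintegral_add_left' hi0.aestronglyMeasurable.enorm]
      calc ENNReal.ofReal T * ‖F₀‖ₑ = ∫⁻ _ in Ioo 0 T, ‖F₀‖ₑ := by simp [mul_comm]
        _ ≤ _ := by
          refine lintegral_mono_ae ?_
          filter_upwards [hF, h0] with t h1 h3
          rw [h3]
          have : F₀ = f t - ∫ s in (0 : ℝ)..t, f' s := by rw [h1, add_sub_cancel_right]
          rw [this]
          exact enorm_sub_le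
    have hT' : ENNReal.ofReal T⁻¹ * ENNReal.ofReal T = 1 := by
      rw [← ENNReal.ofReal_mul (by positivity), inv_mul_cancel₀ hT.ne', ENNReal.ofReal_one]
    have h2 := mul_le_mul_right h1 (ENNReal.ofReal T⁻¹)
    rw [← mul_assoc, hT', one_mul, mul_add, ← mul_assoc, hT', one_mul] at h2
    refine h2.trans ?_
    rw [ENNReal.ofReal_add (by positivity) zero_le_one, ENNReal.ofReal_one, add_mul, one_mul, hs]
    gcongr
    · exact le_self_add
    · exact le_add_self
  · rw [hs]
    exact ENNReal.add_lt_top.2 ⟨hi0.hasFiniteIntegral, hi1.hasFiniteIntegral⟩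

theorem memLp_rpow {a C : ℝ} (hT : 0 < T) (hp : 0 < p) (ha : p * a < 1) :
    MemLp (fun t : ℝ => C * t ^ (-a)) (ENNReal.ofReal p) (volume.restrict (Ioo 0 T)) := by
  refine MemLp.const_mul ?_ C
  have hm : AEStronglyMeasurable (fun t : ℝ => t ^ (-a)) (volume.restrict (Ioo 0 T)) :=
    (measurable_id.pow_const _).aestronglyMeasurable
  refine (integrable_norm_rpow_iff hm (by simpa using hp) ENNReal.ofReal_ne_top).1 ?_
  rw [ENNReal.toReal_ofReal hp.le]
  refine (integrableOn_rpow_Ioo hT (a := 1 - p * a) (by linarith)).congr_fun (fun t ht => ?_)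
    measurableSet_Ioo
  simp only
  rw [Real.norm_of_nonneg (Real.rpow_nonneg ht.1.le _), ← Real.rpow_mul ht.1.le]
  congr 1
  ring

end BochnerNorms

/-! ### The original problem and the diagonalized equation -/

section Solution

theorem eLpNorm_le_of_norm_le_vconv {H : Type*} [NormedAddCommGroup H] {T p : ℝ} {g : ℝ → ℝ}
    {w y : ℝ → H} {x : H} (hp : 1 ≤ p) (hg : IntegrableOn g (Ioo 0 T))
    (hy : IntegrableOn y (Ioo 0 T))
    (h : ∀ᵐ t ∂(volume.restrict (Ioo 0 T)),
      ‖w t‖ ≤ g t * ‖x‖ + vconv g (fun τ => ‖y τ‖) t) :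
    eLpNorm w (ENNReal.ofReal p) (volume.restrict (Ioo 0 T)) ≤
      eLpNorm g (ENNReal.ofReal p) (volume.restrict (Ioo 0 T)) *
        (‖x‖ₑ + ∫⁻ t in Ioo 0 T, ‖y t‖ₑ) := by
  have hp1 : (1 : ℝ≥0∞) ≤ ENNReal.ofReal p := by simpa using ENNReal.ofReal_le_ofReal hp
  refine (eLpNorm_mono_ae_real h).trans ((eLpNorm_add_le ?_ ?_ hp1).trans ?_)
  · exact hg.aestronglyMeasurable.mul_const _
  · exact (integrableOn_vconv hg hy.norm).aestronglyMeasurable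
  rw [mul_add]
  refine add_le_add ?_ ?_
  · have h1 : (fun t => g t * ‖x‖) = ‖x‖ • g := by
      ext t
      simp [mul_comm]
    rw [h1, eLpNorm_const_smul, enorm_norm, mul_comm]
  · refine (eLpNorm_vconv_le_eLpNorm_mul hp hg.aestronglyMeasurable
      hy.norm.aestronglyMeasurable).trans_eq ?_
    simp

variable {d : ℕ} {Ω : Opens (EuclideanSpace ℝ (Fin d))} {lam : ℕ → ℝ} {φ : ℕ → L2 Ω}
  {T κ L p : ℝ} {α : ℝ → ℝ}

theorem fracDeriv_eq_vconv {u w : ℝ → L2 Ω}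
    (h : ∀ᵐ t ∂(volume.restrict (Ioo 0 T)), weakDeriv T 2 u t = w t) {t : ℝ} (ht : t ∈ Ioo 0 T) :
    fracDeriv α T u t = vconv (kernel α) w t :=
  vconv_congr_right ht (kernel α) h

/-- A solution is the double primitive of its second derivative, which solves the diagonalized
equation. -/
theorem IsSolution.ae_eq_doublePrimitive (hφ : IsEigensystem Ω lam φ) (hT : 0 < T) (hp : 1 ≤ p)
    {f u : ℝ → L2 Ω} {u₀ u₁ : L2 Ω} (hu : IsSolution lam φ α κ p T f u₀ u₁ u) :
    IntegrableOn (weakDeriv T 2 u) (Ioo 0 T) ∧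
    (∀ᵐ t ∂(volume.restrict (Ioo 0 T)), u t = doublePrimitive u₀ u₁ (weakDeriv T 2 u) t) ∧
    ∀ᵐ t ∂(volume.restrict (Ioo 0 T)), ∀ i,
      inner ℝ (φ i) (vconv (kernel α) (weakDeriv T 2 u) t) + κ * lam i * inner ℝ (φ i)
        (doublePrimitive u₀ u₁ (weakDeriv T 2 u) t) = inner ℝ (φ i) (f t) := by
  have h1 := hu.memSobolev.isWeakDeriv (j := 1) (by norm_num)
  have h2 := hu.memSobolev.isWeakDeriv (j := 2) le_rfl
  have hi1 := integrableOn_of_memLp hp (hu.memSobolev.memLp (j := 1) (by norm_num))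
  have hi2 := integrableOn_of_memLp hp (hu.memSobolev.memLp (j := 2) le_rfl)
  obtain ⟨c₁, hc₁⟩ := ((isWeakDeriv_two_iff h1).1 h2).exists_ae_eq_primitive hT hi2
  obtain ⟨c₀, hc₀⟩ := h1.exists_ae_eq_primitive hT hi1
  obtain rfl := HasInitialValue.eq hT hi2 hc₁ hu.initial_velocity
  obtain rfl := HasInitialValue.eq hT hi1 hc₀ hu.initial_value
  have hu2 : ∀ᵐ t ∂(volume.restrict (Ioo 0 T)),
      u t = doublePrimitive c₀ c₁ (weakDeriv T 2 u) t := by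
    filter_upwards [hc₀, ae_restrict_mem measurableSet_Ioo] with t h3 ht
    rw [h3, doublePrimitive, ← vconv_one_left, ← vconv_one_left, vconv_congr_right ht _ hc₁]
  refine ⟨hi2, hu2, ?_⟩
  filter_upwards [hu2, hu.equation, hu.boundary] with t h3 h4 h5 i
  obtain ⟨-, h, hh, heq⟩ := h4
  have h6 := hφ.inner_of_hasWeakLaplacian h5 hh i
  have h7 : vconv (kernel α) (weakDeriv T 2 u) t = f t + κ • h := by
    rw [← heq]
    exact (sub_add_cancel _ _).symm
  rw [← h3, h7, inner_add_right, real_inner_smul_right, h6]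
  ring

/-- The double primitive of a solution of the diagonalized equation is a solution. -/
theorem isSolution_doublePrimitive (hφ : IsEigensystem Ω lam φ)
    (hΩ : Bornology.IsBounded (Ω : Set (EuclideanSpace ℝ (Fin d)))) (hT : 0 < T) (hκ : 0 < κ)
    (hα : IsAdmissibleExponent T L α) (hp : 1 ≤ p) {f w F : ℝ → L2 Ω} {u₀ u₁ : L2 Ω}
    (hf : ∀ᵐ t ∂(volume.restrict (Ioo 0 T)), f t = F t)
    (hw : MemLp w (ENNReal.ofReal p) (volume.restrict (Ioo 0 T)))
    (hh : MemLp (fun t => κ⁻¹ • (vconv (kernel α) w t - F t)) (ENNReal.ofReal p)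
      (volume.restrict (Ioo 0 T)))
    (heq : ∀ᵐ t ∂(volume.restrict (Ioo 0 T)), ∀ i, inner ℝ (φ i) (vconv (kernel α) w t) +
      κ * lam i * inner ℝ (φ i) (doublePrimitive u₀ u₁ w t) = inner ℝ (φ i) (F t)) :
    IsSolution lam φ α κ p T f u₀ u₁ (doublePrimitive u₀ u₁ w) ∧
    (∀ᵐ t ∂(volume.restrict (Ioo 0 T)),
      weakDeriv T 1 (doublePrimitive u₀ u₁ w) t = u₁ + ∫ s in (0 : ℝ)..t, w s) ∧
    (∀ᵐ t ∂(volume.restrict (Ioo 0 T)), weakDeriv T 2 (doublePrimitive u₀ u₁ w) t = w t) ∧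
    lpHNorm lam φ 2 p T (doublePrimitive u₀ u₁ w) =
      eLpNorm (fun t => κ⁻¹ • (vconv (kernel α) w t - F t)) (ENNReal.ofReal p)
        (volume.restrict (Ioo 0 T)) := by
  have hp0 : 0 < p := one_pos.trans_le hp
  have hwi := integrableOn_of_memLp hp hw
  have hu1i := integrableOn_primitive hwi u₁
  have hui : IntegrableOn (doublePrimitive u₀ u₁ w) (Ioo 0 T) := integrableOn_primitive hu1i u₀
  have hd1 : IsWeakDeriv T 1 (doublePrimitive u₀ u₁ w) (fun t => u₁ + ∫ s in (0 : ℝ)..t, w s) :=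
    isWeakDeriv_primitive hT hu1i u₀
  have hd2 : IsWeakDeriv T 2 (doublePrimitive u₀ u₁ w) w :=
    (isWeakDeriv_two_iff hd1).2 (isWeakDeriv_primitive hT hwi u₁)
  have hwd1 := hd1.weakDeriv_ae_eq
  have hwd2 := hd2.weakDeriv_ae_eq
  have hcont : ∀ {z : ℝ → L2 Ω} (a : L2 Ω), IntegrableOn z (Ioo 0 T) →
      MemLp (fun t => a + ∫ s in (0 : ℝ)..t, z s) (ENNReal.ofReal p)
        (volume.restrict (Ioo 0 T)) := by
    intro z a hz
    obtain ⟨B, hB⟩ := isCompact_Icc.exists_bound_of_continuousOn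
      ((continuousOn_const (c := a)).add (continuousOn_primitive hz))
    exact MemLp.of_bound (integrableOn_primitive hz a).aestronglyMeasurable B
      ((ae_restrict_mem measurableSet_Ioo).mono fun t ht => hB t (Ioo_subset_Icc_self ht))
  -- The equation in coordinates says that `κ⁻¹ (k * w - F)` has the coefficients of `A u`. This
  -- gives the Laplacian, the boundary condition and the `Ȟ²` norm together.
  have hinner : ∀ᵐ t ∂(volume.restrict (Ioo 0 T)), ∀ i,
      inner ℝ (φ i) (κ⁻¹ • (vconv (kernel α) w t - F t)) =
        - lam i * inner ℝ (φ i) (doublePrimitive u₀ u₁ w t) := by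
    filter_upwards [heq] with t ht i
    rw [real_inner_smul_right, inner_sub_right, ← ht i]
    field_simp
    ring
  have hnorm : ∀ᵐ t ∂(volume.restrict (Ioo 0 T)), hNorm lam φ 2 (doublePrimitive u₀ u₁ w t) =
      ‖κ⁻¹ • (vconv (kernel α) w t - F t)‖ₑ := by
    filter_upwards [hinner] with t ht
    exact hφ.hNorm_two_eq hΩ fun i => by rw [ht i]; ring
  have hlint : ∫⁻ t in Ioo 0 T, hNorm lam φ 2 (doublePrimitive u₀ u₁ w t) ^ p =
      ∫⁻ t in Ioo 0 T, ‖κ⁻¹ • (vconv (kernel α) w t - F t)‖ₑ ^ p :=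
    lintegral_congr_ae (hnorm.mono fun t ht => by simp only [ht])
  have hlap : ∀ᵐ t ∂(volume.restrict (Ioo 0 T)), MemH10 Ω (doublePrimitive u₀ u₁ w t) ∧
      HasWeakLaplacian Ω (doublePrimitive u₀ u₁ w t)
        (κ⁻¹ • (vconv (kernel α) w t - F t)) :=
    hinner.mono fun t ht => hφ.hasWeakLaplacian_of_inner hΩ ht
  have hlp : lpHNorm lam φ 2 p T (doublePrimitive u₀ u₁ w) =
      eLpNorm (fun t => κ⁻¹ • (vconv (kernel α) w t - F t)) (ENNReal.ofReal p)
        (volume.restrict (Ioo 0 T)) := by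
    rw [lpHNorm, hlint, eLpNorm_ofReal_rpow hp0]
  refine ⟨⟨?_, ⟨hui.aestronglyMeasurable, ?_, ?_⟩, ?_, hlap.mono fun t ht => ht.1, ?_, ?_⟩,
    hwd1, hwd2, hlp⟩
  · intro j hj
    interval_cases j
    · exact ⟨_, isWeakDeriv_zero hui.locallyIntegrableOn, hcont u₀ hu1i⟩
    · exact ⟨_, hd1, hcont u₁ hwi⟩
    · exact ⟨_, hd2, hw⟩
  · filter_upwards [hnorm] with t ht
    rw [ht]
    exact enorm_lt_top
  · rw [hlint]
    have := lintegral_rpow_enorm_lt_top_of_eLpNorm_lt_top (by simpa using hp0)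
      ENNReal.ofReal_ne_top hh.2
    rwa [ENNReal.toReal_ofReal hp0.le] at this
  · have hi := integrableOn_of_memLp hp (hw.ae_eq (hwd2.mono fun t ht => ht.symm))
    filter_upwards [hlap, hf, ae_intervalIntegrable_vconv (integrableOn_kernel hT hα) hi,
      ae_restrict_mem measurableSet_Ioo] with t h1 h2 h3 ht
    refine ⟨h3, _, h1.2, ?_⟩
    rw [fracDeriv_eq_vconv hwd2 ht, smul_smul, mul_inv_cancel₀ hκ.ne', one_smul, h2,
      sub_sub_cancel]
  · exact hasInitialValue_of_ae_eq hu1i u₀ (Eventually.of_forall fun _ => rfl)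
  · exact hasInitialValue_of_ae_eq hwi u₁ hwd1

end Solution

end DiffusionWave

/-! ### The a priori estimate and the assembly of the theorem -/

theorem mainTheorem3 {d : ℕ} (Ω : TopologicalSpace.Opens (EuclideanSpace ℝ (Fin d)))
    (hΩ : Bornology.IsBounded (Ω : Set (EuclideanSpace ℝ (Fin d))))
    (lam : ℕ → ℝ) (φ : ℕ → DiffusionWave.L2 Ω) (hφ : DiffusionWave.IsEigensystem Ω lam φ)
    (T κ L : ℝ) (hT : 0 < T) (hκ : 0 < κ)
    (α : ℝ → ℝ) (hα : DiffusionWave.IsAdmissibleExponent T L α)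
    (p : ℝ) (hp1 : 1 < p) (hp2 : p < 1 / (2 - α 0)) :
    ∃ Q : ℝ, 0 < Q ∧
      ∀ (f : ℝ → DiffusionWave.L2 Ω) (u₀ u₁ : DiffusionWave.L2 Ω),
        DiffusionWave.MemSobolev 1 1 T f →
        DiffusionWave.hNorm lam φ 2 u₀ < ∞ →
        DiffusionWave.hNorm lam φ 2 u₁ < ∞ →
        ∃ u : ℝ → DiffusionWave.L2 Ω,
          DiffusionWave.IsSolution lam φ α κ p T f u₀ u₁ u ∧
          (∀ v : ℝ → DiffusionWave.L2 Ω,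
            DiffusionWave.IsSolution lam φ α κ p T f u₀ u₁ v →
              ∀ᵐ t ∂(volume.restrict (Set.Ioo 0 T)), v t = u t) ∧
          DiffusionWave.sobolevNorm 2 p T u + DiffusionWave.lpHNorm lam φ 2 p T u ≤
            ENNReal.ofReal Q *
              (DiffusionWave.sobolevNorm 1 1 T f + DiffusionWave.hNorm lam φ 2 u₀ +
                DiffusionWave.hNorm lam φ 2 u₁) := by
  have hα0 := hα.range 0 ⟨le_rfl, hT.le⟩
  have hp0 : 0 < p := one_pos.trans hp1
  have hpa : p * (2 - α 0) < 1 := (lt_div_iff₀ (by linarith [hα0.2])).1 hp2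
  obtain ⟨c, hc, hlam⟩ := hφ.exists_forall_le hΩ
  obtain ⟨C, hC, hres⟩ := DiffusionWave.exists_resolvent_kernel hT hα
  have hμ : ∀ i, 0 < κ * lam i := fun i => mul_pos hκ (hc.trans_le (hlam i))
  choose ρ hρ hρg hρe using fun i => hres (κ * lam i) (hμ i)
  have hk := DiffusionWave.integrableOn_kernel hT hα
  set g : ℝ → ℝ := fun t => C * t ^ (-(2 - α 0)) with hg
  -- The only use of the upper bound on `p`: the common majorant of the resolvent kernels lies in
  -- `L^p`.
  have hgp : MemLp g (ENNReal.ofReal p) (volume.restrict (Set.Ioo 0 T)) :=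
    DiffusionWave.memLp_rpow hT hp0 hpa
  have hgi := DiffusionWave.integrableOn_of_memLp hp1.le hgp
  have hρg' : ∀ i, ∀ t ∈ Set.Ioo 0 T, |ρ i t| ≤ g t := fun i t ht => by
    rw [hg, neg_sub]
    exact hρg i t ht
  set I := (volume : Measure ℝ).restrict (Set.Ioo 0 T) with hI
  set P := ENNReal.ofReal p with hP
  have hP1 : 1 ≤ P := ENNReal.one_le_ofReal.2 hp1.le
  set b := hφ.basis hΩ with hb
  have hbφ : ∀ i, b i = φ i := hφ.basis_apply hΩ
  set V := ENNReal.ofReal T ^ (1 / p) with hV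
  set k₁ := ∫⁻ t in Set.Ioo 0 T, ‖DiffusionWave.kernel α t‖ₑ with hk₁
  set K₀ := ENNReal.ofReal (T⁻¹ + 1) with hK₀
  -- The constants `Kw`, `Kv`, `Ku`, `Kh` bound, relative to the norm `N` of the data, the `L^p`
  -- norms of `∂_t² u`, `∂_t u`, `u` and `A u`. In `Kw` the majorant `g` multiplies the bounds for
  -- `F₀ - κ l₀` and `f' - κ l₁`.
  set Kw := eLpNorm g P I * (K₀ + ENNReal.ofReal κ + (1 + ENNReal.ofReal T * ENNReal.ofReal κ))
    with hKw
  set Kv := ENNReal.ofReal c⁻¹ * V + ENNReal.ofReal T * Kw with hKv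
  set Ku := ENNReal.ofReal c⁻¹ * V + ENNReal.ofReal T * Kv with hKu
  set Kh := ENNReal.ofReal κ⁻¹ * (Kw * k₁ + (K₀ * V + V)) with hKh
  set K := ((2 : ℕ) + 1 : ℝ≥0∞) ^ (1 / p) * (Ku + Kv + Kw) + Kh with hK
  have hVt : V < ∞ := ENNReal.rpow_lt_top_of_nonneg (by positivity) ENNReal.ofReal_ne_top
  have hk₁t : k₁ < ∞ := hk.hasFiniteIntegral
  have hKwt : Kw < ∞ := ENNReal.mul_lt_top hgp.2 (by finiteness)
  have hKt : K < ∞ := by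
    have : ((2 : ℕ) + 1 : ℝ≥0∞) ^ (1 / p) < ∞ :=
      ENNReal.rpow_lt_top_of_nonneg (by positivity) (by finiteness)
    rw [hK, hKh, hKu, hKv]
    finiteness
  -- The summand `1` only ensures that the constant is positive.
  refine ⟨K.toReal + 1, by positivity, fun f u₀ u₁ hf hu₀ hu₁ => ?_⟩
  obtain ⟨l₀, hl₀, hn₀⟩ := hφ.exists_of_hNorm_lt_top hΩ hu₀
  obtain ⟨l₁, hl₁, hn₁⟩ := hφ.exists_of_hNorm_lt_top hΩ hu₁
  have hq₀ := hφ.enorm_le hΩ hc hlam hl₀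
  have hq₁ := hφ.enorm_le hΩ hc hlam hl₁
  obtain ⟨F₀, f', hf', hfF, hSf', hSF₀, hSt⟩ := hf.exists_primitive hT
  obtain ⟨w, hwi, hwb, hweq⟩ := DiffusionWave.exists_diagonal_solution b hgi hk hρ hρg' hρe
    (a₀ := u₀) (a₁ := u₁) (l₀ := l₀) (l₁ := l₁) (F₀ := F₀) hf'
    (fun i => by rw [hbφ, hl₀]) (fun i => by rw [hbφ, hl₁])
  have hy : IntegrableOn (fun τ => f' τ - κ • l₁) (Set.Ioo 0 T) :=
    hf'.sub (integrableOn_const (by simp))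
  have hwle := DiffusionWave.eLpNorm_le_of_norm_le_vconv hp1.le hgi hy hwb
  rw [hn₀, hn₁]
  set S := DiffusionWave.sobolevNorm 1 1 T f with hS
  set N := S + ‖l₀‖ₑ + ‖l₁‖ₑ with hN
  have hNt : N < ∞ := by finiteness
  have hSN : S ≤ N := le_self_add.trans le_self_add
  have h0N : ‖l₀‖ₑ ≤ N := le_add_self.trans le_self_add
  have h1N : ‖l₁‖ₑ ≤ N := le_add_self
  have hκe : ‖κ‖ₑ = ENNReal.ofReal κ := Real.enorm_of_nonneg hκ.le
  have hxN : ‖F₀ - κ • l₀‖ₑ ≤ (K₀ + ENNReal.ofReal κ) * N := by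
    refine enorm_sub_le.trans ?_
    rw [enorm_smul, hκe, add_mul]
    gcongr
    exact hSF₀.trans (by gcongr)
  have hyN : ∫⁻ t in Set.Ioo 0 T, ‖f' t - κ • l₁‖ₑ ≤
      (1 + ENNReal.ofReal T * ENNReal.ofReal κ) * N := by
    calc ∫⁻ t in Set.Ioo 0 T, ‖f' t - κ • l₁‖ₑ
        ≤ ∫⁻ t in Set.Ioo 0 T, (‖f' t‖ₑ + ‖κ • l₁‖ₑ) := lintegral_mono fun t => enorm_sub_le
      _ = (∫⁻ t in Set.Ioo 0 T, ‖f' t‖ₑ) + ENNReal.ofReal T * ENNReal.ofReal κ * ‖l₁‖ₑ := by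
        rw [lintegral_add_right _ measurable_const, enorm_smul, hκe]
        simp only [lintegral_const, Measure.restrict_apply_univ, Real.volume_Ioo, sub_zero]
        ring
      _ ≤ _ := by
        rw [add_mul, one_mul]
        gcongr
        exact hSf'.trans hSN
  have hwN : eLpNorm w P I ≤ Kw * N := by
    refine hwle.trans ?_
    rw [hKw, mul_assoc, add_mul (K₀ + ENNReal.ofReal κ)]
    gcongr
  have hwp : MemLp w P I := ⟨hwi.aestronglyMeasurable, hwN.trans_lt (by finiteness)⟩
  have hprim : ∀ (a : DiffusionWave.L2 Ω) (z : ℝ → DiffusionWave.L2 Ω),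
      IntegrableOn z (Set.Ioo 0 T) →
      eLpNorm (fun t => a + ∫ s in (0 : ℝ)..t, z s) P I ≤
        ‖a‖ₑ * V + ENNReal.ofReal T * eLpNorm z P I := by
    intro a z hz
    have hz0 : IntegrableOn (fun t => ∫ s in (0 : ℝ)..t, z s) (Set.Ioo 0 T) := by
      simpa using DiffusionWave.integrableOn_primitive hz 0
    refine (eLpNorm_add_le aestronglyMeasurable_const hz0.aestronglyMeasurable hP1).trans ?_
    rw [DiffusionWave.eLpNorm_const_Ioo hp0]
    gcongr
    exact DiffusionWave.eLpNorm_integral_le hp1.le hz.aestronglyMeasurable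
  have hvN : eLpNorm (fun t => u₁ + ∫ s in (0 : ℝ)..t, w s) P I ≤ Kv * N := by
    refine (hprim u₁ w hwi).trans ?_
    rw [hKv, add_mul, mul_assoc (ENNReal.ofReal T), mul_right_comm]
    gcongr
    exact hq₁.trans (by gcongr)
  have huN : eLpNorm (DiffusionWave.doublePrimitive u₀ u₁ w) P I ≤ Ku * N := by
    refine (hprim u₀ _ (DiffusionWave.integrableOn_primitive hwi u₁)).trans ?_
    rw [hKu, add_mul, mul_assoc (ENNReal.ofReal T), mul_right_comm]
    gcongr
    exact hq₀.trans (by gcongr)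
  set F : ℝ → DiffusionWave.L2 Ω := fun t => F₀ + ∫ s in (0 : ℝ)..t, f' s with hF
  have hFi : IntegrableOn F (Set.Ioo 0 T) := DiffusionWave.integrableOn_primitive hf' F₀
  have hkw := DiffusionWave.integrableOn_vconv hk hwi
  have hhN : eLpNorm (fun t => κ⁻¹ • (DiffusionWave.vconv (DiffusionWave.kernel α) w t - F t)) P I ≤
      Kh * N := by
    have h1 : eLpNorm F P I ≤ (K₀ * V + V) * N := by
      have hz0 : IntegrableOn (fun t => ∫ s in (0 : ℝ)..t, f' s) (Set.Ioo 0 T) := by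
        simpa using DiffusionWave.integrableOn_primitive hf' 0
      refine (eLpNorm_add_le aestronglyMeasurable_const hz0.aestronglyMeasurable hP1).trans ?_
      rw [DiffusionWave.eLpNorm_const_Ioo hp0, add_mul, mul_right_comm]
      gcongr
      · exact hSF₀.trans (by gcongr)
      · refine (DiffusionWave.eLpNorm_integral_le' hp1.le hf'.aestronglyMeasurable).trans ?_
        gcongr
        exact hSf'.trans hSN
    have h2 : eLpNorm (DiffusionWave.vconv (DiffusionWave.kernel α) w) P I ≤ Kw * k₁ * N := by
      refine (DiffusionWave.eLpNorm_vconv_le_mul_eLpNorm hp1.le hk.aestronglyMeasurable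
        hwi.aestronglyMeasurable).trans ?_
      rw [mul_right_comm]
      gcongr
    have h3 : (fun t => κ⁻¹ • (DiffusionWave.vconv (DiffusionWave.kernel α) w t - F t)) =
        κ⁻¹ • (DiffusionWave.vconv (DiffusionWave.kernel α) w - F) := rfl
    rw [h3, eLpNorm_const_smul, Real.enorm_of_nonneg (by positivity), hKh, mul_assoc, add_mul]
    gcongr
    exact (eLpNorm_sub_le hkw.aestronglyMeasurable hFi.aestronglyMeasurable hP1).trans
      (add_le_add h2 h1)
  have hhp : MemLp (fun t => κ⁻¹ •
      (DiffusionWave.vconv (DiffusionWave.kernel α) w t - F t)) P I :=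
    ⟨((hkw.sub hFi).smul κ⁻¹).aestronglyMeasurable, hhN.trans_lt (by rw [hKh]; finiteness)⟩
  have hweq' : ∀ᵐ t ∂I, ∀ i,
      inner ℝ (φ i) (DiffusionWave.vconv (DiffusionWave.kernel α) w t) + κ * lam i *
        inner ℝ (φ i) (DiffusionWave.doublePrimitive u₀ u₁ w t) = inner ℝ (φ i) (F t) := by
    simpa only [hbφ] using hweq
  obtain ⟨hsol, hd1, hd2, hlp⟩ := DiffusionWave.isSolution_doublePrimitive hφ hΩ hT hκ hα hp1.le
    hfF hwp hhp hweq'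
  refine ⟨DiffusionWave.doublePrimitive u₀ u₁ w, hsol, fun v hv => ?_, ?_⟩
  -- Any solution is the double primitive of its second derivative with the same initial data, so
  -- uniqueness reduces to the diagonalized equation.
  · obtain ⟨hvi, hvd, hveq⟩ := hv.ae_eq_doublePrimitive hφ hT hp1.le
    have hveq' : ∀ᵐ t ∂I, ∀ i,
        inner ℝ (b i) (DiffusionWave.vconv (DiffusionWave.kernel α)
          (DiffusionWave.weakDeriv T 2 v) t) + κ * lam i * inner ℝ (b i)
            (DiffusionWave.doublePrimitive u₀ u₁ (DiffusionWave.weakDeriv T 2 v) t) =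
              inner ℝ (b i) (F t) := by
      filter_upwards [hveq, hfF] with t h1 h2 i
      rw [hbφ, h1 i, h2]
    filter_upwards [hvd, DiffusionWave.ae_doublePrimitive_eq_of_equation b hk hρ hρe hvi hwi
      hveq' hweq] with t h1 h2
    rw [h1, h2]
  · have hsob : DiffusionWave.sobolevNorm 2 p T (DiffusionWave.doublePrimitive u₀ u₁ w) ≤
        ((2 : ℕ) + 1 : ℝ≥0∞) ^ (1 / p) * ((Ku + Kv + Kw) * N) := by
      refine DiffusionWave.sobolevNorm_le 2 hp0 fun j hj => ?_
      have hd0 := (DiffusionWave.isWeakDeriv_zero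
        (hsol.memSobolev.isWeakDeriv (j := 1) (by norm_num)).1).weakDeriv_ae_eq
      interval_cases j
      · rw [eLpNorm_congr_ae hd0]
        exact huN.trans (by gcongr; exact le_self_add.trans le_self_add)
      · rw [eLpNorm_congr_ae hd1]
        exact hvN.trans (by gcongr; exact le_add_self.trans le_self_add)
      · rw [eLpNorm_congr_ae hd2]
        exact hwN.trans (by gcongr; exact le_add_self)
    rw [hlp]
    refine (add_le_add hsob hhN).trans ?_
    rw [← mul_assoc, ← add_mul, ← hK]
    gcongr
    rw [← ENNReal.ofReal_toReal hKt.ne]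
    exact ENNReal.ofReal_le_ofReal (by rw [ENNReal.toReal_ofReal ENNReal.toReal_nonneg]; linarith)
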